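/- **Corollary 4.9.** Let $\mathbb K$ be a field of characteristic $0$, let $k\in\mathbb Z$, and let $A_\bullet$ be a cosimplicial object in the category of unital ($\mathbb Z$-graded, differential $d_n$ of degree $+1$) differential graded commutative $\mathbb K$-algebras. Let $i_\bullet\colon A_\bullet\to A_\bullet$ be a cosimplicial linear map, i.e. a family of $\mathbb K$-linear maps $i_n\colon A_n\to A_n$ commuting with all the cosimplicial structure maps. Write $[f,g]=fg-(-1)^{|f||g|}gf$ for the graded commutator of homogeneous operators and $l_n=[i_n,d_n]$. Call a homogeneous operator $f$ on a graded commutative algebra *quasi-Batalin–Vilkovisky* if it is a differential operator of order $\le 2$ (i.e. $[[[f,a],b],c]=0$ for all homogeneous $a,b,c$, viewed as left multiplications) and $f(1)=0$. Assume that for every $n\ge 0$ * $i_n$ is a quasi-Batalin–Vilkovisky operator of degree $-2k$, and * $[l_n,i_n]$ is a quasi-Batalin–Vilkovisky operator (of degree $1-4k$). Then for every $n$ the shifted complex $A_n[2k-1]$, $A_n[2k-1]^p=A_n^{2k-1+p}$, with the differential $d_n$ and the bracket $$[a,b]_{l_n}=(-1)^{\bar a}\bigl(l_n(ab)-l_n(a)b\bigr)-a\,l_n(b)$$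 ($\bar a$ the degree of $a$ in $A_n$) is a differential graded Lie algebra (DGLA), so that $(A_\bullet[2k-1],d_\bullet,[\,,]_{l_\bullet})$ is a cosimplicial DGLA, and its totalization is homotopy abelian, i.e. it is connected by a finite zigzag of quasi-isomorphisms of DGLAs to a DGLA with zero bracket. Here the totalization of a cosimplicial DGLA $L_\bullet$ is the Thom–Whitney DGLA $\operatorname{Tot}(L_\bullet)=\bigoplus_{p}\operatorname{Tot}^p$, $$\operatorname{Tot}^p=\Bigl\{(x_n)\in\prod_{n\ge0}(\Omega_n\otimes L_n)^p\ :\ (\varphi^*\otimes \mathrm{id})x_n=(\mathrm{id}\otimes\varphi_*)x_m\ \text{ in }\Omega_m\otimes L_n\text{ for every monotone }\varphi\colon[m]\to[n]\Bigr\},$$ with componentwise differential and bracket, where $\Omega_n=\mathbb K[t_0,\dots,t_n,dt_0,\dots,dt_n]/(\sum t_i-1,\sum dt_i)$ is the DG algebra of polynomial differential forms on the $n$-simplex, and on $\Omega_n\otimes L_n$ one has $d(\omega\otimes a)=d\omega\otimes a+(-1)^{|\omega|}\omega\otimes da$ and $[\omega\otimes a,\eta\otimes b]=(-1)^{|a||\eta|}\omega\eta\otimes[a,b]$.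 -/

import Mathlib

open CategoryTheory

/-- The relations between the generators `tᵢ` (index `inl i`) and `dtᵢ` (index `inr i`),
`0 ≤ i ≤ n`, of the algebra of polynomial differential forms on the `n`-simplex: graded
commutativity, `∑ tᵢ = 1` and `∑ dtᵢ = 0`. -/
inductive PolyFormsRel (K : Type*) [Field K] (n : ℕ) :
    FreeAlgebra K (Fin (n + 1) ⊕ Fin (n + 1)) → FreeAlgebra K (Fin (n + 1) ⊕ Fin (n + 1)) → Prop
  | t_t (i j : Fin (n + 1)) : PolyFormsRel K n
      (FreeAlgebra.ι K (Sum.inl i) * FreeAlgebra.ι K (Sum.inl j))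
      (FreeAlgebra.ι K (Sum.inl j) * FreeAlgebra.ι K (Sum.inl i))
  | t_dt (i j : Fin (n + 1)) : PolyFormsRel K n
      (FreeAlgebra.ι K (Sum.inl i) * FreeAlgebra.ι K (Sum.inr j))
      (FreeAlgebra.ι K (Sum.inr j) * FreeAlgebra.ι K (Sum.inl i))
  | dt_dt (i j : Fin (n + 1)) : PolyFormsRel K n
      (FreeAlgebra.ι K (Sum.inr i) * FreeAlgebra.ι K (Sum.inr j))
      (-(FreeAlgebra.ι K (Sum.inr j) * FreeAlgebra.ι K (Sum.inr i)))
  | sum_t : PolyFormsRel K n (∑ i, FreeAlgebra.ι K (Sum.inl i)) 1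
  | sum_dt : PolyFormsRel K n (∑ i, FreeAlgebra.ι K (Sum.inr i)) 0

/-- Polynomial differential forms on the `n`-simplex,
`Ωₙ = K[t₀, …, tₙ, dt₀, …, dtₙ] / (∑ tᵢ - 1, ∑ dtᵢ)` with `tᵢ` of degree `0` and `dtᵢ` of
degree `1`. -/
def PolyForms (K : Type*) [Field K] (n : ℕ) : Type _ := RingQuot (PolyFormsRel K n)

namespace PolyForms

variable (K : Type*) [Field K] (n : ℕ)

noncomputable instance instRing : Ring (PolyForms K n) :=
  inferInstanceAs (Ring (RingQuot (PolyFormsRel K n)))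

noncomputable instance instAlgebra : Algebra K (PolyForms K n) :=
  inferInstanceAs (Algebra K (RingQuot (PolyFormsRel K n)))

/-- The quotient map. -/
noncomputable def mk : FreeAlgebra K (Fin (n + 1) ⊕ Fin (n + 1)) →ₐ[K] PolyForms K n :=
  RingQuot.mkAlgHom K (PolyFormsRel K n)

theorem mk_surjective : Function.Surjective (mk K n) :=
  RingQuot.mkAlgHom_surjective K (PolyFormsRel K n)

theorem mk_rel {x y : FreeAlgebra K (Fin (n + 1) ⊕ Fin (n + 1))} (h : PolyFormsRel K n x y) :
    mk K n x = mk K n y :=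
  RingQuot.mkAlgHom_rel K h

/-- The generators: `gen (inl i) = tᵢ` and `gen (inr i) = dtᵢ`. -/
noncomputable def gen (x : Fin (n + 1) ⊕ Fin (n + 1)) : PolyForms K n :=
  mk K n (FreeAlgebra.ι K x)

/-- The barycentric coordinate `tᵢ`. -/
noncomputable abbrev t (i : Fin (n + 1)) : PolyForms K n := gen K n (Sum.inl i)

/-- The one-form `dtᵢ`. -/
noncomputable abbrev dt (i : Fin (n + 1)) : PolyForms K n := gen K n (Sum.inr i)

theorem t_mul_t (i j : Fin (n + 1)) : t K n i * t K n j = t K n j * t K n i := by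
  simpa [t, gen] using mk_rel K n (PolyFormsRel.t_t i j)

theorem t_mul_dt (i j : Fin (n + 1)) : t K n i * dt K n j = dt K n j * t K n i := by
  simpa [t, gen] using mk_rel K n (PolyFormsRel.t_dt i j)

theorem dt_mul_dt (i j : Fin (n + 1)) : dt K n i * dt K n j = -(dt K n j * dt K n i) := by
  simpa [t, gen] using mk_rel K n (PolyFormsRel.dt_dt i j)

theorem sum_t : ∑ i, t K n i = 1 := by
  simpa [t, gen] using mk_rel K n PolyFormsRel.sum_t

theorem sum_dt : ∑ i, dt K n i = 0 := by
  simpa [t, gen] using mk_rel K n PolyFormsRel.sum_dt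

section lift

variable {K n} {B : Type*} [Ring B] [Algebra K B]

/-- The universal property of polynomial forms. -/
noncomputable def lift (τ δ : Fin (n + 1) → B)
    (h₁ : ∀ i j, τ i * τ j = τ j * τ i) (h₂ : ∀ i j, τ i * δ j = δ j * τ i)
    (h₃ : ∀ i j, δ i * δ j = -(δ j * δ i)) (h₄ : ∑ i, τ i = 1) (h₅ : ∑ i, δ i = 0) :
    PolyForms K n →ₐ[K] B :=
  RingQuot.liftAlgHom K ⟨FreeAlgebra.lift K (Sum.elim τ δ), by
    intro x y h
    cases h <;> simp [h₁, h₂, h₄, h₅]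
    rename_i i j
    exact h₃ i j⟩

variable (τ δ : Fin (n + 1) → B)
    (h₁ : ∀ i j, τ i * τ j = τ j * τ i) (h₂ : ∀ i j, τ i * δ j = δ j * τ i)
    (h₃ : ∀ i j, δ i * δ j = -(δ j * δ i)) (h₄ : ∑ i, τ i = 1) (h₅ : ∑ i, δ i = 0)

theorem lift_gen (x : Fin (n + 1) ⊕ Fin (n + 1)) :
    lift τ δ h₁ h₂ h₃ h₄ h₅ (gen K n x) = Sum.elim τ δ x := by
  unfold lift gen mk
  exact (RingQuot.liftAlgHom_mkAlgHom_apply _ _ _ _).trans (by simp)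

@[simp] theorem lift_t (i : Fin (n + 1)) : lift τ δ h₁ h₂ h₃ h₄ h₅ (t K n i) = τ i :=
  lift_gen τ δ h₁ h₂ h₃ h₄ h₅ _

@[simp] theorem lift_dt (i : Fin (n + 1)) : lift τ δ h₁ h₂ h₃ h₄ h₅ (dt K n i) = δ i :=
  lift_gen τ δ h₁ h₂ h₃ h₄ h₅ _

@[elab_as_elim]
theorem induction {P : PolyForms K n → Prop} (hc : ∀ r, P (algebraMap K _ r))
    (ht : ∀ i, P (t K n i)) (hdt : ∀ i, P (dt K n i))
    (hm : ∀ a b, P a → P b → P (a * b)) (ha : ∀ a b, P a → P b → P (a + b))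
    (x : PolyForms K n) : P x := by
  obtain ⟨x, rfl⟩ := mk_surjective K n x
  induction x with
  | grade0 r => rw [AlgHom.commutes]; exact hc r
  | grade1 x => cases x; exacts [ht _, hdt _]
  | mul a b iha ihb => rw [map_mul]; exact hm _ _ iha ihb
  | add a b iha ihb => rw [map_add]; exact ha _ _ iha ihb

theorem hom_ext {f g : PolyForms K n →ₐ[K] B} (ht : ∀ i, f (t K n i) = g (t K n i))
    (hdt : ∀ i, f (dt K n i) = g (dt K n i)) : f = g := by
  ext x
  induction x using induction with
  | hc r => simp
  | ht i => exact ht i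
  | hdt i => exact hdt i
  | hm a b iha ihb => simp [iha, ihb]
  | ha a b iha ihb => simp [iha, ihb]

end lift

/-- Forms of degree `p`: the span of the products of generators with exactly `p` factors `dtᵢ`. -/
noncomputable def gr (p : ℤ) : Submodule K (PolyForms K n) :=
  Submodule.span K {x | ∃ l : List (Fin (n + 1) ⊕ Fin (n + 1)),
    ((l.countP Sum.isRight : ℕ) : ℤ) = p ∧ (l.map (gen K n)).prod = x}

variable {K n} in
theorem t_mem (i : Fin (n + 1)) : t K n i ∈ gr K n 0 :=
  Submodule.subset_span ⟨[Sum.inl i], by simp, by simp⟩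

variable {K n} in
theorem dt_mem (i : Fin (n + 1)) : dt K n i ∈ gr K n 1 :=
  Submodule.subset_span ⟨[Sum.inr i], by simp, by simp⟩

instance gr_gradedMonoid : SetLike.GradedMonoid (gr K n) where
  one_mem := Submodule.subset_span ⟨[], by simp, by simp⟩
  mul_mem p q x y hx hy := by
    have := Submodule.mul_mem_mul hx hy
    unfold gr at this
    rw [Submodule.span_mul_span] at this
    refine Submodule.span_mono ?_ this
    rintro _ ⟨_, ⟨l, rfl, rfl⟩, _, ⟨m, rfl, rfl⟩, rfl⟩
    exact ⟨l ++ m, by simp, by simp⟩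

/-- The map decomposing a form into its homogeneous components. -/
noncomputable def decomposeHom : PolyForms K n →ₐ[K] DirectSum ℤ (fun p => gr K n p) :=
  lift (fun i => DirectSum.of (fun p => gr K n p) 0 ⟨t K n i, t_mem i⟩)
    (fun i => DirectSum.of (fun p => gr K n p) 1 ⟨dt K n i, dt_mem i⟩)
    (fun i j => by
      rw [DirectSum.of_mul_of, DirectSum.of_mul_of]
      congr 1
      exact Subtype.ext (t_mul_t K n i j))
    (fun i j => by
      rw [DirectSum.of_mul_of, DirectSum.of_mul_of]
      exact DirectSum.of_eq_of_gradedMonoid_eq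
        (Sigma.subtype_ext (add_comm (0 : ℤ) 1) (t_mul_dt K n i j)))
    (fun i j => by
      rw [DirectSum.of_mul_of, DirectSum.of_mul_of, ← map_neg]
      congr 1
      exact Subtype.ext (dt_mul_dt K n i j))
    (by
      rw [← map_sum, DirectSum.one_def]
      congr 1
      exact Subtype.ext (by simpa using sum_t K n))
    (by
      rw [← map_sum, ← map_zero (DirectSum.of (fun p => gr K n p) 1)]
      congr 1
      exact Subtype.ext (by simpa using sum_dt K n))

theorem decomposeHom_list (l : List (Fin (n + 1) ⊕ Fin (n + 1)))
    (h : (l.map (gen K n)).prod ∈ gr K n ((l.countP Sum.isRight : ℕ) : ℤ)) :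
    decomposeHom K n (l.map (gen K n)).prod
      = DirectSum.of (fun p => gr K n p) ((l.countP Sum.isRight : ℕ) : ℤ) ⟨_, h⟩ := by
  induction l with
  | nil => simp; rfl
  | cons x l ih =>
    have h' : (l.map (gen K n)).prod ∈ gr K n ((l.countP Sum.isRight : ℕ) : ℤ) :=
      Submodule.subset_span ⟨l, rfl, rfl⟩
    have hl : decomposeHom K n ((x :: l).map (gen K n)).prod = decomposeHom K n (gen K n x) *
        DirectSum.of (fun p => gr K n p) ((l.countP Sum.isRight : ℕ) : ℤ) ⟨_, h'⟩ := by
      rw [List.map_cons, List.prod_cons, map_mul, ih h']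
    rw [hl]
    cases x with
    | inl i =>
      rw [show decomposeHom K n (gen K n (Sum.inl i)) =
        DirectSum.of (fun p => gr K n p) 0 ⟨t K n i, t_mem i⟩ from lift_t ..,
        DirectSum.of_mul_of]
      have e : 0 + ((l.countP Sum.isRight : ℕ) : ℤ)
          = (((Sum.inl i :: l).countP Sum.isRight : ℕ) : ℤ) := by simp
      exact DirectSum.of_eq_of_gradedMonoid_eq (Sigma.subtype_ext e rfl)
    | inr i =>
      rw [show decomposeHom K n (gen K n (Sum.inr i)) =
        DirectSum.of (fun p => gr K n p) 1 ⟨dt K n i, dt_mem i⟩ from lift_dt ..,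
        DirectSum.of_mul_of]
      have e : 1 + ((l.countP Sum.isRight : ℕ) : ℤ)
          = (((Sum.inr i :: l).countP Sum.isRight : ℕ) : ℤ) := by
        rw [List.countP_cons_of_pos (by rfl)]
        push_cast
        ring
      exact DirectSum.of_eq_of_gradedMonoid_eq (Sigma.subtype_ext e rfl)

noncomputable instance gr_gradedAlgebra : GradedAlgebra (gr K n) :=
  GradedAlgebra.ofAlgHom (gr K n) (decomposeHom K n)
    (hom_ext (fun i => by
        rw [AlgHom.comp_apply, show decomposeHom K n (t K n i) =
          DirectSum.of (fun p => gr K n p) 0 ⟨t K n i, t_mem i⟩ from lift_t ..]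
        exact DirectSum.coeAlgHom_of _ _ _)
      (fun i => by
        rw [AlgHom.comp_apply, show decomposeHom K n (dt K n i) =
          DirectSum.of (fun p => gr K n p) 1 ⟨dt K n i, dt_mem i⟩ from lift_dt ..]
        exact DirectSum.coeAlgHom_of _ _ _))
    (by
      rintro p ⟨x, hx⟩
      induction hx using Submodule.span_induction with
      | mem x h =>
        obtain ⟨l, rfl, rfl⟩ := h
        exact decomposeHom_list K n l _
      | zero =>
        simp only [map_zero]
        exact (map_zero (DirectSum.of (fun p => gr K n p) p)).symm
      | add x y hx hy ihx ihy =>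
        simp only [map_add] at ihx ihy ⊢
        rw [ihx, ihy, ← map_add]; rfl
      | smul r x hx ih =>
        simp only [map_smul] at ih ⊢
        rw [ih]
        exact (map_smul (DirectSum.lof K ℤ (fun p => gr K n p) p) r ⟨x, hx⟩).symm)

/-- The parity involution `ω ↦ (-1)^|ω| ω`. -/
noncomputable def parity : PolyForms K n →ₐ[K] PolyForms K n :=
  lift (t K n) (fun i => -dt K n i) (t_mul_t K n)
    (fun i j => by simp [t_mul_dt])
    (fun i j => by simpa using dt_mul_dt K n i j)
    (sum_t K n) (by simp [sum_dt])

/-- The algebra map `ω ↦ !![(-1)^|ω| ω, dω; 0, ω]` determined by `d tᵢ = dtᵢ` and `d dtᵢ = 0`. -/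
noncomputable def dMatrix : PolyForms K n →ₐ[K] Matrix (Fin 2) (Fin 2) (PolyForms K n) :=
  lift (fun i => !![t K n i, dt K n i; 0, t K n i]) (fun i => !![-dt K n i, 0; 0, dt K n i])
    (fun i j => by
      simp [t_mul_t K n i j]
      rw [t_mul_dt K n i j, t_mul_dt K n j i, add_comm])
    (fun i j => by
      simp [t_mul_dt K n i j]
      exact dt_mul_dt K n i j)
    (fun i j => by
      ext a b
      fin_cases a <;> fin_cases b <;> simp [Matrix.mul_apply] <;> exact dt_mul_dt K n i j)
    (by
      ext a b
      fin_cases a <;> fin_cases b <;> simp [Matrix.sum_apply, sum_t, sum_dt])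
    (by
      ext a b
      fin_cases a <;> fin_cases b <;> simp [Matrix.sum_apply, sum_dt])

/-- The de Rham differential: the derivation with `d tᵢ = dtᵢ` and `d dtᵢ = 0`. -/
noncomputable def d : PolyForms K n →ₗ[K] PolyForms K n :=
  Matrix.entryLinearMap K (PolyForms K n) 0 1 ∘ₗ (dMatrix K n).toLinearMap

variable {K n}

theorem d_apply (x : PolyForms K n) : d K n x = dMatrix K n x 0 1 := rfl

@[simp] theorem parity_t (i : Fin (n + 1)) : parity K n (t K n i) = t K n i := lift_t ..
@[simp] theorem parity_dt (i : Fin (n + 1)) : parity K n (dt K n i) = -dt K n i := lift_dt ..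

theorem dMatrix_apply (x : PolyForms K n) :
    dMatrix K n x = !![parity K n x, d K n x; 0, x] := by
  have key : dMatrix K n x 0 0 = parity K n x ∧ dMatrix K n x 1 0 = 0 ∧ dMatrix K n x 1 1 = x := by
    induction x using induction with
    | hc r => simp [Matrix.algebraMap_matrix_apply]
    | ht i => rw [show dMatrix K n (t K n i) = _ from lift_t ..]; simp
    | hdt i => rw [show dMatrix K n (dt K n i) = _ from lift_dt ..]; simp
    | hm a b iha ihb => simp [Matrix.mul_apply, iha, ihb]
    | ha a b iha ihb => simp [iha, ihb]
  ext a b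
  fin_cases a <;> fin_cases b <;> simp [key, d_apply]

@[simp] theorem d_t (i : Fin (n + 1)) : d K n (t K n i) = dt K n i := by
  rw [d_apply, show dMatrix K n (t K n i) = _ from lift_t ..]; simp

@[simp] theorem d_dt (i : Fin (n + 1)) : d K n (dt K n i) = 0 := by
  rw [d_apply, show dMatrix K n (dt K n i) = _ from lift_dt ..]; simp

@[simp] theorem d_algebraMap (r : K) : d K n (algebraMap K _ r) = 0 := by
  rw [d_apply, AlgHom.commutes]; simp [Matrix.algebraMap_matrix_apply]

theorem d_mul (x y : PolyForms K n) : d K n (x * y) = d K n x * y + parity K n x * d K n y := by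
  rw [d_apply, map_mul, dMatrix_apply, dMatrix_apply]
  simp [Matrix.mul_apply, add_comm]

theorem parity_parity (x : PolyForms K n) : parity K n (parity K n x) = x := by
  induction x using induction <;> simp_all

theorem d_parity (x : PolyForms K n) : d K n (parity K n x) = -parity K n (d K n x) := by
  induction x using induction <;> simp_all [d_mul, parity_parity]
  all_goals abel

theorem d_d (x : PolyForms K n) : d K n (d K n x) = 0 := by
  induction x using induction <;> simp_all [d_mul, parity_parity, d_parity]

theorem gr_induction {P : ℤ → PolyForms K n → Prop}
    (h1 : P 0 1) (ht : ∀ p i x, x ∈ gr K n p → P p x → P p (t K n i * x))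
    (hdt : ∀ p i x, x ∈ gr K n p → P p x → P (1 + p) (dt K n i * x))
    (h0 : ∀ p, P p 0) (ha : ∀ p x y, P p x → P p y → P p (x + y))
    (hs : ∀ p (r : K) x, P p x → P p (r • x))
    {p : ℤ} {x : PolyForms K n} (hx : x ∈ gr K n p) : P p x := by
  induction hx using Submodule.span_induction with
  | mem x h =>
    obtain ⟨l, rfl, rfl⟩ := h
    induction l with
    | nil => simpa using h1
    | cons a l ih =>
      have h' : (l.map (gen K n)).prod ∈ gr K n ((l.countP Sum.isRight : ℕ) : ℤ) :=
        Submodule.subset_span ⟨l, rfl, rfl⟩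
      cases a with
      | inl i => simpa using ht _ i _ h' ih
      | inr i => 
        have := hdt _ i _ h' ih
        rw [List.countP_cons, List.map_cons, List.prod_cons]
        simpa [add_comm] using this
  | zero => exact h0 p
  | add x y _ _ ihx ihy => exact ha p x y ihx ihy
  | smul r x _ ih => exact hs p r x ih

theorem parity_of_mem {p : ℤ} {x : PolyForms K n} (hx : x ∈ gr K n p) :
    parity K n x = p.negOnePow • x := by
  refine gr_induction (P := fun p x => parity K n x = p.negOnePow • x) ?_ ?_ ?_ ?_ ?_ ?_ hx
  · simp
  · intro p i x _ ih
    simp [ih, mul_smul_comm]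
  · intro p i x _ ih
    simp [ih, mul_smul_comm, Int.negOnePow_add]
  · intro p
    simp
  · intro p x y hx hy
    simp [hx, hy]
  · intro p r x ih
    rw [map_smul, ih, smul_comm]

theorem d_mem {p : ℤ} {x : PolyForms K n} (hx : x ∈ gr K n p) : d K n x ∈ gr K n (p + 1) := by
  refine gr_induction (P := fun p x => d K n x ∈ gr K n (p + 1)) ?_ ?_ ?_ ?_ ?_ ?_ hx
  · rw [show (1 : PolyForms K n) = algebraMap K _ 1 by simp, d_algebraMap]; exact zero_mem _
  · intro p i x hx ih
    rw [d_mul, d_t, parity_t]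
    refine add_mem ?_ ?_
    · rw [add_comm]; exact SetLike.mul_mem_graded (dt_mem i) hx
    · simpa using SetLike.mul_mem_graded (t_mem i) ih
  · intro p i x hx ih
    rw [d_mul, d_dt, parity_dt, zero_mul, zero_add, neg_mul, add_assoc]
    exact neg_mem (SetLike.mul_mem_graded (dt_mem i) ih)
  · intro p
    simp
  · intro p x y hx hy
    rw [map_add]; exact add_mem hx hy
  · intro p r x ih
    rw [map_smul]; exact Submodule.smul_mem _ _ ih

theorem t_comm (i : Fin (n + 1)) (x : PolyForms K n) : x * t K n i = t K n i * x := by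
  induction x using induction with
  | hc r => exact Algebra.commutes r _
  | ht j => exact t_mul_t K n j i
  | hdt j => exact (t_mul_dt K n i j).symm
  | hm a b iha ihb => rw [mul_assoc, ihb, ← mul_assoc, iha, mul_assoc]
  | ha a b iha ihb => rw [add_mul, mul_add, iha, ihb]

theorem dt_comm (i : Fin (n + 1)) (x : PolyForms K n) :
    dt K n i * x = parity K n x * dt K n i := by
  induction x using induction with
  | hc r => simpa using (Algebra.commutes r (dt K n i)).symm
  | ht j => simpa using (t_mul_dt K n j i).symm
  | hdt j => simpa using dt_mul_dt K n i j
  | hm a b iha ihb => rw [← mul_assoc, iha, mul_assoc, ihb, ← mul_assoc, map_mul]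
  | ha a b iha ihb => rw [mul_add, map_add, add_mul, iha, ihb]

theorem mul_comm_of_mem {p q : ℤ} {x y : PolyForms K n} (hx : x ∈ gr K n p) (hy : y ∈ gr K n q) :
    x * y = (p * q).negOnePow • (y * x) := by
  refine gr_induction (P := fun p x => x * y = (p * q).negOnePow • (y * x)) ?_ ?_ ?_ ?_ ?_ ?_ hx
  · simp
  · intro p i x _ ih
    rw [mul_assoc, ih, mul_smul_comm, ← mul_assoc, ← mul_assoc, t_comm]
  · intro p i x _ ih
    rw [mul_assoc, ih, mul_smul_comm, ← mul_assoc, dt_comm, parity_of_mem hy, smul_mul_assoc,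
      smul_mul_assoc, smul_smul, ← Int.negOnePow_add, mul_assoc]
    congr 2
    ring
  · intro p
    simp
  · intro p x x' hx hx'
    rw [add_mul, hx, hx', mul_add, smul_add]
  · intro p r x ih
    rw [smul_mul_assoc, ih, mul_smul_comm, smul_comm]

/-- Pull-back of forms along the affine map of simplices given by `φ` on vertices,
`tᵢ ↦ ∑_{φ j = i} tⱼ` and `dtᵢ ↦ ∑_{φ j = i} dtⱼ`. -/
noncomputable def pullback {m n : ℕ} (φ : Fin (m + 1) → Fin (n + 1)) :
    PolyForms K n →ₐ[K] PolyForms K m :=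
  lift (fun i => ∑ j with φ j = i, t K m j) (fun i => ∑ j with φ j = i, dt K m j)
    (fun i j => Finset.sum_mul_sum _ _ _ _ |>.trans <| by
      rw [Finset.sum_comm, Finset.sum_mul_sum]; simp only [t_mul_t])
    (fun i j => by
      rw [Finset.sum_mul_sum, Finset.sum_comm, Finset.sum_mul_sum]; simp only [t_mul_dt])
    (fun i j => by
      rw [Finset.sum_mul_sum, Finset.sum_comm, Finset.sum_mul_sum]
      simp only [← Finset.sum_neg_distrib]
      exact Finset.sum_congr rfl fun _ _ => Finset.sum_congr rfl fun _ _ => dt_mul_dt ..)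
    (by rw [Finset.sum_fiberwise, sum_t])
    (by rw [Finset.sum_fiberwise, sum_dt])

@[simp] theorem pullback_t {m n : ℕ} (φ : Fin (m + 1) → Fin (n + 1)) (i : Fin (n + 1)) :
    pullback φ (t K n i) = ∑ j with φ j = i, t K m j := lift_t ..

@[simp] theorem pullback_dt {m n : ℕ} (φ : Fin (m + 1) → Fin (n + 1)) (i : Fin (n + 1)) :
    pullback φ (dt K n i) = ∑ j with φ j = i, dt K m j := lift_dt ..

theorem pullback_parity {m n : ℕ} (φ : Fin (m + 1) → Fin (n + 1)) (x : PolyForms K n) :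
    pullback φ (parity K n x) = parity K m (pullback φ x) := by
  induction x using induction <;> simp_all

theorem pullback_d {m n : ℕ} (φ : Fin (m + 1) → Fin (n + 1)) (x : PolyForms K n) :
    pullback φ (d K n x) = d K m (pullback φ x) := by
  induction x using induction <;> simp_all [d_mul, pullback_parity]

theorem pullback_mem {m n : ℕ} (φ : Fin (m + 1) → Fin (n + 1)) {p : ℤ} {x : PolyForms K n}
    (hx : x ∈ gr K n p) : pullback φ x ∈ gr K m p := by
  refine gr_induction (P := fun p x => pullback φ x ∈ gr K m p) ?_ ?_ ?_ ?_ ?_ ?_ hx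
  · rw [map_one]; exact SetLike.GradedOne.one_mem
  · intro p i x hx ih
    rw [map_mul, pullback_t]
    simpa using SetLike.mul_mem_graded (sum_mem fun j _ => t_mem j) ih
  · intro p i x hx ih
    rw [map_mul, pullback_dt]
    exact SetLike.mul_mem_graded (sum_mem fun j _ => dt_mem j) ih
  · intro p
    simp
  · intro p x y hx hy
    rw [map_add]; exact add_mem hx hy
  · intro p r x ih
    rw [map_smul]; exact Submodule.smul_mem _ _ ih

theorem pullback_id (x : PolyForms K n) : pullback id x = x := by
  induction x using induction <;> simp_all [Finset.filter_eq']

theorem pullback_comp {l m n : ℕ} (ψ : Fin (l + 1) → Fin (m + 1)) (φ : Fin (m + 1) → Fin (n + 1))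
    (x : PolyForms K n) : pullback (φ ∘ ψ) x = pullback ψ (pullback φ x) := by
  have key : ∀ (i : Fin (n + 1)) (f : Fin (l + 1) → PolyForms K l),
      ∑ j with φ (ψ j) = i, f j = ∑ k with φ k = i, ∑ j with ψ j = k, f j := by
    intro i f
    simp only [Finset.sum_filter]
    rw [← Finset.sum_fiberwise Finset.univ ψ]
    refine Finset.sum_congr rfl fun k _ => ?_
    rw [Finset.sum_filter]
    split_ifs with h
    · exact Finset.sum_congr rfl fun j _ => by aesop
    · exact Finset.sum_eq_zero fun j _ => by aesop
  induction x using induction <;> simp_all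

end PolyForms

universe u v w

section graded

variable {K : Type*} [Field K] {M : Type*} [AddCommGroup M] [Module K M]

/-- The operator on the graded vector space `M = ⨁ₚ gr p` acting on `gr p` as multiplication by
the integer `c p`. -/
noncomputable def gradedScale {gr : ℤ → Submodule K M} (h : DirectSum.IsInternal gr) (c : ℤ → ℤ) :
    M →ₗ[K] M :=
  DirectSum.toModule K ℤ M (fun p => c p • (gr p).subtype) ∘ₗ
    (LinearEquiv.ofBijective (DirectSum.coeLinearMap gr) h).symm.toLinearMap

theorem internal_symm_apply {gr : ℤ → Submodule K M} (h : DirectSum.IsInternal gr)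
    {p : ℤ} {x : M} (hx : x ∈ gr p) :
    (LinearEquiv.ofBijective (DirectSum.coeLinearMap gr) h).symm x
      = DirectSum.lof K ℤ (fun p => gr p) p ⟨x, hx⟩ := by
  exact (LinearEquiv.symm_apply_eq _).2 (DirectSum.coeLinearMap_lof gr p ⟨x, hx⟩).symm

theorem gradedScale_apply {gr : ℤ → Submodule K M} (h : DirectSum.IsInternal gr) (c : ℤ → ℤ)
    {p : ℤ} {x : M} (hx : x ∈ gr p) : gradedScale h c x = c p • x := by
  rw [gradedScale, LinearMap.comp_apply, LinearEquiv.coe_coe, internal_symm_apply h hx,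
    DirectSum.toModule_lof]
  rfl

/-- To prove a linear statement on a graded vector space it is enough to treat homogeneous
elements. -/
theorem graded_induction {gr : ℤ → Submodule K M} (h : DirectSum.IsInternal gr) {P : M → Prop}
    (hm : ∀ p x, x ∈ gr p → P x) (ha : ∀ x y, P x → P y → P (x + y)) (x : M) : P x := by
  have hx : x ∈ ⨆ p, gr p := by rw [h.submodule_iSup_eq_top]; trivial
  exact Submodule.iSup_induction gr (motive := P) hx hm (hm 0 0 (zero_mem _)) ha

/-- The map sending `x` to the family of its homogeneous components. -/
noncomputable def gradedSplit {gr : ℤ → Submodule K M} (h : DirectSum.IsInternal gr) :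
    M →ₗ[K] (ℤ →₀ M) :=
  DirectSum.toModule K ℤ (ℤ →₀ M) (fun p => Finsupp.lsingle p ∘ₗ (gr p).subtype) ∘ₗ
    (LinearEquiv.ofBijective (DirectSum.coeLinearMap gr) h).symm.toLinearMap

theorem gradedSplit_apply {gr : ℤ → Submodule K M} (h : DirectSum.IsInternal gr)
    {p : ℤ} {x : M} (hx : x ∈ gr p) : gradedSplit h x = Finsupp.single p x := by
  rw [gradedSplit, LinearMap.comp_apply, LinearEquiv.coe_coe, internal_symm_apply h hx,
    DirectSum.toModule_lof]
  rfl

theorem isInternal_of_split {gr : ℤ → Submodule K M} (hsup : ⨆ p, gr p = ⊤)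
    (c : M →ₗ[K] (ℤ →₀ M)) (hc : ∀ p x, x ∈ gr p → c x = Finsupp.single p x) :
    DirectSum.IsInternal gr := by
  refine DirectSum.isInternal_submodule_of_iSupIndep_of_iSup_eq_top ?_ hsup
  refine iSupIndep_of_dfinsupp_lsum_injective gr ?_
  rw [injective_iff_map_eq_zero]
  intro z hz
  have key : ∀ z : Π₀ p, gr p, ∀ q,
      c (DFinsupp.lsum ℕ (fun p => (gr p).subtype) z) q = (z q : M) := by
    intro z q
    induction z using DFinsupp.induction with
    | h0 => simp
    | ha p b f _ _ ih =>
      rw [map_add, map_add, Finsupp.add_apply, ih, DFinsupp.add_apply, Submodule.coe_add]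
      congr 1
      rw [DFinsupp.lsum_single, Submodule.subtype_apply, hc p _ b.2, DFinsupp.single_apply,
        Finsupp.single_apply]
      split_ifs with hpq
      · subst hpq; rfl
      · rfl
  ext q
  rw [← key z q, hz]
  simp

theorem isInternal_comap_iSup {A : ℤ → Submodule K M} (h : iSupIndep A) :
    DirectSum.IsInternal fun i => (A i).comap (⨆ i, A i).subtype := by
  have hp : ∀ i, A i ≤ ⨆ i, A i := le_iSup A
  refine (DirectSum.isInternal_submodule_iff_iSupIndep_and_iSup_eq_top _).mpr ⟨?_, ?_⟩
  · let e : Submodule K ↥(⨆ i, A i) ≃o Set.Iic (⨆ i, A i) := (⨆ i, A i).mapIic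
    suffices (e ∘ fun i => (A i).comap (⨆ i, A i).subtype) = fun i => ⟨A i, hp i⟩ by
      rw [← iSupIndep_map_orderIso_iff e, this]
      exact .of_coe_Iic_comp h
    ext i m
    change m ∈ ((A i).comap (⨆ i, A i).subtype).map (⨆ i, A i).subtype ↔ _
    rw [Submodule.map_comap_subtype, inf_of_le_right (hp i)]
  · apply Submodule.map_injective_of_injective (⨆ i, A i).injective_subtype
    rw [Submodule.map_iSup, Submodule.map_subtype_top]
    exact iSup_congr fun i => by rw [Submodule.map_comap_subtype, inf_of_le_right (hp i)]

end graded

section signs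

theorem negOnePow_congr {a b : ℤ} (h : Even (a - b)) : a.negOnePow = b.negOnePow :=
  (Int.negOnePow_eq_iff a b).2 h

end signs

/-- A differential graded commutative algebra over `K` (a field of characteristic zero in practice):
a `ℤ`-graded unital algebra `A = ⨁ₚ gr p`, commutative in the graded sense, with a differential `d`
of degree `1` which is a derivation of square zero. -/
structure CDGA (K : Type u) [Field K] where
  carrier : Type v
  [ring : Ring carrier]
  [algebra : Algebra K carrier]
  gr : ℤ → Submodule K carrier
  [graded : GradedAlgebra gr]
  d : carrier →ₗ[K] carrier
  d_mem : ∀ {p : ℤ} {a : carrier}, a ∈ gr p → d a ∈ gr (p + 1)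
  d_d : ∀ a, d (d a) = 0
  d_mul : ∀ {p : ℤ} {a : carrier}, a ∈ gr p → ∀ b : carrier,
    d (a * b) = d a * b + p.negOnePow • (a * d b)
  graded_comm : ∀ {p q : ℤ} {a b : carrier}, a ∈ gr p → b ∈ gr q →
    a * b = (p * q).negOnePow • (b * a)

namespace CDGA

attribute [instance] CDGA.ring CDGA.algebra CDGA.graded

variable {K : Type u} [Field K]

theorem isInternal (A : CDGA.{u, v} K) : DirectSum.IsInternal A.gr :=
  DirectSum.Decomposition.isInternal A.gr

/-- The parity involution `a ↦ (-1)^|a| a`. -/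
noncomputable def parity (A : CDGA.{u, v} K) : A.carrier →ₗ[K] A.carrier :=
  gradedScale A.isInternal (fun p => (p.negOnePow : ℤ))

theorem parity_apply (A : CDGA.{u, v} K) {p : ℤ} {a : A.carrier} (ha : a ∈ A.gr p) :
    A.parity a = p.negOnePow • a :=
  gradedScale_apply A.isInternal _ ha

/-- Morphisms of CDGAs: unital algebra maps preserving degrees and differentials. -/
@[ext]
structure Hom (A : CDGA.{u, v} K) (B : CDGA.{u, w} K) where
  toAlgHom : A.carrier →ₐ[K] B.carrier
  map_mem : ∀ {p : ℤ} {a : A.carrier}, a ∈ A.gr p → toAlgHom a ∈ B.gr p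
  map_d : ∀ a : A.carrier, toAlgHom (A.d a) = B.d (toAlgHom a)

instance : Category (CDGA.{u, v} K) where
  Hom A B := Hom A B
  id A := ⟨AlgHom.id K A.carrier, fun h => h, fun _ => rfl⟩
  comp f g := ⟨g.toAlgHom.comp f.toAlgHom, fun h => g.map_mem (f.map_mem h),
    fun a => by simp [f.map_d, g.map_d]⟩

theorem Hom.map_parity {A : CDGA.{u, v} K} {B : CDGA.{u, w} K} (f : Hom A B) (a : A.carrier) :
    f.toAlgHom (A.parity a) = B.parity (f.toAlgHom a) := by
  induction a using graded_induction A.isInternal with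
  | hm p a ha =>
    rw [A.parity_apply ha, B.parity_apply (f.map_mem ha), Units.smul_def, map_zsmul]; rfl
  | ha a b iha ihb => simp only [map_add, iha, ihb]

end CDGA

/-- The simplicial CDGA `Ω_•` of polynomial differential forms on the standard simplices. -/
noncomputable def polyForms (K : Type u) [Field K] : SimplicialObject (CDGA.{u, u} K) where
  obj n :=
    { carrier := PolyForms K n.unop.len
      gr := PolyForms.gr K n.unop.len
      d := PolyForms.d K n.unop.len
      d_mem := PolyForms.d_mem
      d_d := PolyForms.d_d
      d_mul := fun ha b => by
        rw [PolyForms.d_mul, PolyForms.parity_of_mem ha, smul_mul_assoc]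
      graded_comm := PolyForms.mul_comm_of_mem }
  map φ :=
    { toAlgHom := PolyForms.pullback φ.unop.toOrderHom
      map_mem := PolyForms.pullback_mem _
      map_d := PolyForms.pullback_d _ }
  map_id n := CDGA.Hom.ext (AlgHom.ext fun x => PolyForms.pullback_id x)
  map_comp φ ψ := CDGA.Hom.ext (AlgHom.ext fun x => 
    PolyForms.pullback_comp ψ.unop.toOrderHom φ.unop.toOrderHom x)

/-- The data underlying a differential graded Lie algebra: a vector space with a family of graded
pieces, a differential and a bracket. The axioms are in `DGLAData.IsDGLA`. -/
structure DGLAData (K : Type u) [Field K] where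
  carrier : Type v
  [addCommGroup : AddCommGroup carrier]
  [module : Module K carrier]
  gr : ℤ → Submodule K carrier
  d : carrier →ₗ[K] carrier
  bracket : carrier →ₗ[K] carrier →ₗ[K] carrier

attribute [instance] DGLAData.addCommGroup DGLAData.module

/-- The axioms of a differential graded Lie algebra: `L = ⨁ₚ gr p`, the differential has degree `1`
and square zero, and the bracket has degree `0`, is graded antisymmetric and satisfies the graded
Leibniz and Jacobi identities. -/
structure DGLAData.IsDGLA {K : Type u} [Field K] (L : DGLAData.{u, v} K) : Prop where
  isInternal : DirectSum.IsInternal L.gr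
  d_mem : ∀ {p : ℤ} {x : L.carrier}, x ∈ L.gr p → L.d x ∈ L.gr (p + 1)
  d_d : ∀ x, L.d (L.d x) = 0
  bracket_mem : ∀ {p q : ℤ} {x y : L.carrier}, x ∈ L.gr p → y ∈ L.gr q →
    L.bracket x y ∈ L.gr (p + q)
  antisymm : ∀ {p q : ℤ} {x y : L.carrier}, x ∈ L.gr p → y ∈ L.gr q →
    L.bracket x y = -((p * q).negOnePow • L.bracket y x)
  leibniz : ∀ {p : ℤ} {x : L.carrier}, x ∈ L.gr p → ∀ y : L.carrier,
    L.d (L.bracket x y) = L.bracket (L.d x) y + p.negOnePow • L.bracket x (L.d y)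
  jacobi : ∀ {p q : ℤ} {x y : L.carrier}, x ∈ L.gr p → y ∈ L.gr q → ∀ z : L.carrier,
    L.bracket x (L.bracket y z)
      = L.bracket (L.bracket x y) z + (p * q).negOnePow • L.bracket y (L.bracket x z)

/-- A differential graded Lie algebra over `K`. -/
structure DGLA (K : Type u) [Field K] extends DGLAData.{u, v} K where
  isDGLA : toDGLAData.IsDGLA

namespace DGLA

variable {K : Type u} [Field K]

/-- Morphisms of DGLAs: linear maps preserving degrees, differentials and brackets. -/
@[ext]
structure Hom (L : DGLA.{u, v} K) (M : DGLA.{u, w} K) where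
  toLinearMap : L.carrier →ₗ[K] M.carrier
  map_mem : ∀ {p : ℤ} {x : L.carrier}, x ∈ L.gr p → toLinearMap x ∈ M.gr p
  map_d : ∀ x : L.carrier, toLinearMap (L.d x) = M.d (toLinearMap x)
  map_bracket : ∀ x y : L.carrier,
    toLinearMap (L.bracket x y) = M.bracket (toLinearMap x) (toLinearMap y)

instance : Category (DGLA.{u, v} K) where
  Hom L M := Hom L M
  id L := ⟨LinearMap.id, fun h => h, fun _ => rfl, fun _ _ => rfl⟩
  comp f g := ⟨g.toLinearMap ∘ₗ f.toLinearMap, fun h => g.map_mem (f.map_mem h),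
    fun a => by simp [f.map_d, g.map_d], fun a b => by simp [f.map_bracket, g.map_bracket]⟩

/-- Degree `p` cocycles. -/
def cocycles (L : DGLA.{u, v} K) (p : ℤ) : Submodule K L.carrier :=
  L.gr p ⊓ LinearMap.ker L.d

/-- Degree `p` coboundaries, as a subspace of the cocycles. -/
def coboundaries (L : DGLA.{u, v} K) (p : ℤ) : Submodule K (L.cocycles p) :=
  ((L.gr (p - 1)).map L.d).comap (L.cocycles p).subtype

/-- The cohomology `Hᵖ(L)`. -/
abbrev cohomology (L : DGLA.{u, v} K) (p : ℤ) : Type v :=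
  L.cocycles p ⧸ L.coboundaries p

/-- The map induced on cocycles. -/
def Hom.mapCocycles {L : DGLA.{u, v} K} {M : DGLA.{u, w} K} (f : Hom L M) (p : ℤ) :
    L.cocycles p →ₗ[K] M.cocycles p :=
  f.toLinearMap.restrict fun x hx =>
    ⟨f.map_mem hx.1, by
      have h : L.d x = 0 := hx.2
      
      change M.d (f.toLinearMap x) = 0
      rw [← f.map_d, h, map_zero]⟩

/-- The map induced on cohomology. -/
def Hom.mapCohomology {L : DGLA.{u, v} K} {M : DGLA.{u, w} K} (f : Hom L M) (p : ℤ) :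
    L.cohomology p →ₗ[K] M.cohomology p :=
  Submodule.mapQ _ _ (f.mapCocycles p) (by
    rintro ⟨_, hx⟩ ⟨y, hy, rfl⟩
    exact ⟨f.toLinearMap y, f.map_mem hy, (f.map_d y).symm⟩)

/-- A quasi-isomorphism: a morphism of DGLAs inducing isomorphisms in cohomology. -/
def Hom.IsQuasiIso {L : DGLA.{u, v} K} {M : DGLA.{u, w} K} (f : Hom L M) : Prop :=
  ∀ p : ℤ, Function.Bijective (f.mapCohomology p)

/-- Two DGLAs are quasi-isomorphic (isomorphic in the homotopy category) if they are connected by a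
finite zigzag of quasi-isomorphisms of DGLAs. -/
def QuasiIsomorphic (L M : DGLA.{u, v} K) : Prop :=
  Relation.EqvGen (fun L M : DGLA.{u, v} K => ∃ f : Hom L M, f.IsQuasiIso) L M

/-- A DGLA is abelian if its bracket is zero (the differential is arbitrary). -/
def IsAbelian (L : DGLA.{u, v} K) : Prop := ∀ x y : L.carrier, L.bracket x y = 0

/-- A DGLA is homotopy abelian if it is quasi-isomorphic to an abelian DGLA. -/
def IsHomotopyAbelian (L : DGLA.{u, v} K) : Prop :=
  ∃ M : DGLA.{u, v} K, M.IsAbelian ∧ QuasiIsomorphic L M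

/-- The projection of `L` onto its even part. -/
noncomputable def evenPart (L : DGLA.{u, v} K) : L.carrier →ₗ[K] L.carrier :=
  gradedScale L.isDGLA.isInternal (fun p => if Even p then 1 else 0)

/-- The projection of `L` onto its odd part. -/
noncomputable def oddPart (L : DGLA.{u, v} K) : L.carrier →ₗ[K] L.carrier :=
  gradedScale L.isDGLA.isInternal (fun p => if Even p then 0 else 1)

end DGLA

namespace CDGA

open TensorProduct

variable {K : Type u} [Field K]

variable (B : CDGA.{u, w} K) (L : DGLA.{u, v} K)

/-- The degree `r` part of `B ⊗ L`, spanned by `b ⊗ a` with `|b| + |a| = r`. -/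
def tensorGr (r : ℤ) : Submodule K (B.carrier ⊗[K] L.carrier) :=
  Submodule.span K {x | ∃ (p q : ℤ) (b : B.carrier) (a : L.carrier),
    p + q = r ∧ b ∈ B.gr p ∧ a ∈ L.gr q ∧ b ⊗ₜ[K] a = x}

/-- The differential `d (b ⊗ a) = db ⊗ a + (-1)^|b| b ⊗ da`. -/
noncomputable def tensorD : B.carrier ⊗[K] L.carrier →ₗ[K] B.carrier ⊗[K] L.carrier :=
  TensorProduct.map B.d LinearMap.id + TensorProduct.map B.parity L.d

/-- The bracket `[b ⊗ a, b' ⊗ a'] = (-1)^(|a||b'|) bb' ⊗ [a, a']`. -/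
noncomputable def tensorBracket :
    B.carrier ⊗[K] L.carrier →ₗ[K] B.carrier ⊗[K] L.carrier →ₗ[K] B.carrier ⊗[K] L.carrier :=
  TensorProduct.map₂ (LinearMap.mul K B.carrier) (L.bracket ∘ₗ L.evenPart)
    + TensorProduct.map₂ ((LinearMap.mul K B.carrier).compl₂ B.parity) (L.bracket ∘ₗ L.oddPart)

variable {B L}

theorem tmul_mem_tensorGr {p q r : ℤ} {b : B.carrier} {a : L.carrier} (hb : b ∈ B.gr p)
    (ha : a ∈ L.gr q) (h : p + q = r) : b ⊗ₜ[K] a ∈ tensorGr B L r :=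
  Submodule.subset_span ⟨p, q, b, a, h, hb, ha, rfl⟩

@[elab_as_elim]
theorem tensorGr_induction {r : ℤ} {P : ∀ x : B.carrier ⊗[K] L.carrier, x ∈ tensorGr B L r → Prop}
    (hm : ∀ (p q : ℤ) (b : B.carrier) (a : L.carrier) (h : p + q = r) (hb : b ∈ B.gr p)
      (ha : a ∈ L.gr q), P (b ⊗ₜ[K] a) (tmul_mem_tensorGr hb ha h))
    (ha : ∀ x y hx hy, P x hx → P y hy → P (x + y) (add_mem hx hy))
    {x : B.carrier ⊗[K] L.carrier} (hx : x ∈ tensorGr B L r) : P x hx := by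
  refine Submodule.closure_induction (p := P) ?_ ha ?_ hx
  · simpa using hm r 0 0 0 (add_zero r) (zero_mem _) (zero_mem _)
  · rintro k _ ⟨p, q, b, a, h, hb, ha, rfl⟩
    have := hm p q _ a h (Submodule.smul_mem _ k hb) ha
    simpa only [TensorProduct.smul_tmul'] using this

theorem sign_smul_tmul (u : ℤˣ) (b : B.carrier) (a : L.carrier) :
    (u • b) ⊗ₜ[K] a = u • (b ⊗ₜ[K] a) := by
  rw [Units.smul_def, Units.smul_def]
  exact map_zsmul ((TensorProduct.mk K B.carrier L.carrier).flip a) _ _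

theorem tmul_sign_smul (u : ℤˣ) (b : B.carrier) (a : L.carrier) :
    b ⊗ₜ[K] (u • a) = u • (b ⊗ₜ[K] a) := by
  rw [Units.smul_def, Units.smul_def]
  exact map_zsmul (TensorProduct.mk K B.carrier L.carrier b) _ _

theorem tensorD_tmul {p : ℤ} {b : B.carrier} (hb : b ∈ B.gr p) (a : L.carrier) :
    tensorD B L (b ⊗ₜ[K] a) = B.d b ⊗ₜ[K] a + p.negOnePow • (b ⊗ₜ[K] L.d a) := by
  simp only [tensorD, LinearMap.add_apply, TensorProduct.map_tmul, LinearMap.id_apply,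
    B.parity_apply hb]
  rfl

theorem tensorBracket_tmul {p q : ℤ} (b : B.carrier) {a : L.carrier} (ha : a ∈ L.gr p)
    {b' : B.carrier} (hb' : b' ∈ B.gr q) (a' : L.carrier) :
    tensorBracket B L (b ⊗ₜ[K] a) (b' ⊗ₜ[K] a')
      = (p * q).negOnePow • ((b * b') ⊗ₜ[K] L.bracket a a') := by
  simp only [tensorBracket, LinearMap.add_apply, TensorProduct.map₂_apply_tmul, TensorProduct.map_tmul,
    LinearMap.compl₂_apply, LinearMap.mul_apply', LinearMap.comp_apply,
    B.parity_apply hb', DGLA.evenPart, DGLA.oddPart, gradedScale_apply _ _ ha]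
  rcases Int.even_or_odd p with hp | hp
  · simp [hp, Int.negOnePow_even _ (hp.mul_right q)]
  · have h : (p * q).negOnePow = q.negOnePow :=
      negOnePow_congr (by
        obtain ⟨m, rfl⟩ := hp
        exact ⟨m * q, by ring⟩)
    simp only [Int.not_even_iff_odd.2 hp, if_false, zero_smul, map_zero, LinearMap.zero_apply,
      tmul_zero, zero_add, one_smul, h, mul_smul_comm]
    rfl


theorem iSup_tensorGr : ⨆ r, tensorGr B L r = ⊤ := by
  rw [eq_top_iff]
  rintro x -
  induction x using TensorProduct.induction_on with
  | zero => exact zero_mem _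
  | add x y hx hy => exact add_mem hx hy
  | tmul b a =>
    induction b using graded_induction B.isInternal with
    | ha b b' hb hb' => rw [TensorProduct.add_tmul]; exact add_mem hb hb'
    | hm p b hb =>
      induction a using graded_induction L.isDGLA.isInternal with
      | ha a a' ha ha' => rw [TensorProduct.tmul_add]; exact add_mem ha ha'
      | hm q a ha => exact Submodule.mem_iSup_of_mem (p + q) (tmul_mem_tensorGr hb ha rfl)

theorem tensorGr_isInternal : DirectSum.IsInternal (tensorGr B L) := by
  let comb : (ℤ →₀ B.carrier) →ₗ[K] (ℤ →₀ L.carrier) →ₗ[K] (ℤ →₀ B.carrier ⊗[K] L.carrier) :=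
    Finsupp.lsum K fun p => (Finsupp.lsum K fun q =>
      ((TensorProduct.mk K B.carrier L.carrier).compr₂ (Finsupp.lsingle (p + q))).flip).flip
  refine isInternal_of_split iSup_tensorGr
    (TensorProduct.lift
      (comb.compl₁₂ (gradedSplit B.isInternal) (gradedSplit L.isDGLA.isInternal))) ?_
  intro r x hx
  induction hx using tensorGr_induction with
  | hm p q b a h hb ha =>
    rw [TensorProduct.lift.tmul, LinearMap.compl₁₂_apply, gradedSplit_apply _ hb,
      gradedSplit_apply _ ha]
    simp [comb, h]
  | ha x y _ _ hx hy => rw [map_add, hx, hy, Finsupp.single_add]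

theorem tensorD_mem {r : ℤ} {x : B.carrier ⊗[K] L.carrier} (hx : x ∈ tensorGr B L r) :
    tensorD B L x ∈ tensorGr B L (r + 1) := by
  induction hx using tensorGr_induction with
  | hm p q b a h hb ha =>
    rw [tensorD_tmul hb]
    refine add_mem (tmul_mem_tensorGr (B.d_mem hb) ha (by lia)) ?_
    rw [Units.smul_def]
    exact zsmul_mem (tmul_mem_tensorGr hb (L.isDGLA.d_mem ha) (by lia)) _
  | ha x y _ _ hx hy => rw [map_add]; exact add_mem hx hy

theorem tensorBracket_mem {r s : ℤ} {x y : B.carrier ⊗[K] L.carrier} (hx : x ∈ tensorGr B L r)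
    (hy : y ∈ tensorGr B L s) : tensorBracket B L x y ∈ tensorGr B L (r + s) := by
  induction hx using tensorGr_induction with
  | ha x x' _ _ hx hx' => rw [map_add, LinearMap.add_apply]; exact add_mem hx hx'
  | hm p q b a h hb ha =>
    induction hy using tensorGr_induction with
    | ha y y' _ _ hy hy' => rw [map_add]; exact add_mem hy hy'
    | hm p' q' b' a' h' hb' ha' =>
      rw [tensorBracket_tmul b ha hb' a', Units.smul_def]
      exact zsmul_mem (tmul_mem_tensorGr (SetLike.mul_mem_graded hb hb')
        (L.isDGLA.bracket_mem ha ha') (by lia)) _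

/-- A linear identity on the tensor product may be checked on homogeneous pure tensors. -/
theorem tensor_induction {P : B.carrier ⊗[K] L.carrier → Prop}
    (hm : ∀ (p q : ℤ) (b : B.carrier) (a : L.carrier), b ∈ B.gr p → a ∈ L.gr q → P (b ⊗ₜ[K] a))
    (ha : ∀ x y, P x → P y → P (x + y)) (x : B.carrier ⊗[K] L.carrier) : P x := by
  induction x using graded_induction (tensorGr_isInternal (B := B) (L := L)) with
  | hm r x hx =>
    refine tensorGr_induction (P := fun x _ => P x) ?_ (fun x y _ _ => ha x y) hx
    exact fun p q b a _ hb ha => hm p q b a hb ha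
  | ha x y hx hy => exact ha x y hx hy

theorem tensorD_tensorD (x : B.carrier ⊗[K] L.carrier) : tensorD B L (tensorD B L x) = 0 := by
  induction x using tensor_induction with
  | ha x y hx hy => rw [map_add, map_add, hx, hy, add_zero]
  | hm p q b a hb ha =>
    rw [tensorD_tmul hb, map_add, tensorD_tmul (B.d_mem hb), B.d_d,
      Units.smul_def (Int.negOnePow p), map_zsmul, tensorD_tmul hb, L.isDGLA.d_d, ← Units.smul_def,
      Int.negOnePow_succ]
    simp

theorem tensorBracket_antisymm {r s : ℤ} {x y : B.carrier ⊗[K] L.carrier}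
    (hx : x ∈ tensorGr B L r) (hy : y ∈ tensorGr B L s) :
    tensorBracket B L x y = -((r * s).negOnePow • tensorBracket B L y x) := by
  induction hx using tensorGr_induction with
  | ha x x' _ _ hx hx' => rw [map_add, map_add, LinearMap.add_apply, hx, hx', smul_add, neg_add]
  | hm p q b a h hb ha =>
    induction hy using tensorGr_induction with
    | ha y y' _ _ hy hy' => rw [map_add, map_add, LinearMap.add_apply, hy, hy', smul_add, neg_add]
    | hm p' q' b' a' h' hb' ha' =>
      rw [tensorBracket_tmul b ha hb' a', tensorBracket_tmul b' ha' hb a,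
        B.graded_comm hb hb', L.isDGLA.antisymm ha ha', TensorProduct.tmul_neg, smul_neg,
        tmul_sign_smul, sign_smul_tmul, smul_smul, smul_smul, smul_smul,
        ← Int.negOnePow_add, ← Int.negOnePow_add, ← Int.negOnePow_add]
      congr 2
      subst h h'
      exact negOnePow_congr ⟨-(q' * p), by ring⟩

theorem tensor_leibniz {r : ℤ} {x : B.carrier ⊗[K] L.carrier} (hx : x ∈ tensorGr B L r)
    (y : B.carrier ⊗[K] L.carrier) :
    tensorD B L (tensorBracket B L x y)
      = tensorBracket B L (tensorD B L x) y
        + r.negOnePow • tensorBracket B L x (tensorD B L y) := by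
  induction hx using tensorGr_induction with
  | ha x x' _ _ hx hx' =>
    simp only [map_add, LinearMap.add_apply, hx, hx', smul_add]
    abel
  | hm p q b a h hb ha =>
    induction y using tensor_induction with
    | ha y y' hy hy' =>
      simp only [map_add, hy, hy', smul_add]
      abel
    | hm p' q' b' a' hb' ha' =>
      subst h
      rw [tensorBracket_tmul b ha hb' a', tensorD_tmul hb, tensorD_tmul hb', map_add, map_add,
        LinearMap.add_apply, tensorBracket_tmul _ ha hb', tensorBracket_tmul _ ha (B.d_mem hb')]
      simp only [Units.smul_def, map_zsmul, LinearMap.smul_apply]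
      simp only [← Units.smul_def]
      rw [tensorBracket_tmul _ (L.isDGLA.d_mem ha) hb', tensorBracket_tmul _ ha hb',
        tensorD_tmul (SetLike.mul_mem_graded hb hb'), B.d_mul hb, L.isDGLA.leibniz ha,
        TensorProduct.add_tmul, TensorProduct.tmul_add, tmul_sign_smul,
        sign_smul_tmul]
      simp only [smul_add, smul_smul, ← Int.negOnePow_add]
      rw [negOnePow_congr (a := (p + q) + q * (p' + 1)) (b := q * p' + p) ⟨q, by ring⟩,
        negOnePow_congr (a := p + (q + 1) * p') (b := q * p' + (p + p')) ⟨0, by ring⟩,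
        negOnePow_congr (a := (p + q) + (p' + q * p')) (b := q * p' + (p + p' + q)) ⟨0, by ring⟩]
      abel

theorem tensor_jacobi {r s : ℤ} {x y : B.carrier ⊗[K] L.carrier} (hx : x ∈ tensorGr B L r)
    (hy : y ∈ tensorGr B L s) (z : B.carrier ⊗[K] L.carrier) :
    tensorBracket B L x (tensorBracket B L y z)
      = tensorBracket B L (tensorBracket B L x y) z
        + (r * s).negOnePow • tensorBracket B L y (tensorBracket B L x z) := by
  induction hx using tensorGr_induction with
  | ha x x' _ _ hx hx' =>
    simp only [map_add, LinearMap.add_apply, hx, hx', smul_add]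
    abel
  | hm i p b a h hb ha =>
    induction hy using tensorGr_induction with
    | ha y y' _ _ hy hy' =>
      simp only [map_add, LinearMap.add_apply, hy, hy', smul_add]
      abel
    | hm j q b' a' h' hb' ha' =>
      induction z using tensor_induction with
      | ha z z' hz hz' =>
        simp only [map_add, hz, hz', smul_add]
        abel
      | hm m n c e hc he =>
        subst h h'
        rw [tensorBracket_tmul b' ha' hc, tensorBracket_tmul b ha hb', tensorBracket_tmul b ha hc]
        simp only [Units.smul_def, map_zsmul, LinearMap.smul_apply]
        simp only [← Units.smul_def]
        rw [tensorBracket_tmul b ha (SetLike.mul_mem_graded hb' hc),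
          tensorBracket_tmul b' ha' (SetLike.mul_mem_graded hb hc),
          tensorBracket_tmul (b * b') (L.isDGLA.bracket_mem ha ha') hc,
          L.isDGLA.jacobi ha ha', TensorProduct.tmul_add, tmul_sign_smul,
          ← mul_assoc b' b c, B.graded_comm hb' hb, mul_assoc b b' c, smul_mul_assoc,
          mul_assoc b b' c, sign_smul_tmul]
        simp only [smul_add, smul_smul, ← Int.negOnePow_add]
        congr 2
        · exact negOnePow_congr ⟨0, by ring⟩
        · exact negOnePow_congr ⟨-(i * j) - i * q, by ring⟩

variable (B L) in
/-- The tensor product `B ⊗ L` of a CDGA and a DGLA, as a DGLA. -/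
noncomputable def tensor : DGLA.{u, max w v} K where
  carrier := B.carrier ⊗[K] L.carrier
  gr := tensorGr B L
  d := tensorD B L
  bracket := tensorBracket B L
  isDGLA :=
    { isInternal := tensorGr_isInternal
      d_mem := tensorD_mem
      d_d := tensorD_tensorD
      bracket_mem := tensorBracket_mem
      antisymm := tensorBracket_antisymm
      leibniz := tensor_leibniz
      jacobi := tensor_jacobi }

section functoriality

variable {B' : CDGA.{u, w} K} {L' : DGLA.{u, v} K} (f : Hom B B') (g : DGLA.Hom L L')

theorem map_tensorD (x : B.carrier ⊗[K] L.carrier) :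
    TensorProduct.map f.toAlgHom.toLinearMap g.toLinearMap (tensorD B L x)
      = tensorD B' L' (TensorProduct.map f.toAlgHom.toLinearMap g.toLinearMap x) := by
  induction x using tensor_induction with
  | ha x y hx hy => simp only [map_add, hx, hy]
  | hm p q b a hb ha =>
    rw [tensorD_tmul hb, map_add, Units.smul_def, map_zsmul]
    simp only [TensorProduct.map_tmul, AlgHom.toLinearMap_apply]
    rw [tensorD_tmul (f.map_mem hb), f.map_d, g.map_d, Units.smul_def]

theorem map_tensorBracket (x y : B.carrier ⊗[K] L.carrier) :
    TensorProduct.map f.toAlgHom.toLinearMap g.toLinearMap (tensorBracket B L x y)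
      = tensorBracket B' L' (TensorProduct.map f.toAlgHom.toLinearMap g.toLinearMap x)
          (TensorProduct.map f.toAlgHom.toLinearMap g.toLinearMap y) := by
  induction x using tensor_induction with
  | ha x x' hx hx' => simp only [map_add, LinearMap.add_apply, hx, hx']
  | hm p q b a hb ha =>
    induction y using tensor_induction with
    | ha y y' hy hy' => simp only [map_add, hy, hy']
    | hm p' q' b' a' hb' ha' =>
      rw [tensorBracket_tmul b ha hb', Units.smul_def, map_zsmul]
      simp only [TensorProduct.map_tmul, AlgHom.toLinearMap_apply]
      rw [tensorBracket_tmul _ (g.map_mem ha) (f.map_mem hb'), g.map_bracket, map_mul,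
        Units.smul_def]

/-- The morphism of DGLAs `f ⊗ g : B ⊗ L → B' ⊗ L'`. -/
noncomputable def tensorMap : DGLA.Hom (B.tensor L) (B'.tensor L') where
  toLinearMap := TensorProduct.map f.toAlgHom.toLinearMap g.toLinearMap
  map_mem {r x} hx := by
    refine tensorGr_induction (P := fun x _ => TensorProduct.map f.toAlgHom.toLinearMap
      g.toLinearMap x ∈ tensorGr B' L' r) ?_ ?_ hx
    · intro p q b a h hb ha
      exact tmul_mem_tensorGr (f.map_mem hb) (g.map_mem ha) h
    · intro x y _ _ hx hy
      rw [map_add]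
      exact add_mem hx hy
  map_d := map_tensorD f g
  map_bracket := map_tensorBracket f g

end functoriality

end CDGA

namespace Totalization

variable {K : Type u} [Field K] (L : CosimplicialObject (DGLA.{u, v} K))

/-- The factor `Ωₙ ⊗ Lₙ`. -/
noncomputable abbrev factor (n : SimplexCategory) : DGLA.{u, max u v} K :=
  ((polyForms K).obj (Opposite.op n)).tensor (L.obj n)

/-- Families `(xₙ) ∈ ∏ₙ Ωₙ ⊗ Lₙ` with `(φ^* ⊗ id) xₙ = (id ⊗ φ_*) xₘ` in `Ωₘ ⊗ Lₙ` for every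
monotone map `φ : [m] → [n]`. -/
def compatible : Submodule K (∀ n : SimplexCategory, (factor L n).carrier) where
  carrier := {x | ∀ (m n : SimplexCategory) (φ : m ⟶ n),
    (CDGA.tensorMap ((polyForms K).map φ.op) (𝟙 (L.obj n))).toLinearMap (x n)
      = (CDGA.tensorMap (𝟙 ((polyForms K).obj (Opposite.op m))) (L.map φ)).toLinearMap (x m)}
  zero_mem' m n φ := by simp
  add_mem' hx hy m n φ := by simp [hx m n φ, hy m n φ]
  smul_mem' c x hx m n φ := by simp [hx m n φ]

/-- The degree `p` part of the totalization: compatible families `(xₙ)` with every `xₙ` of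
degree `p` in `Ωₙ ⊗ Lₙ`. -/
def degree (p : ℤ) : Submodule K (∀ n : SimplexCategory, (factor L n).carrier) where
  carrier := {x | x ∈ compatible L ∧ ∀ n, x n ∈ (factor L n).gr p}
  zero_mem' := ⟨zero_mem _, fun _ => zero_mem _⟩
  add_mem' hx hy := ⟨add_mem hx.1 hy.1, fun n => add_mem (hx.2 n) (hy.2 n)⟩
  smul_mem' c _ hx := ⟨Submodule.smul_mem _ c hx.1, fun n => Submodule.smul_mem _ c (hx.2 n)⟩

/-- The differential on families. -/
noncomputable def dPi : (∀ n : SimplexCategory, (factor L n).carrier) →ₗ[K]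
    (∀ n : SimplexCategory, (factor L n).carrier) :=
  LinearMap.pi fun n => (factor L n).d ∘ₗ LinearMap.proj n

/-- The bracket on families. -/
noncomputable def bracketPi : (∀ n : SimplexCategory, (factor L n).carrier) →ₗ[K]
    (∀ n : SimplexCategory, (factor L n).carrier) →ₗ[K]
    (∀ n : SimplexCategory, (factor L n).carrier) :=
  LinearMap.mk₂ K (fun x y n => (factor L n).bracket (x n) (y n))
    (fun _ _ _ => by ext n; simp) (fun _ _ _ => by ext n; simp)
    (fun _ _ _ => by ext n; simp) (fun _ _ _ => by ext n; simp)

variable {L}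

theorem dPi_mem {p : ℤ} {x : ∀ n : SimplexCategory, (factor L n).carrier} (hx : x ∈ degree L p) :
    dPi L x ∈ degree L (p + 1) :=
  ⟨fun m n φ => ((CDGA.tensorMap _ _).map_d _).trans
      ((congrArg _ (hx.1 m n φ)).trans ((CDGA.tensorMap _ _).map_d _).symm),
    fun n => (factor L n).isDGLA.d_mem (hx.2 n)⟩

theorem bracketPi_mem {p q : ℤ} {x y : ∀ n : SimplexCategory, (factor L n).carrier}
    (hx : x ∈ degree L p) (hy : y ∈ degree L q) : bracketPi L x y ∈ degree L (p + q) :=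
  ⟨fun m n φ => ((CDGA.tensorMap _ _).map_bracket _ _).trans
      ((congrArg₂ (fun x y => (((polyForms K).obj (Opposite.op m)).tensor (L.obj n)).bracket x y)
        (hx.1 m n φ) (hy.1 m n φ)).trans
        ((CDGA.tensorMap _ _).map_bracket _ _).symm),
    fun n => (factor L n).isDGLA.bracket_mem (hx.2 n) (hy.2 n)⟩

theorem dPi_mem_iSup {x : ∀ n : SimplexCategory, (factor L n).carrier}
    (hx : x ∈ ⨆ p, degree L p) : dPi L x ∈ ⨆ p, degree L p := by
  induction hx using Submodule.iSup_induction' with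
  | mem p x hx => exact Submodule.mem_iSup_of_mem _ (dPi_mem hx)
  | zero => rw [map_zero]; exact zero_mem _
  | add x y _ _ hx hy => rw [map_add]; exact add_mem hx hy

theorem bracketPi_mem_iSup {x y : ∀ n : SimplexCategory, (factor L n).carrier}
    (hx : x ∈ ⨆ p, degree L p) (hy : y ∈ ⨆ p, degree L p) :
    bracketPi L x y ∈ ⨆ p, degree L p := by
  induction hx using Submodule.iSup_induction' with
  | zero => rw [map_zero]; exact zero_mem _
  | add x y _ _ hx hy => rw [map_add]; exact add_mem hx hy
  | mem p x hx =>
    induction hy using Submodule.iSup_induction' with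
    | mem q y hy => exact Submodule.mem_iSup_of_mem _ (bracketPi_mem hx hy)
    | zero => rw [map_zero]; exact zero_mem _
    | add x y _ _ hx hy => rw [map_add]; exact add_mem hx hy

theorem iSupIndep_degree : iSupIndep (degree L) := by
  refine iSupIndep_of_dfinsupp_lsum_injective _ ?_
  rw [injective_iff_map_eq_zero]
  intro z hz
  have key : ∀ (n : SimplexCategory) (z : Π₀ p, degree L p) (q : ℤ),
      gradedSplit (factor L n).isDGLA.isInternal
        (DFinsupp.lsum ℕ (fun p => (degree L p).subtype) z n) q = (z q).1 n := by
    intro n z q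
    induction z using DFinsupp.induction with
    | h0 => simp
    | ha p b f _ _ ih =>
      rw [map_add, Pi.add_apply, map_add, Finsupp.add_apply, ih, DFinsupp.add_apply,
        Submodule.coe_add, Pi.add_apply]
      congr 1
      rw [DFinsupp.lsum_single, Submodule.subtype_apply, gradedSplit_apply _ (b.2.2 n),
        DFinsupp.single_apply, Finsupp.single_apply]
      split_ifs with hpq
      · subst hpq; rfl
      · rfl
  refine DFinsupp.ext fun q => Subtype.ext (funext fun n => ?_)
  rw [← key n z q, hz]
  simp

variable (L)

/-- The (Thom-Whitney) totalization of a cosimplicial DGLA `L`: the graded vector space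
`⨁ₚ degree p` of compatible families, with componentwise differential and bracket. -/
noncomputable def tot : DGLA.{u, max u v} K where
  carrier := ↥(⨆ p, degree L p)
  gr p := (degree L p).comap (⨆ p, degree L p).subtype
  d := (dPi L).restrict fun _ hx => dPi_mem_iSup hx
  bracket := LinearMap.mk₂ K
    (fun x y => ⟨bracketPi L x.1 y.1, bracketPi_mem_iSup x.2 y.2⟩)
    (fun _ _ _ => by ext1; simp) (fun _ _ _ => by ext1; simp)
    (fun _ _ _ => by ext1; simp) (fun _ _ _ => by ext1; simp)
  isDGLA :=
    { isInternal := isInternal_comap_iSup iSupIndep_degree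
      d_mem := fun hx => dPi_mem hx
      d_d := fun x => Subtype.ext (funext fun n => (factor L n).isDGLA.d_d _)
      bracket_mem := fun hx hy => bracketPi_mem hx hy
      antisymm := fun hx hy => Subtype.ext (funext fun n =>
        (factor L n).isDGLA.antisymm (hx.2 n) (hy.2 n))
      leibniz := fun hx y => Subtype.ext (funext fun n =>
        (factor L n).isDGLA.leibniz (hx.2 n) _)
      jacobi := fun hx hy z => Subtype.ext (funext fun n =>
        (factor L n).isDGLA.jacobi (hx.2 n) (hy.2 n) _) }

end Totalization

section Koszul

variable {K : Type u} [Field K]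

/-- The graded commutator `[f, g] = fg - (-1)^(|f||g|) gf` of two operators of degrees `p`, `q`. -/
def gradedCommutator {M : Type v} [AddCommGroup M] [Module K M] (p q : ℤ)
    (f g : Module.End K M) : Module.End K M :=
  f * g - (p * q).negOnePow • (g * f)

namespace CDGA

variable (A : CDGA.{u, v} K)

/-- The operator `f` is homogeneous of degree `m`. -/
def HasDegree (m : ℤ) (f : Module.End K A.carrier) : Prop :=
  ∀ (p : ℤ) (a : A.carrier), a ∈ A.gr p → f a ∈ A.gr (m + p)

/-- `A.IsDiffOp r m f`: the operator `f`, homogeneous of degree `m`, is a differential operator of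
order `≤ r` on the graded commutative algebra `A`. Recursively, all graded commutators of `f` with
left multiplications by homogeneous elements are differential operators of order `≤ r - 1`, the
only differential operator of negative order being `0`. -/
def IsDiffOp : ℕ → ℤ → Module.End K A.carrier → Prop
  | 0, m, f => A.HasDegree m f ∧ ∀ (p : ℤ) (a : A.carrier), a ∈ A.gr p →
      gradedCommutator m p f (LinearMap.mulLeft K a) = 0
  | r + 1, m, f => A.HasDegree m f ∧ ∀ (p : ℤ) (a : A.carrier), a ∈ A.gr p →
      IsDiffOp r (m + p) (gradedCommutator m p f (LinearMap.mulLeft K a))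

/-- Quasi-Batalin-Vilkovisky operators of degree `m`: differential operators of order `≤ 2` that
annihilate the unit. -/
def IsQuasiBV (m : ℤ) (f : Module.End K A.carrier) : Prop :=
  A.IsDiffOp 2 m f ∧ f 1 = 0

/-- The operator `l = [i, d]`, for `i` of degree `-2k`. -/
def lieOp (k : ℤ) (i : Module.End K A.carrier) : Module.End K A.carrier :=
  gradedCommutator (-(2 * k)) 1 i A.d

/-- The bracket `[a, b]_l = (-1)^|a| (l(ab) - l(a)b) - a l(b)` generated by `l`. -/
noncomputable def bracketOf (l : Module.End K A.carrier) :
    A.carrier →ₗ[K] A.carrier →ₗ[K] A.carrier :=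
  ((LinearMap.mul K A.carrier).compr₂ l - LinearMap.mul K A.carrier ∘ₗ l) ∘ₗ A.parity
    - (LinearMap.mul K A.carrier).compl₂ l

theorem bracketOf_apply' (l : Module.End K A.carrier) (a b : A.carrier) :
    A.bracketOf l a b = l (A.parity a * b) - l (A.parity a) * b - a * l b := by
  simp [bracketOf]

theorem bracketOf_apply (l : Module.End K A.carrier) {p : ℤ} {a : A.carrier} (ha : a ∈ A.gr p)
    (b : A.carrier) :
    A.bracketOf l a b = p.negOnePow • (l (a * b) - l a * b) - a * l b := by
  rw [bracketOf_apply', A.parity_apply ha, smul_mul_assoc]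
  simp only [Units.smul_def, map_zsmul, smul_mul_assoc, smul_sub]

/-- The graded vector space `A[2k-1]`, with the differential `d` and the bracket `[ , ]_l` generated
by `l = [i, d]`. -/
noncomputable def koszulData (k : ℤ) (i : Module.End K A.carrier) : DGLAData.{u, v} K where
  carrier := A.carrier
  gr p := A.gr (2 * k - 1 + p)
  d := A.d
  bracket := A.bracketOf (A.lieOp k i)

variable {A} in
theorem Hom.map_lieOp {B : CDGA.{u, v} K} (f : Hom A B) (k : ℤ) {i : Module.End K A.carrier}
    {j : Module.End K B.carrier} (h : ∀ a, j (f.toAlgHom a) = f.toAlgHom (i a)) (a : A.carrier) :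
    B.lieOp k j (f.toAlgHom a) = f.toAlgHom (A.lieOp k i a) := by
  have e : ∀ (A : CDGA.{u, v} K) (i : Module.End K A.carrier) (a : A.carrier),
      A.lieOp k i a = i (A.d a) - ((-(2 * k) * 1).negOnePow : ℤ) • A.d (i a) := fun _ _ _ => rfl
  rw [e, e, map_sub, map_zsmul, ← f.map_d, h, h, f.map_d]

variable {A} in
theorem Hom.map_bracketOf {B : CDGA.{u, v} K} (f : Hom A B) {l : Module.End K A.carrier}
    {l' : Module.End K B.carrier} (h : ∀ a, l' (f.toAlgHom a) = f.toAlgHom (l a))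
    (a b : A.carrier) :
    f.toAlgHom (A.bracketOf l a b) = B.bracketOf l' (f.toAlgHom a) (f.toAlgHom b) := by
  rw [bracketOf_apply', bracketOf_apply', ← f.map_parity, ← map_mul, h, h, h]
  simp only [map_sub, map_mul]

/-- The cosimplicial DGLA `(A_•[2k-1], d, [ , ]_{l_•})` associated with a cosimplicial linear map
`i_•`, given that its levels are DGLAs. -/
noncomputable def koszulCosimplicial (A : CosimplicialObject (CDGA.{u, v} K)) (k : ℤ)
    (i : ∀ n : SimplexCategory, Module.End K (A.obj n).carrier)
    (hi : ∀ (m n : SimplexCategory) (φ : m ⟶ n) (a : (A.obj m).carrier),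
      i n ((A.map φ).toAlgHom a) = (A.map φ).toAlgHom (i m a))
    (h : ∀ n, ((A.obj n).koszulData k (i n)).IsDGLA) :
    CosimplicialObject (DGLA.{u, v} K) where
  obj n := { (A.obj n).koszulData k (i n) with isDGLA := h n }
  map {m n} φ :=
    { toLinearMap := (A.map φ).toAlgHom.toLinearMap
      map_mem := fun hx => (A.map φ).map_mem hx
      map_d := (A.map φ).map_d
      map_bracket := Hom.map_bracketOf (A.map φ) (Hom.map_lieOp (A.map φ) k (hi m n φ)) }
  map_id n := by
    apply DGLA.Hom.ext
    change (A.map (𝟙 n)).toAlgHom.toLinearMap = LinearMap.id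
    rw [A.map_id]
    rfl
  map_comp {l m n} φ ψ := by
    apply DGLA.Hom.ext
    change (A.map (φ ≫ ψ)).toAlgHom.toLinearMap
      = (A.map ψ).toAlgHom.toLinearMap ∘ₗ (A.map φ).toAlgHom.toLinearMap
    rw [A.map_comp]
    rfl

end CDGA

end Koszul

/-! ### Signs and graded commutators of operators. -/

section signs

/-! The statement reduces to a single algebra. The forms on the simplices are graded commutative, so
each Ωₙ ⊗ Aₙ is again a differential graded commutative algebra, and finite sums of homogeneous
compatible families form one as well (`Totalization.algTot`). The operators 1 ⊗ iₙ induce on it an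
operator satisfying the same two hypotheses (`isQuasiBV_totOp`, `isQuasiBV_gradedCommutator_totOp`),
and the bracket it generates is the bracket of the totalization (`totHom`). It remains to treat one
algebra A with operators i and l = [i, d] (`koszul_isHomotopyAbelian`).

The bracket is a derived bracket: as l has order at most 2 and kills 1, left multiplication by [a,
b]_l is, up to sign, the double commutator [[l, a], b] (`mulLeft_bracketOf`). The DGLA axioms then
follow from the Jacobi identity for operators, from [d, l] = 0, and from [l, l] having order at most
2. The last fact holds because [l, l] = [[l, i], d] and [l, i] has order at most 2.

For homotopy abelianity one passes to symbols. Let M consist of the series ∑ Xⁿ fₙ with fₙ of order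
at most n, modulo those with fₙ of order at most n - 1, the bracket being the commutator divided by
X. The element Q = X d + X² l satisfies [Q, Q] = 0 in M, so [Q, ·] makes M a DGLA. The constant term
is a left multiplication and defines a projection π of M onto a shift of A whose kernel is a
sub-DGLA. Left multiplications give a section s of π with commuting values, and [ , ]_l is its
derived bracket.

The general principle is `DGLA.isHomotopyAbelian_of_complement`. In this situation L, the shifted
algebra with its bracket, is quasi-isomorphic to the homotopy fibre of the inclusion of ker π in M:
the section extends to a morphism from the cone of L to M compatible with the projections. If π also
has a section τ compatible with the differentials, then x ↦ dt ⊗ τ x embeds the complex L with zero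
bracket into the path model of the fibre, because dt² = 0, and this is a quasi-isomorphism. All
comparisons of cohomology go through the period of a path x, namely π applied to the integral of x
from 0 to 1.

The compatible section is τ = exp(ad i), a ↦ ∑ Xⁿ (ad i)ⁿ a / n!. Formally exp(ad i) sends X d to X
d + X² l + X³ [i, l] / 2 + …; since [i, l] has order at most 2, everything after the second term is
zero in M. Thus exp(ad i) intertwines d with [Q, ·] (`seriesBracket_differential_seriesExp`).
Characteristic 0 is used for the factorials, for dividing by 2, and for integrating polynomials. -/

theorem negOnePow_mul_self (p : ℤ) : p.negOnePow * p.negOnePow = 1 := by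
  rw [← Int.negOnePow_add, Int.negOnePow_even _ ⟨p, rfl⟩]

theorem negOnePow_mul_of_even_left {p : ℤ} (q : ℤ) (h : Even p) : (p * q).negOnePow = 1 :=
  Int.negOnePow_even _ (h.mul_right q)

theorem negOnePow_mul_of_odd_left {p : ℤ} (q : ℤ) (h : Odd p) :
    (p * q).negOnePow = q.negOnePow :=
  negOnePow_congr (by
    obtain ⟨m, rfl⟩ := h
    exact ⟨m * q, by ring⟩)

end signs

section commutator

variable {K : Type u} [Field K] {M : Type v} [AddCommGroup M] [Module K M]

theorem gradedCommutator_add_left (p q : ℤ) (f f' g : Module.End K M) :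
    gradedCommutator p q (f + f') g = gradedCommutator p q f g + gradedCommutator p q f' g := by
  simp only [gradedCommutator, add_mul, mul_add, smul_add]; abel

theorem gradedCommutator_add_right (p q : ℤ) (f g g' : Module.End K M) :
    gradedCommutator p q f (g + g') = gradedCommutator p q f g + gradedCommutator p q f g' := by
  simp only [gradedCommutator, add_mul, mul_add, smul_add]; abel

theorem gradedCommutator_smul_left (p q : ℤ) (c : K) (f g : Module.End K M) :
    gradedCommutator p q (c • f) g = c • gradedCommutator p q f g := by
  simp only [gradedCommutator, smul_mul_assoc, mul_smul_comm, smul_sub]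
  rw [smul_comm c]

theorem gradedCommutator_smul_right (p q : ℤ) (c : K) (f g : Module.End K M) :
    gradedCommutator p q f (c • g) = c • gradedCommutator p q f g := by
  simp only [gradedCommutator, smul_mul_assoc, mul_smul_comm, smul_sub]
  rw [smul_comm c]

theorem gradedCommutator_units_smul_left (p q : ℤ) (c : ℤˣ) (f g : Module.End K M) :
    gradedCommutator p q (c • f) g = c • gradedCommutator p q f g := by
  simp only [gradedCommutator, smul_mul_assoc, mul_smul_comm, smul_sub]
  rw [smul_comm c]

theorem gradedCommutator_units_smul_right (p q : ℤ) (c : ℤˣ) (f g : Module.End K M) :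
    gradedCommutator p q f (c • g) = c • gradedCommutator p q f g := by
  simp only [gradedCommutator, smul_mul_assoc, mul_smul_comm, smul_sub]
  rw [smul_comm c]

@[simp] theorem gradedCommutator_zero_left (p q : ℤ) (g : Module.End K M) :
    gradedCommutator p q 0 g = 0 := by simp [gradedCommutator]

@[simp] theorem gradedCommutator_zero_right (p q : ℤ) (g : Module.End K M) :
    gradedCommutator p q g 0 = 0 := by simp [gradedCommutator]

theorem gradedCommutator_neg_left (p q : ℤ) (f g : Module.End K M) :
    gradedCommutator p q (-f) g = -gradedCommutator p q f g := by
  simp [gradedCommutator, sub_eq_add_neg, add_comm]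

/-- Only the parities of the degrees enter the sign. The degrees met below differ by even multiples
of k, so labels such as 1 and 1 - 2k are interchangeable. -/
theorem gradedCommutator_congr {p p' q q' : ℤ} (hp : Even (p - p')) (hq : Even (q - q'))
    (f g : Module.End K M) : gradedCommutator p q f g = gradedCommutator p' q' f g := by
  unfold gradedCommutator
  rw [negOnePow_congr (a := p * q) (b := p' * q')]
  have : p * q - p' * q' = (p - p') * q + p' * (q - q') := by ring
  rw [this]
  exact (hp.mul_right q).add (hq.mul_left p')

theorem gradedCommutator_antisymm (p q : ℤ) (f g : Module.End K M) :
    gradedCommutator p q f g = -((p * q).negOnePow • gradedCommutator q p g f) := by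
  simp only [gradedCommutator, smul_sub, smul_smul, mul_comm q p, negOnePow_mul_self, one_smul]
  abel

/-- The degrees are mere labels determining signs, so the identity needs no homogeneity of the
operators. -/
theorem gradedCommutator_jacobi (p q r : ℤ) (f g h : Module.End K M) :
    gradedCommutator p (q + r) f (gradedCommutator q r g h)
      = gradedCommutator (p + q) r (gradedCommutator p q f g) h
        + (p * q).negOnePow • gradedCommutator q (p + r) g (gradedCommutator p r f h) := by
  simp only [gradedCommutator, smul_sub, smul_smul, mul_sub, sub_mul, smul_mul_assoc,
    mul_smul_comm, mul_assoc, mul_add, add_mul, Int.negOnePow_add]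
  have hu : ∀ x, (p * q).negOnePow * ((p * q).negOnePow * x) = x := fun x => by
    rw [← mul_assoc, negOnePow_mul_self, one_mul]
  simp only [mul_comm q p, hu]
  rw [mul_comm (q * r).negOnePow (p * r).negOnePow, mul_comm (q * r).negOnePow (p * q).negOnePow,
    mul_left_comm (p * r).negOnePow]
  abel

end commutator

/-! ### Differential operators on a graded commutative algebra. -/

namespace CDGA

variable {K : Type u} [Field K] (A : CDGA.{u, v} K)

theorem mulLeft_hasDegree {p : ℤ} {a : A.carrier} (ha : a ∈ A.gr p) :
    A.HasDegree p (LinearMap.mulLeft K a) :=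
  fun _ _ hb => SetLike.mul_mem_graded ha hb

theorem units_smul_mem {M : Type*} [AddCommGroup M] [Module K M] (S : Submodule K M) (c : ℤˣ)
    {x : M} (hx : x ∈ S) : c • x ∈ S := by
  rw [Units.smul_def]; exact zsmul_mem hx _

variable {A}

/-- The sign labels are left free because both products already have degree p + q. -/
theorem HasDegree.gradedCommutator {p q : ℤ} {f g : Module.End K A.carrier}
    (hf : A.HasDegree p f) (hg : A.HasDegree q g) (p' q' : ℤ) :
    A.HasDegree (p + q) (gradedCommutator p' q' f g) := by
  intro r a ha
  refine sub_mem ?_ (units_smul_mem _ _ ?_)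
  · rw [add_assoc]; exact hf _ _ (hg _ _ ha)
  · rw [add_comm p, add_assoc]; exact hg _ _ (hf _ _ ha)

namespace IsDiffOp

theorem hasDegree {r : ℕ} {m : ℤ} {f : Module.End K A.carrier} (h : A.IsDiffOp r m f) :
    A.HasDegree m f := by
  cases r <;> exact h.1

theorem commutator_eq_zero {m p : ℤ} {f : Module.End K A.carrier} (h : A.IsDiffOp 0 m f)
    {a : A.carrier} (ha : a ∈ A.gr p) :
    gradedCommutator m p f (LinearMap.mulLeft K a) = 0 := h.2 p a ha

theorem commutator {r : ℕ} {m p : ℤ} {f : Module.End K A.carrier} (h : A.IsDiffOp (r + 1) m f)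
    {a : A.carrier} (ha : a ∈ A.gr p) :
    A.IsDiffOp r (m + p) (gradedCommutator m p f (LinearMap.mulLeft K a)) := h.2 p a ha

theorem congr_degree {r : ℕ} {m m' : ℤ} {f : Module.End K A.carrier} (h : A.IsDiffOp r m f)
    (e : m = m') : A.IsDiffOp r m' f := e ▸ h

theorem zero (r : ℕ) (m : ℤ) : A.IsDiffOp r m 0 := by
  induction r generalizing m with
  | zero => exact ⟨fun p a _ => zero_mem _, fun p a _ => by simp⟩
  | succ r ih => exact ⟨fun p a _ => zero_mem _, fun p a _ => by simpa using ih _⟩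

theorem add {r : ℕ} {m : ℤ} {f g : Module.End K A.carrier} (hf : A.IsDiffOp r m f)
    (hg : A.IsDiffOp r m g) : A.IsDiffOp r m (f + g) := by
  induction r generalizing m f g with
  | zero =>
    refine ⟨fun p a ha => add_mem (hf.1 p a ha) (hg.1 p a ha), fun p a ha => ?_⟩
    rw [gradedCommutator_add_left, hf.2 p a ha, hg.2 p a ha, add_zero]
  | succ r ih =>
    refine ⟨fun p a ha => add_mem (hf.1 p a ha) (hg.1 p a ha), fun p a ha => ?_⟩
    rw [gradedCommutator_add_left]
    exact ih (hf.2 p a ha) (hg.2 p a ha)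

theorem smul {r : ℕ} {m : ℤ} {f : Module.End K A.carrier} (hf : A.IsDiffOp r m f) (c : K) :
    A.IsDiffOp r m (c • f) := by
  induction r generalizing m f with
  | zero =>
    refine ⟨fun p a ha => Submodule.smul_mem _ c (hf.1 p a ha), fun p a ha => ?_⟩
    rw [gradedCommutator_smul_left, hf.2 p a ha, smul_zero]
  | succ r ih =>
    refine ⟨fun p a ha => Submodule.smul_mem _ c (hf.1 p a ha), fun p a ha => ?_⟩
    rw [gradedCommutator_smul_left]
    exact ih (hf.2 p a ha)

variable (A) in
/-- The space of differential operators of degree `m` and order `≤ r`. -/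
def _root_.CDGA.diffOps (r : ℕ) (m : ℤ) : Submodule K (Module.End K A.carrier) where
  carrier := {f | A.IsDiffOp r m f}
  zero_mem' := zero r m
  add_mem' := add
  smul_mem' c _ h := smul h c

theorem units_smul {r : ℕ} {m : ℤ} {f : Module.End K A.carrier} (hf : A.IsDiffOp r m f) (c : ℤˣ) :
    A.IsDiffOp r m (c • f) := units_smul_mem (A.diffOps r m) c hf

theorem neg {r : ℕ} {m : ℤ} {f : Module.End K A.carrier} (hf : A.IsDiffOp r m f) :
    A.IsDiffOp r m (-f) := (A.diffOps r m).neg_mem hf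

theorem sub {r : ℕ} {m : ℤ} {f g : Module.End K A.carrier} (hf : A.IsDiffOp r m f)
    (hg : A.IsDiffOp r m g) : A.IsDiffOp r m (f - g) := (A.diffOps r m).sub_mem hf hg

theorem sum {r : ℕ} {m : ℤ} {ι : Type*} {s : Finset ι} {f : ι → Module.End K A.carrier}
    (h : ∀ i ∈ s, A.IsDiffOp r m (f i)) : A.IsDiffOp r m (∑ i ∈ s, f i) :=
  (A.diffOps r m).sum_mem h

theorem succ {r : ℕ} {m : ℤ} {f : Module.End K A.carrier} (hf : A.IsDiffOp r m f) :
    A.IsDiffOp (r + 1) m f := by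
  induction r generalizing m f with
  | zero =>
    refine ⟨hf.1, fun p a ha => ?_⟩
    rw [hf.2 p a ha]
    exact zero _ _
  | succ r ih => exact ⟨hf.1, fun p a ha => ih (hf.2 p a ha)⟩

/-- Evaluating the vanishing commutator with a at the unit gives f a as a signed product of a and f
1, and graded commutativity absorbs the sign. Operators of order 0 are therefore determined by their
value at 1, which is how identities between brackets are obtained. -/
theorem eq_mulLeft {m : ℤ} {f : Module.End K A.carrier} (hf : A.IsDiffOp 0 m f) :
    f = LinearMap.mulLeft K (f 1) := by
  ext a
  induction a using graded_induction A.isInternal with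
  | ha a b iha ihb => rw [map_add, map_add, iha, ihb]
  | hm p a ha =>
    have h := LinearMap.congr_fun (hf.2 p a ha) 1
    simp only [gradedCommutator, LinearMap.sub_apply, Module.End.mul_apply,
      LinearMap.mulLeft_apply, mul_one, LinearMap.zero_apply, sub_eq_zero] at h
    have h1 : f 1 ∈ A.gr m := by simpa using hf.1 0 1 SetLike.GradedOne.one_mem
    rw [h, LinearMap.mulLeft_apply, A.graded_comm h1 ha]
    rfl

theorem gradedCommutator_zero_zero {p q : ℤ} {f g : Module.End K A.carrier}
    (hf : A.IsDiffOp 0 p f) (hg : A.IsDiffOp 0 q g) : gradedCommutator p q f g = 0 := by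
  rw [hg.eq_mulLeft]
  exact hf.2 q _ (by simpa using hg.1 0 1 SetLike.GradedOne.one_mem)

/-- The commutator loses one order: by Jacobi, a commutator with a left multiplication falls on f or
on g and lowers the order of that operator, so induction on t applies. Writing r + s = t + 1 avoids
truncated subtraction; the case r = s = 0 it leaves out is `gradedCommutator_zero_zero`. -/
theorem gradedCommutator {r s t : ℕ} {p q : ℤ} {f g : Module.End K A.carrier}
    (hf : A.IsDiffOp r p f) (hg : A.IsDiffOp s q g) (h : r + s = t + 1) :
    A.IsDiffOp t (p + q) (gradedCommutator p q f g) := by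
  have key : ∀ (c : ℤ) (a : A.carrier), _root_.gradedCommutator (p + q) c
      (_root_.gradedCommutator p q f g) (LinearMap.mulLeft K a)
      = _root_.gradedCommutator p (q + c) f (_root_.gradedCommutator q c g (LinearMap.mulLeft K a))
        - (p * q).negOnePow • _root_.gradedCommutator q (p + c) g
          (_root_.gradedCommutator p c f (LinearMap.mulLeft K a)) := fun c a => by
    rw [gradedCommutator_jacobi]; abel
  have hd := hf.hasDegree.gradedCommutator hg.hasDegree p q
  induction t generalizing r s p q f g with
  | zero =>
    refine ⟨hd, fun c a ha => ?_⟩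
    rw [key]
    obtain ⟨rfl, rfl⟩ | ⟨rfl, rfl⟩ : r = 0 ∧ s = 1 ∨ r = 1 ∧ s = 0 := by omega
    · rw [hf.2 c a ha, gradedCommutator_zero_zero hf (hg.2 c a ha)]; simp
    · rw [hg.2 c a ha, gradedCommutator_zero_zero hg (hf.2 c a ha)]; simp
  | succ t ih =>
    have ih' : ∀ {r s : ℕ} {p q : ℤ} {f g : Module.End K A.carrier}, A.IsDiffOp r p f →
        A.IsDiffOp s q g → r + s = t + 1 →
        A.IsDiffOp t (p + q) (_root_.gradedCommutator p q f g) := fun hf hg e =>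
      ih hf hg e (fun c a => by rw [gradedCommutator_jacobi]; abel)
        (hf.hasDegree.gradedCommutator hg.hasDegree _ _)
    refine ⟨hd, fun c a ha => ?_⟩
    rw [key]
    refine sub ?_ (units_smul ?_ _)
    -- An operator of order 0 commutes with left multiplications, so the term vanishes when there is
    -- no order left to lower.
    · cases s with
      | zero => rw [hg.2 c a ha, gradedCommutator_zero_right]; exact zero _ _
      | succ s => exact (ih' hf (hg.2 c a ha) (by omega)).congr_degree (by ring)
    · cases r with
      | zero => rw [hf.2 c a ha, gradedCommutator_zero_right]; exact zero _ _
      | succ r => exact (ih' hg (hf.2 c a ha) (by omega)).congr_degree (by ring)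

end IsDiffOp

theorem one_mem_gr : (1 : A.carrier) ∈ A.gr 0 := SetLike.GradedOne.one_mem

theorem d_one : A.d 1 = 0 := by
  have h := A.d_mul (one_mem_gr (A := A)) 1
  simpa using h

theorem gradedCommutator_d_mulLeft {p : ℤ} {a : A.carrier} (ha : a ∈ A.gr p) :
    gradedCommutator 1 p A.d (LinearMap.mulLeft K a) = LinearMap.mulLeft K (A.d a) := by
  ext b
  simp [gradedCommutator, A.d_mul ha]

theorem isDiffOp_mulLeft {p : ℤ} {a : A.carrier} (ha : a ∈ A.gr p) :
    A.IsDiffOp 0 p (LinearMap.mulLeft K a) := by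
  refine ⟨A.mulLeft_hasDegree ha, fun q b hb => ?_⟩
  ext c
  simp only [gradedCommutator, LinearMap.sub_apply, Module.End.mul_apply, LinearMap.mulLeft_apply,
    LinearMap.smul_apply, LinearMap.zero_apply]
  rw [← mul_assoc, A.graded_comm ha hb, smul_mul_assoc, mul_assoc, sub_self]

theorem isDiffOp_d : A.IsDiffOp 1 1 A.d :=
  ⟨fun p a ha => by rw [add_comm]; exact A.d_mem ha, fun p a ha => by
    rw [gradedCommutator_d_mulLeft ha]
    exact isDiffOp_mulLeft (by rw [add_comm]; exact A.d_mem ha)⟩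

end CDGA

/-! ### The derived bracket of an odd operator of order two. -/

namespace CDGA

variable {K : Type u} [Field K] {A : CDGA.{u, v} K}

theorem mulLeft_injective : Function.Injective fun a : A.carrier => LinearMap.mulLeft K a :=
  fun a b h => by simpa using LinearMap.congr_fun h 1

theorem bracketOf_mem {l : Module.End K A.carrier} {m : ℤ} (hl : A.HasDegree m l)
    {p q : ℤ} {a b : A.carrier} (ha : a ∈ A.gr p) (hb : b ∈ A.gr q) :
    A.bracketOf l a b ∈ A.gr (m + p + q) := by
  rw [bracketOf_apply _ _ ha]
  refine sub_mem (units_smul_mem _ _ (sub_mem ?_ ?_)) ?_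
  · rw [add_assoc]; exact hl _ _ (SetLike.mul_mem_graded ha hb)
  · exact SetLike.mul_mem_graded (hl _ _ ha) hb
  · rw [add_comm m, add_assoc]; exact SetLike.mul_mem_graded ha (hl _ _ hb)

/-- As l has order at most 2, the double commutator has order 0 and only its value at 1 matters.
There l 1 = 0 removes one of the four terms, and the oddness of m brings the signs of the other
three to those of `bracketOf_apply`. -/
theorem mulLeft_bracketOf {l : Module.End K A.carrier} {m : ℤ} (hl : A.IsDiffOp 2 m l)
    (hm : Odd m) (h1 : l 1 = 0) {p q : ℤ} {a b : A.carrier} (ha : a ∈ A.gr p) (hb : b ∈ A.gr q) :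
    LinearMap.mulLeft K (A.bracketOf l a b) = p.negOnePow •
      gradedCommutator (m + p) q (gradedCommutator m p l (LinearMap.mulLeft K a))
        (LinearMap.mulLeft K b) := by
  refine Eq.trans ?_
    (congrArg (p.negOnePow • ·) ((hl.commutator ha).commutator hb).eq_mulLeft.symm)
  rw [bracketOf_apply _ _ ha]
  have hc := A.graded_comm hb (hl.hasDegree p a ha)
  have e : (m * p).negOnePow = p.negOnePow := negOnePow_mul_of_odd_left p hm
  have e' : (q * (m + p)).negOnePow * ((m + p) * q).negOnePow = 1 := by
    rw [mul_comm q, negOnePow_mul_self]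
  have key : (gradedCommutator (m + p) q (gradedCommutator m p l (LinearMap.mulLeft K a))
      (LinearMap.mulLeft K b)) 1 = l (a * b) - l a * b - p.negOnePow • (a * l b) := by
    simp only [gradedCommutator, LinearMap.sub_apply, Module.End.mul_apply,
      LinearMap.mulLeft_apply, mul_one, h1, mul_zero, smul_zero, sub_zero, LinearMap.smul_apply, e,
      hc, smul_smul, mul_comm ((m + p) * q).negOnePow, e', one_smul]
    abel
  rw [key]
  ext c
  simp only [LinearMap.mulLeft_apply, LinearMap.smul_apply, smul_sub, smul_smul,
    negOnePow_mul_self, one_smul, sub_mul, smul_mul_assoc]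

theorem isInternal_shift (c : ℤ) : DirectSum.IsInternal fun p => A.gr (c + p) := by
  have h := (DirectSum.isInternal_submodule_iff_iSupIndep_and_iSup_eq_top _).1 A.isInternal
  refine (DirectSum.isInternal_submodule_iff_iSupIndep_and_iSup_eq_top _).2
    ⟨h.1.comp (add_right_injective c), ?_⟩
  rw [← h.2]
  exact (Equiv.addLeft c).iSup_comp (g := A.gr)

/-- The data making `l` the generator of a DGLA bracket on a shift of `A`. -/
structure IsBracketGenerator (A : CDGA.{u, v} K) (m : ℤ) (l : Module.End K A.carrier) : Prop where
  isDiffOp : A.IsDiffOp 2 m l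
  odd : Odd m
  map_one : l 1 = 0
  commutator_d : gradedCommutator 1 m A.d l = 0
  commutator_self : A.IsDiffOp 2 (m + m) (gradedCommutator m m l l)

theorem mulLeft_add (a b : A.carrier) :
    LinearMap.mulLeft K (a + b) = LinearMap.mulLeft K a + LinearMap.mulLeft K b := by
  ext c; simp [add_mul]

theorem mulLeft_neg (a : A.carrier) : LinearMap.mulLeft K (-a) = -LinearMap.mulLeft K a := by
  ext c; simp

theorem mulLeft_units_smul (u : ℤˣ) (a : A.carrier) :
    LinearMap.mulLeft K (u • a) = u • LinearMap.mulLeft K a := by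
  ext c; simp [smul_mul_assoc]

namespace IsBracketGenerator

variable {l : Module.End K A.carrier} {m : ℤ}

theorem commutator_d_commutator (hl : A.IsBracketGenerator m l) {p : ℤ} {a : A.carrier}
    (ha : a ∈ A.gr p) :
    gradedCommutator 1 (m + p) A.d (gradedCommutator m p l (LinearMap.mulLeft K a))
      = -gradedCommutator m (p + 1) l (LinearMap.mulLeft K (A.d a)) := by
  rw [gradedCommutator_jacobi, hl.commutator_d, gradedCommutator_zero_left, zero_add,
    gradedCommutator_d_mulLeft ha, one_mul, Int.negOnePow_odd _ hl.odd, add_comm 1 p]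
  simp

theorem mulLeft_bracketOf (hl : A.IsBracketGenerator m l) {p q : ℤ} {a b : A.carrier}
    (ha : a ∈ A.gr p) (hb : b ∈ A.gr q) :
    LinearMap.mulLeft K (A.bracketOf l a b) = p.negOnePow •
      gradedCommutator (m + p) q (gradedCommutator m p l (LinearMap.mulLeft K a))
        (LinearMap.mulLeft K b) :=
  CDGA.mulLeft_bracketOf hl.isDiffOp hl.odd hl.map_one ha hb

/-- Jacobi for the odd operator l gives [[l, l], a] = 2 [l, [l, a]], and the left side has order at
most 1 by the assumption on [l, l]. -/
theorem isDiffOp_commutator_commutator [CharZero K] (hl : A.IsBracketGenerator m l) {p : ℤ}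
    {a : A.carrier} (ha : a ∈ A.gr p) :
    A.IsDiffOp 1 (m + (m + p))
      (gradedCommutator m (m + p) l (gradedCommutator m p l (LinearMap.mulLeft K a))) := by
  have h := gradedCommutator_jacobi m m p l l (LinearMap.mulLeft K a)
  rw [Int.negOnePow_odd _ (hl.odd.mul hl.odd), Units.neg_smul, one_smul, eq_add_neg_iff_add_eq,
    ← two_smul K] at h
  have h' := (hl.commutator_self.commutator ha).smul (2 : K)⁻¹
  rw [← h, inv_smul_smul₀ two_ne_zero] at h'
  exact h'.congr_degree (add_assoc _ _ _)

/-- The operator [l, [l, a]] has order at most 1, so its double commutator with b and c is 0. Jacobi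
for l, [l, a], b then leaves exactly the two terms compared here. This is where the Jacobi identity
of the bracket depends on [l, l]. -/
theorem commutator_commutator_commutator [CharZero K] (hl : A.IsBracketGenerator m l) {p q r : ℤ}
    {a b c : A.carrier} (ha : a ∈ A.gr p) (hb : b ∈ A.gr q) (hc : c ∈ A.gr r) :
    gradedCommutator (m + p + (m + q)) r (gradedCommutator (m + p) (m + q)
        (gradedCommutator m p l (LinearMap.mulLeft K a))
        (gradedCommutator m q l (LinearMap.mulLeft K b))) (LinearMap.mulLeft K c)
      = -(p.negOnePow • gradedCommutator (m + (m + p + q)) r (gradedCommutator m (m + p + q) l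
          (gradedCommutator (m + p) q (gradedCommutator m p l (LinearMap.mulLeft K a))
            (LinearMap.mulLeft K b))) (LinearMap.mulLeft K c)) := by
  have h := ((hl.isDiffOp_commutator_commutator ha).commutator hb).commutator_eq_zero hc
  rw [gradedCommutator_jacobi m (m + p) q, gradedCommutator_add_left,
    gradedCommutator_congr (p := m + (m + p + q)) (p' := m + (m + p) + q) ⟨0, by ring⟩ ⟨0, by ring⟩,
    h, zero_add, negOnePow_mul_of_odd_left _ hl.odd, Int.negOnePow_add, Int.negOnePow_odd _ hl.odd,
    gradedCommutator_units_smul_left,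
    gradedCommutator_congr (p := m + (m + p + q)) (p' := m + p + (m + q)) ⟨0, by ring⟩
      ⟨0, by ring⟩, smul_smul, mul_left_comm, negOnePow_mul_self]
  simp

/-- Left multiplications commute, so Jacobi for l, a, b turns [[l, a], b] into [a, [l, b]] up to
sign. -/
theorem bracketOf_antisymm (hl : A.IsBracketGenerator m l) {p q : ℤ} {a b : A.carrier}
    (ha : a ∈ A.gr p) (hb : b ∈ A.gr q) :
    A.bracketOf l a b = -(((p + m) * (q + m)).negOnePow • A.bracketOf l b a) := by
  apply mulLeft_injective
  change LinearMap.mulLeft K _ = LinearMap.mulLeft K _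
  rw [mulLeft_neg, mulLeft_units_smul, hl.mulLeft_bracketOf ha hb, hl.mulLeft_bracketOf hb ha]
  have h := gradedCommutator_jacobi m p q l (LinearMap.mulLeft K a) (LinearMap.mulLeft K b)
  rw [(isDiffOp_mulLeft ha).gradedCommutator_zero_zero (isDiffOp_mulLeft hb),
    gradedCommutator_zero_right, gradedCommutator_antisymm p (m + q)] at h
  rw [eq_comm, add_eq_zero_iff_eq_neg, smul_neg, neg_neg] at h
  rw [h]
  simp only [smul_smul, ← Int.negOnePow_add, ← Units.neg_smul, ← Int.negOnePow_succ]
  congr 1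
  apply negOnePow_congr
  have := hl.odd
  rw [← Int.not_even_iff_odd] at this
  simp only [Int.even_add, Int.even_sub, Int.even_mul, this, Int.not_even_one]
  tauto

/-- Left multiplication by d a is the commutator [d, a], so the Leibniz rule is Jacobi for d against
[[l, a], b], combined with [d, l] = 0. -/
theorem bracketOf_leibniz (hl : A.IsBracketGenerator m l) {p q : ℤ} {a b : A.carrier}
    (ha : a ∈ A.gr p) (hb : b ∈ A.gr q) :
    A.d (A.bracketOf l a b)
      = A.bracketOf l (A.d a) b + (p + m).negOnePow • A.bracketOf l a (A.d b) := by
  apply mulLeft_injective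
  change LinearMap.mulLeft K _ = LinearMap.mulLeft K _
  rw [mulLeft_add, mulLeft_units_smul, hl.mulLeft_bracketOf (A.d_mem ha) hb,
    hl.mulLeft_bracketOf ha (A.d_mem hb),
    ← gradedCommutator_d_mulLeft (bracketOf_mem hl.isDiffOp.hasDegree ha hb),
    hl.mulLeft_bracketOf ha hb, gradedCommutator_units_smul_right, gradedCommutator_jacobi,
    hl.commutator_d_commutator ha, gradedCommutator_d_mulLeft hb, gradedCommutator_neg_left,
    add_comm 1 q, ← add_assoc 1 m p, add_comm 1 m, add_assoc m 1 p, add_comm 1 p]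
  simp only [smul_add, smul_neg, smul_smul, Int.negOnePow_add, Int.negOnePow_one, one_mul,
    Int.negOnePow_odd _ hl.odd, mul_neg, neg_mul, Units.neg_smul,
    mul_one]

/-- On left multiplications this is Jacobi for [l, a], [l, b], c, once [[[l, a], [l, b]], c] has
been rewritten by `commutator_commutator_commutator`. -/
theorem bracketOf_jacobi [CharZero K] (hl : A.IsBracketGenerator m l) {p q r : ℤ} {a b c : A.carrier}
    (ha : a ∈ A.gr p) (hb : b ∈ A.gr q) (hc : c ∈ A.gr r) :
    A.bracketOf l a (A.bracketOf l b c) = A.bracketOf l (A.bracketOf l a b) c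
        + ((p + m) * (q + m)).negOnePow • A.bracketOf l b (A.bracketOf l a c) := by
  have hd := hl.isDiffOp.hasDegree
  apply mulLeft_injective
  change LinearMap.mulLeft K _ = LinearMap.mulLeft K _
  rw [mulLeft_add, mulLeft_units_smul, hl.mulLeft_bracketOf ha (bracketOf_mem hd hb hc),
    hl.mulLeft_bracketOf (bracketOf_mem hd ha hb) hc,
    hl.mulLeft_bracketOf hb (bracketOf_mem hd ha hc), hl.mulLeft_bracketOf hb hc,
    hl.mulLeft_bracketOf ha hc, hl.mulLeft_bracketOf ha hb]
  simp only [gradedCommutator_units_smul_right, gradedCommutator_units_smul_left]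
  rw [gradedCommutator_jacobi (m + p) (m + q) r, hl.commutator_commutator_commutator ha hb hc]
  have hm : Even m ↔ False := by simpa using hl.odd
  rw [smul_add, smul_add, smul_neg, smul_neg, ← Units.neg_smul]
  simp only [smul_smul, ← Int.negOnePow_add, ← Int.negOnePow_succ]
  congr 2 <;> apply negOnePow_congr <;>
  · simp only [Int.even_add, Int.even_sub, Int.even_mul, hm, Int.not_even_one]
    tauto

/-- The condition m + c = 0 makes a bracket of degree m on A a bracket of degree 0 on the shift, and
turns the exponents p + m of the preceding lemmas into shifted degrees. -/
theorem isDGLA [CharZero K] (hl : A.IsBracketGenerator m l) (c : ℤ) (hc : m + c = 0) :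
    DGLAData.IsDGLA (K := K) ⟨A.carrier, fun p => A.gr (c + p), A.d, A.bracketOf l⟩ where
  isInternal := isInternal_shift c
  d_mem {p x} hx := by
    have := A.d_mem (p := c + p) hx
    rwa [add_assoc] at this
  d_d := A.d_d
  bracket_mem {p q x y} hx hy := by
    have := bracketOf_mem hl.isDiffOp.hasDegree hx hy
    rwa [show m + (c + p) + (c + q) = c + (p + q) by linear_combination hc] at this
  antisymm {p q x y} hx hy := by
    refine (hl.bracketOf_antisymm hx hy).trans ?_
    rw [show c + p + m = p by linear_combination hc, show c + q + m = q by linear_combination hc]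
  leibniz {p x} hx y := by
    induction y using graded_induction A.isInternal with
    | hm q y hy =>
      refine (hl.bracketOf_leibniz hx hy).trans ?_
      rw [show c + p + m = p by linear_combination hc]
    | ha y y' h h' =>
      simp only [map_add, smul_add] at h h' ⊢
      rw [h, h']
      abel
  jacobi {p q x y} hx hy z := by
    induction z using graded_induction A.isInternal with
    | hm r z hz =>
      refine (hl.bracketOf_jacobi hx hy hz).trans ?_
      rw [show c + p + m = p by linear_combination hc, show c + q + m = q by linear_combination hc]
    | ha z z' h h' =>
      simp only [map_add, smul_add] at h h' ⊢
      rw [h, h']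
      abel

end IsBracketGenerator

section quasiBV

variable {k : ℤ} {i : Module.End K A.carrier}

theorem lieOp_isDiffOp (hi : A.IsQuasiBV (-(2 * k)) i) : A.IsDiffOp 2 (1 - 2 * k) (A.lieOp k i) :=
  (hi.1.gradedCommutator isDiffOp_d rfl).congr_degree (by ring)

/-- From d² = 0 one gets [d, l] = 0. Jacobi for l, i, d then reduces [l, l] to [[l, i], d], and the
commutator with an operator of order 1 does not raise the order. This is the first of the two uses
of the hypothesis on [l, i]. -/
theorem isBracketGenerator_lieOp (hi : A.IsQuasiBV (-(2 * k)) i)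
    (h : A.IsDiffOp 2 (1 - 2 * k + -(2 * k))
      (gradedCommutator (1 - 2 * k) (-(2 * k)) (A.lieOp k i) i)) :
    A.IsBracketGenerator (1 - 2 * k) (A.lieOp k i) := by
  have hs : ((-(2 * k)) * 1).negOnePow = 1 := Int.negOnePow_even _ ⟨-k, by ring⟩
  have hs' : ((1 : ℤ) * (1 - 2 * k)).negOnePow = -1 := Int.negOnePow_odd _ ⟨-k, by ring⟩
  have hd : A.d * A.d = 0 := LinearMap.ext A.d_d
  have hc : gradedCommutator 1 (1 - 2 * k) A.d (A.lieOp k i) = 0 := by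
    rw [gradedCommutator, hs', lieOp, gradedCommutator, hs, one_smul, Units.neg_smul, one_smul,
      mul_sub, sub_mul, mul_assoc, hd, ← mul_assoc A.d A.d, hd, mul_assoc]
    simp
  refine ⟨lieOp_isDiffOp hi, ⟨-k, by ring⟩, ?_, hc, ?_⟩
  · simp [lieOp, gradedCommutator, hi.2, d_one]
  · have e : gradedCommutator (1 - 2 * k) (1 - 2 * k) (A.lieOp k i) (A.lieOp k i)
        = gradedCommutator (1 - 2 * k) (-(2 * k) + 1) (A.lieOp k i)
          (gradedCommutator (-(2 * k)) 1 i A.d) :=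
      gradedCommutator_congr (by simp) ⟨0, by ring⟩ _ _
    rw [e, gradedCommutator_jacobi, gradedCommutator_antisymm (1 - 2 * k) 1, hc]
    simpa only [smul_zero, neg_zero, gradedCommutator_zero_right, add_zero] using
      (h.gradedCommutator isDiffOp_d rfl).congr_degree (by ring)

theorem koszulData_isDGLA [CharZero K] (hi : A.IsQuasiBV (-(2 * k)) i)
    (h : A.IsQuasiBV (1 - 2 * k + -(2 * k))
      (gradedCommutator (1 - 2 * k) (-(2 * k)) (A.lieOp k i) i)) :
    (A.koszulData k i).IsDGLA :=
  (isBracketGenerator_lieOp hi h.1).isDGLA (2 * k - 1) (by ring)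

end quasiBV

end CDGA

/-! ### Square-zero extensions: the forms on the line and the cone algebra. -/

section squareZero

open TrivSqZeroExt

variable (K : Type u) [Field K] (R : Type u) [CommRing R] [Algebra K R]

/-- The grading on `R ⊕ R ε` with `R` in degree `0` and `ε` in degree `e`. -/
def sqZeroGr (e p : ℤ) : Submodule K (TrivSqZeroExt R R) where
  carrier := {x | (p ≠ 0 → x.fst = 0) ∧ (p ≠ e → x.snd = 0)}
  zero_mem' := by simp
  add_mem' ha hb := ⟨fun h => by simp [ha.1 h, hb.1 h], fun h => by simp [ha.2 h, hb.2 h]⟩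
  smul_mem' c _ ha := ⟨fun h => by simp [ha.1 h], fun h => by simp [ha.2 h]⟩

variable {R}

theorem inl_mem_sqZeroGr (e : ℤ) (r : R) : (inl r : TrivSqZeroExt R R) ∈ sqZeroGr K R e 0 :=
  ⟨fun h => (h rfl).elim, fun _ => rfl⟩

theorem inr_mem_sqZeroGr (e : ℤ) (r : R) : (inr r : TrivSqZeroExt R R) ∈ sqZeroGr K R e e :=
  ⟨fun _ => rfl, fun h => (h rfl).elim⟩

variable (R)

theorem sqZeroGr_isInternal {e : ℤ} (he : Odd e) : DirectSum.IsInternal (sqZeroGr K R e) := by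
  have he0 : e ≠ 0 := by rintro rfl; simp at he
  refine isInternal_of_split ?_ (Finsupp.lsingle 0 ∘ₗ (inlAlgHom K R R).toLinearMap ∘ₗ
    (fstHom K R R).toLinearMap + Finsupp.lsingle e ∘ₗ (inrHom R R).restrictScalars K ∘ₗ
    (sndHom R R).restrictScalars K) ?_
  · rw [eq_top_iff]
    rintro x -
    rw [← inl_fst_add_inr_snd_eq x]
    exact add_mem (Submodule.mem_iSup_of_mem 0 (inl_mem_sqZeroGr K e _))
      (Submodule.mem_iSup_of_mem e (inr_mem_sqZeroGr K e _))
  · intro p x hx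
    by_cases hp : p = 0
    · subst hp
      have h := hx.2 he0.symm
      have h' : inl x.fst = x := TrivSqZeroExt.ext rfl (by simp [h])
      simp [h, h']
    · have h := hx.1 hp
      by_cases hq : p = e
      · subst hq
        have h' : inr x.snd = x := TrivSqZeroExt.ext (by simp [h]) rfl
        rw [LinearMap.add_apply]
        change Finsupp.single 0 (inl x.fst) + Finsupp.single p (inr x.snd) = _
        rw [h', h, inl_zero, Finsupp.single_zero, zero_add]
      · have h' : x = 0 := TrivSqZeroExt.ext h (hx.2 hq)
        simp [h']

theorem sqZeroGr_gradedMonoid {e : ℤ} (he : Odd e) : SetLike.GradedMonoid (sqZeroGr K R e) where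
  one_mem := inl_mem_sqZeroGr K e 1
  mul_mem p q x y hx hy := by
    have he0 : e ≠ 0 := by rintro rfl; simp at he
    constructor
    · intro h
      by_cases hp : p = 0
      · have hq : q ≠ 0 := by omega
        simp [hy.1 hq]
      · simp [hx.1 hp]
    · intro h
      have h1 : x.fst = 0 ∨ y.snd = 0 := by
        by_cases hp : p = 0
        · exact Or.inr (hy.2 (by omega))
        · exact Or.inl (hx.1 hp)
      have h2 : x.snd = 0 ∨ y.fst = 0 := by
        by_cases hq : q = 0
        · exact Or.inl (hx.2 (by omega))
        · exact Or.inr (hy.1 hq)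
      rcases h1 with h1 | h1 <;> rcases h2 with h2 | h2 <;> simp [h1, h2]

/-- The CDGA `R ⊕ R ε`, `|ε| = e` odd, with a given differential. -/
noncomputable def sqZeroCDGA {e : ℤ} (he : Odd e)
    (d : TrivSqZeroExt R R →ₗ[K] TrivSqZeroExt R R)
    (hd : ∀ {p : ℤ} {a}, a ∈ sqZeroGr K R e p → d a ∈ sqZeroGr K R e (p + 1))
    (hdd : ∀ a, d (d a) = 0)
    (hmul : ∀ {p : ℤ} {a}, a ∈ sqZeroGr K R e p → ∀ b,
      d (a * b) = d a * b + p.negOnePow • (a * d b)) : CDGA.{u, u} K where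
  carrier := TrivSqZeroExt R R
  gr := sqZeroGr K R e
  graded :=
    { sqZeroGr_gradedMonoid K R he, (sqZeroGr_isInternal K R he).chooseDecomposition with }
  d := d
  d_mem := hd
  d_d := hdd
  d_mul := hmul
  graded_comm {p q a b} ha hb := by
    -- The square-zero extension is strictly commutative, so a sign appears only when both degrees
    -- are odd; then both elements are multiples of ε and the product is 0.
    by_cases h : Even (p * q)
    · rw [Int.negOnePow_even _ h, one_smul, mul_comm]
    · rw [Int.not_even_iff_odd, Int.odd_mul] at h
      have hp : p ≠ 0 := by rintro rfl; simp at h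
      have hq : q ≠ 0 := by rintro rfl; simp at h
      have h0 : a * b = 0 := TrivSqZeroExt.ext (by simp [ha.1 hp]) (by simp [ha.1 hp, hb.1 hq])
      rw [mul_comm b a, h0, smul_zero]

end squareZero

section interval

open Polynomial TrivSqZeroExt

variable (K : Type u) [Field K]

/-- The de Rham algebra `K[t, dt]` of the affine line. -/
noncomputable def lineForms : CDGA.{u, u} K :=
  sqZeroCDGA K K[X] odd_one
    ((inrHom K[X] K[X]).restrictScalars K ∘ₗ derivative ∘ₗ (fstHom K K[X] K[X]).toLinearMap)
    (fun {p a} ha => by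
      refine ⟨fun _ => rfl, fun h => ?_⟩
      have := ha.1 (by rintro rfl; exact h rfl)
      simp [this])
    (fun a => by simp)
    (fun {p a} ha b => by
      have hs : ∀ x : TrivSqZeroExt K[X] K[X], (p.negOnePow • x).fst = p.negOnePow • x.fst ∧
          (p.negOnePow • x).snd = p.negOnePow • x.snd := fun x => by
        rcases Int.units_eq_one_or p.negOnePow with h | h <;> simp [h]
      refine TrivSqZeroExt.ext ?_ ?_
      · simp [hs, -DualNumber.inr_eq_smul_eps]
      by_cases hp : p = 0
      · subst hp
        simp [derivative_mul]
        ring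
      · simp [hs, ha.1 hp, -DualNumber.inr_eq_smul_eps])

/-- The acyclic CDGA `K ⊕ K ε` with `|ε| = -1` and `d ε = 1`. -/
noncomputable def coneAlg : CDGA.{u, u} K :=
  sqZeroCDGA K K (e := -1) (by decide)
    ((inlAlgHom K K K).toLinearMap ∘ₗ (sndHom K K).restrictScalars K)
    (fun {p a} ha => by
      refine ⟨fun h => ?_, fun _ => rfl⟩
      have := ha.2 (by rintro rfl; exact h rfl)
      simp [this])
    (fun a => by simp)
    (fun {p a} ha b => by
      have hs : ∀ x : TrivSqZeroExt K K, (p.negOnePow • x).fst = p.negOnePow • x.fst ∧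
          (p.negOnePow • x).snd = p.negOnePow • x.snd := fun x => by
        rcases Int.units_eq_one_or p.negOnePow with h | h <;> simp [h]
      by_cases hp : p = 0
      · subst hp
        exact TrivSqZeroExt.ext (by simp [ha.2 (by decide)]) (by simp [ha.2 (by decide)])
      · by_cases hq : p = -1
        · subst hq
          exact TrivSqZeroExt.ext (by simp [ha.1 hp]) (by simp [ha.1 hp])
        · exact TrivSqZeroExt.ext (by simp [hs, ha.1 hp, ha.2 hq])
            (by simp [hs, ha.1 hp, ha.2 hq]))

namespace lineForms

variable {K}

/-- The function `f` as a form of degree `0`. -/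
noncomputable def fn (f : K[X]) : (lineForms K).carrier := (inl f : TrivSqZeroExt K[X] K[X])

/-- The one-form `f dt`. -/
noncomputable def form (f : K[X]) : (lineForms K).carrier := (inr f : TrivSqZeroExt K[X] K[X])

theorem fn_mem (f : K[X]) : fn f ∈ (lineForms K).gr 0 := inl_mem_sqZeroGr K 1 f
theorem form_mem (f : K[X]) : form f ∈ (lineForms K).gr 1 := inr_mem_sqZeroGr K 1 f

theorem d_fn (f : K[X]) : (lineForms K).d (fn f) = form (derivative f) := rfl

theorem d_form (f : K[X]) : (lineForms K).d (form f) = 0 :=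
  show (inr (derivative (0 : K[X])) : TrivSqZeroExt K[X] K[X]) = 0 by simp

theorem form_mul_form (f g : K[X]) : form f * form g = 0 := inr_mul_inr _ _ _

theorem exists_eq (b : (lineForms K).carrier) : ∃ f g : K[X], b = fn f + form g :=
  ⟨_, _, (inl_fst_add_inr_snd_eq (R := K[X]) (M := K[X]) b).symm⟩

theorem exists_eq_of_mem {p : ℤ} {b : (lineForms K).carrier} (hb : b ∈ (lineForms K).gr p) :
    (p = 0 ∧ ∃ f, b = fn f) ∨ (p = 1 ∧ ∃ f, b = form f) ∨ b = 0 := by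
  by_cases h : p = 0
  · exact Or.inl ⟨h, _, TrivSqZeroExt.ext rfl (hb.2 (by omega))⟩
  · by_cases h1 : p = 1
    · exact Or.inr (Or.inl ⟨h1, _, TrivSqZeroExt.ext (hb.1 h) rfl⟩)
    · exact Or.inr (Or.inr (TrivSqZeroExt.ext (hb.1 h) (hb.2 h1)))

/-- Evaluation at a point of the line. -/
noncomputable def eval (a : K) : (lineForms K).carrier →ₐ[K] K :=
  (aeval a).comp (fstHom K K[X] K[X])

theorem eval_fn (a : K) (f : K[X]) : eval a (fn f) = f.eval a := by
  change aeval a f = _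
  simp [aeval_def]

theorem eval_form (a : K) (f : K[X]) : eval a (form f) = 0 := by
  change aeval a (0 : K[X]) = _
  simp

theorem eval_eq_zero (a : K) {p : ℤ} (hp : p ≠ 0) {b : (lineForms K).carrier}
    (hb : b ∈ (lineForms K).gr p) : eval a b = 0 := by
  change aeval a (TrivSqZeroExt.fst b) = 0
  rw [hb.1 hp, map_zero]

theorem eval_d (a : K) (b : (lineForms K).carrier) : eval a ((lineForms K).d b) = 0 :=
  eval_form a _

/-- The primitive of a polynomial vanishing at the origin. -/
noncomputable def primitive : K[X] →ₗ[K] K[X] :=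
  Polynomial.lsum fun n => ((n : K) + 1)⁻¹ • monomial (n + 1)

theorem primitive_monomial (n : ℕ) (a : K) :
    primitive (monomial n a) = monomial (n + 1) (((n : K) + 1)⁻¹ * a) := by
  simp [primitive, Polynomial.lsum_apply, sum_monomial_index, smul_monomial]

theorem eval_zero_primitive (f : K[X]) : (primitive f).eval 0 = 0 := by
  induction f using Polynomial.induction_on' with
  | add f g hf hg => simp [hf, hg]
  | monomial n a => simp [primitive_monomial]

theorem derivative_primitive [CharZero K] (f : K[X]) : derivative (primitive f) = f := by
  induction f using Polynomial.induction_on' with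
  | add f g hf hg => simp [hf, hg]
  | monomial n a =>
    have : (n : K) + 1 ≠ 0 := by exact_mod_cast n.succ_ne_zero
    rw [primitive_monomial, derivative_monomial]
    congr 1
    push_cast
    field_simp

theorem primitive_derivative [CharZero K] (f : K[X]) :
    primitive (derivative f) = f - C (f.eval 0) := by
  induction f using Polynomial.induction_on' with
  | add f g hf hg => simp [hf, hg]; ring
  | monomial n a =>
    rw [derivative_monomial, primitive_monomial]
    cases n with
    | zero => simp
    | succ n =>
      have : (n : K) + 1 ≠ 0 := by exact_mod_cast n.succ_ne_zero
      simp
      field_simp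

/-- Integration from the origin, as a homotopy on `K[t, dt]`. -/
noncomputable def integrate : (lineForms K).carrier →ₗ[K] (lineForms K).carrier :=
  (inlAlgHom K K[X] K[X]).toLinearMap ∘ₗ primitive ∘ₗ (sndHom K[X] K[X]).restrictScalars K

theorem integrate_fn (f : K[X]) : integrate (fn f) = 0 := by
  change (inl (primitive (0 : K[X])) : TrivSqZeroExt K[X] K[X]) = 0
  simp

theorem integrate_form (f : K[X]) : integrate (form f) = fn (primitive f) := rfl

end lineForms

namespace coneAlg

variable {K}

/-- The generator of degree `-1`. -/
def eps : (coneAlg K).carrier := (inr 1 : TrivSqZeroExt K K)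

theorem eps_mem : (eps : (coneAlg K).carrier) ∈ (coneAlg K).gr (-1) := inr_mem_sqZeroGr K (-1) 1

theorem d_eps : (coneAlg K).d (eps : (coneAlg K).carrier) = 1 := rfl

theorem eps_mul_eps : (eps * eps : (coneAlg K).carrier) = 0 := inr_mul_inr _ _ _

/-- The augmentation killing `ε`. -/
noncomputable def aug : (coneAlg K).carrier →ₐ[K] K := fstHom K K K

/-- The coefficient of `ε`. -/
noncomputable def coeff : (coneAlg K).carrier →ₗ[K] K := (sndHom K K).restrictScalars K

theorem coeff_eps : coeff (eps : (coneAlg K).carrier) = 1 := rfl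

theorem coeff_one : coeff (1 : (coneAlg K).carrier) = 0 := rfl

theorem aug_eq_zero {p : ℤ} (hp : p ≠ 0) {b : (coneAlg K).carrier}
    (hb : b ∈ (coneAlg K).gr p) : aug b = 0 := hb.1 hp

theorem exists_eq_of_mem {p : ℤ} {b : (coneAlg K).carrier} (hb : b ∈ (coneAlg K).gr p) :
    (p = 0 ∧ ∃ c : K, b = c • 1) ∨ (p = -1 ∧ ∃ c : K, b = c • eps) ∨ b = 0 := by
  by_cases h : p = 0
  · exact Or.inl ⟨h, TrivSqZeroExt.fst b, TrivSqZeroExt.ext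
      (show _ = TrivSqZeroExt.fst b • (1 : K) by simp)
      ((hb.2 (by omega)).trans (show _ = TrivSqZeroExt.fst b • (0 : K) by simp))⟩
  · by_cases h1 : p = -1
    · exact Or.inr (Or.inl ⟨h1, TrivSqZeroExt.snd b, TrivSqZeroExt.ext
        ((hb.1 h).trans (show _ = TrivSqZeroExt.snd b • (0 : K) by simp))
        (show _ = TrivSqZeroExt.snd b • (1 : K) by simp)⟩)
    · exact Or.inr (Or.inr (TrivSqZeroExt.ext (hb.1 h) (hb.2 h1)))

end coneAlg

end interval

/-! ### Quasi-isomorphisms, sub-DGLAs and contractions of tensor products. -/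

namespace DGLA

variable {K : Type u} [Field K]

theorem Hom.isQuasiIso_of {L : DGLA.{u, v} K} {M : DGLA.{u, w} K} (f : Hom L M)
    (surj : ∀ p y, y ∈ M.gr p → M.d y = 0 → ∃ x ∈ L.gr p, L.d x = 0 ∧
      ∃ w ∈ M.gr (p - 1), M.d w = f.toLinearMap x - y)
    (inj : ∀ p x, x ∈ L.gr p → L.d x = 0 → ∀ w ∈ M.gr (p - 1), M.d w = f.toLinearMap x →
      ∃ z ∈ L.gr (p - 1), L.d z = x) : f.IsQuasiIso := by
  intro p
  constructor
  · rw [injective_iff_map_eq_zero]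
    intro x hx
    obtain ⟨x, rfl⟩ := Submodule.Quotient.mk_surjective _ x
    change Submodule.Quotient.mk (f.mapCocycles p x) = 0 at hx
    rw [Submodule.Quotient.mk_eq_zero] at hx ⊢
    obtain ⟨w, hw, hw'⟩ := hx
    exact inj p x.1 x.2.1 x.2.2 w hw hw'
  · intro y
    obtain ⟨y, rfl⟩ := Submodule.Quotient.mk_surjective _ y
    obtain ⟨x, hx, hdx, w, hw, hw'⟩ := surj p y.1 y.2.1 y.2.2
    refine ⟨Submodule.Quotient.mk ⟨x, hx, hdx⟩, ?_⟩
    exact (Submodule.Quotient.eq _).2 ⟨w, hw, hw'⟩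

/-- The DGLA with the same underlying complex as `L` and zero bracket. -/
noncomputable def abelianization (L : DGLA.{u, v} K) : DGLA.{u, v} K where
  carrier := L.carrier
  gr := L.gr
  d := L.d
  bracket := 0
  isDGLA :=
    { isInternal := L.isDGLA.isInternal
      d_mem := L.isDGLA.d_mem
      d_d := L.isDGLA.d_d
      bracket_mem := fun _ _ => zero_mem _
      antisymm := fun _ _ => by simp
      leibniz := fun _ _ => by simp
      jacobi := fun _ _ _ => by simp }

section restrict

variable (M : DGLA.{u, v} K) (S : Submodule K M.carrier) (hd : ∀ x ∈ S, M.d x ∈ S)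
  (hb : ∀ x ∈ S, ∀ y ∈ S, M.bracket x y ∈ S)

theorem iSupIndep_inf_gr : iSupIndep fun p => S ⊓ M.gr p :=
  (((DirectSum.isInternal_submodule_iff_iSupIndep_and_iSup_eq_top _).1
    M.isDGLA.isInternal).1).mono fun _ => inf_le_right

theorem d_mem_iSup_inf (hd : ∀ x ∈ S, M.d x ∈ S) {x : M.carrier} (hx : x ∈ ⨆ p, S ⊓ M.gr p) :
    M.d x ∈ ⨆ p, S ⊓ M.gr p := by
  induction hx using Submodule.iSup_induction' with
  | mem p x hx => exact Submodule.mem_iSup_of_mem (p + 1) ⟨hd x hx.1, M.isDGLA.d_mem hx.2⟩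
  | zero => rw [map_zero]; exact zero_mem _
  | add x y _ _ hx hy => rw [map_add]; exact add_mem hx hy

theorem bracket_mem_iSup_inf (hb : ∀ x ∈ S, ∀ y ∈ S, M.bracket x y ∈ S) {x y : M.carrier}
    (hx : x ∈ ⨆ p, S ⊓ M.gr p) (hy : y ∈ ⨆ p, S ⊓ M.gr p) :
    M.bracket x y ∈ ⨆ p, S ⊓ M.gr p := by
  induction hx using Submodule.iSup_induction' with
  | zero => rw [map_zero]; exact zero_mem _
  | add x y _ _ hx hy => rw [map_add]; exact add_mem hx hy
  | mem p x hx =>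
    induction hy using Submodule.iSup_induction' with
    | mem q y hy =>
      exact Submodule.mem_iSup_of_mem (p + q) ⟨hb x hx.1 y hy.1, M.isDGLA.bracket_mem hx.2 hy.2⟩
    | zero => rw [map_zero]; exact zero_mem _
    | add x y _ _ hx hy => rw [map_add]; exact add_mem hx hy

/-- The largest graded sub-DGLA contained in a subspace closed under differential and bracket. -/
noncomputable def restrict : DGLA.{u, v} K where
  carrier := ↥(⨆ p, S ⊓ M.gr p)
  gr p := (S ⊓ M.gr p).comap (⨆ p, S ⊓ M.gr p).subtype
  d := M.d.restrict fun _ hx => d_mem_iSup_inf M S hd hx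
  bracket := LinearMap.mk₂ K
    (fun x y => ⟨M.bracket x.1 y.1, bracket_mem_iSup_inf M S hb x.2 y.2⟩)
    (fun _ _ _ => by ext1; simp) (fun _ _ _ => by ext1; simp)
    (fun _ _ _ => by ext1; simp) (fun _ _ _ => by ext1; simp)
  isDGLA :=
    { isInternal := isInternal_comap_iSup (iSupIndep_inf_gr M S)
      d_mem := fun hx => ⟨hd _ hx.1, M.isDGLA.d_mem hx.2⟩
      d_d := fun x => Subtype.ext (M.isDGLA.d_d _)
      bracket_mem := fun hx hy => ⟨hb _ hx.1 _ hy.1, M.isDGLA.bracket_mem hx.2 hy.2⟩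
      antisymm := fun hx hy => Subtype.ext (M.isDGLA.antisymm hx.2 hy.2)
      leibniz := fun hx y => Subtype.ext (M.isDGLA.leibniz hx.2 _)
      jacobi := fun hx hy z => Subtype.ext (M.isDGLA.jacobi hx.2 hy.2 _) }

/-- Elements of `restrict` that are homogeneous. -/
def restrictMk {x : M.carrier} {p : ℤ} (hx : x ∈ S) (hp : x ∈ M.gr p) :
    (M.restrict S hd hb).carrier :=
  ⟨x, Submodule.mem_iSup_of_mem p ⟨hx, hp⟩⟩

theorem restrict_coe_mem (x : (M.restrict S hd hb).carrier) : x.1 ∈ S :=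
  (iSup_le fun _ => inf_le_left : ⨆ p, S ⊓ M.gr p ≤ S) x.2

/-- Morphisms into `restrict`. -/
noncomputable def restrictLift {L : DGLA.{u, w} K} (f : Hom L M)
    (hf : ∀ p x, x ∈ L.gr p → f.toLinearMap x ∈ S) : Hom L (M.restrict S hd hb) where
  toLinearMap := f.toLinearMap.codRestrict _ fun x => by
    induction x using graded_induction L.isDGLA.isInternal with
    | hm p x hx => exact Submodule.mem_iSup_of_mem p ⟨hf p x hx, f.map_mem hx⟩
    | ha x y hx hy => rw [map_add]; exact add_mem hx hy
  map_mem hx := ⟨hf _ _ hx, f.map_mem hx⟩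
  map_d x := Subtype.ext (f.map_d x)
  map_bracket x y := Subtype.ext (f.map_bracket x y)

end restrict

section contract

open TensorProduct

variable {B : CDGA.{u, w} K} {M : DGLA.{u, v} K}

/-- Contraction of a tensor product with a linear form on the first factor. -/
noncomputable def contract (φ : B.carrier →ₗ[K] K) : B.carrier ⊗[K] M.carrier →ₗ[K] M.carrier :=
  (TensorProduct.lid K M.carrier).toLinearMap ∘ₗ TensorProduct.map φ LinearMap.id

@[simp] theorem contract_tmul (φ : B.carrier →ₗ[K] K) (b : B.carrier) (m : M.carrier) :
    contract φ (b ⊗ₜ[K] m) = φ b • m := by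
  simp [contract]

/-- Meant for two characters, evaluation at a point of the line and the augmentation of the cone
algebra. They kill all forms of nonzero degree, so a surviving b ⊗ m has the degree of m. -/
theorem contract_mem (φ : B.carrier →ₐ[K] K) (hφ : ∀ p b, p ≠ 0 → b ∈ B.gr p → φ b = 0)
    {r : ℤ} {x : B.carrier ⊗[K] M.carrier} (hx : x ∈ CDGA.tensorGr B M r) :
    contract φ.toLinearMap x ∈ M.gr r := by
  induction hx using CDGA.tensorGr_induction with
  | ha x y _ _ hx hy => rw [map_add]; exact add_mem hx hy
  | hm p q b m h hb hm =>
    rw [contract_tmul]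
    by_cases hp : p = 0
    · subst hp
      obtain rfl : q = r := by omega
      exact Submodule.smul_mem _ _ hm
    · rw [AlgHom.toLinearMap_apply, hφ p b hp hb, zero_smul]
      exact zero_mem _

/-- The Koszul sign is trivial on the terms that survive, those whose second factor from B has
degree 0. -/
theorem contract_bracket (φ : B.carrier →ₐ[K] K) (hφ : ∀ p b, p ≠ 0 → b ∈ B.gr p → φ b = 0)
    (x y : B.carrier ⊗[K] M.carrier) :
    contract φ.toLinearMap (CDGA.tensorBracket B M x y)
      = M.bracket (contract φ.toLinearMap x) (contract φ.toLinearMap y) := by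
  induction x using CDGA.tensor_induction with
  | ha x x' hx hx' => simp only [map_add, LinearMap.add_apply, hx, hx']
  | hm p q b a hb ha =>
    induction y using CDGA.tensor_induction with
    | ha y y' hy hy' => simp only [map_add, hy, hy']
    | hm p' q' b' a' hb' ha' =>
      rw [CDGA.tensorBracket_tmul b ha hb', Units.smul_def, map_zsmul]
      simp only [contract_tmul, AlgHom.toLinearMap_apply, map_mul, map_smul, LinearMap.smul_apply]
      by_cases hp : p' = 0
      · subst hp
        simp [smul_smul, mul_comm]
      · simp [hφ p' b' hp hb']

end contract

/-- A DGLA `M` with a sub-DGLA, the kernel of `π`, whose quotient complex is `L[1]`. -/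
structure Complement (M : DGLA.{u, v} K) (L : DGLA.{u, w} K) where
  π : M.carrier →ₗ[K] L.carrier
  s : L.carrier →ₗ[K] M.carrier
  π_mem : ∀ {p x}, x ∈ M.gr p → π x ∈ L.gr (p + 1)
  s_mem : ∀ {p x}, x ∈ L.gr p → s x ∈ M.gr (p - 1)
  π_s : ∀ x, π (s x) = x
  π_d : ∀ x, π (M.d x) = -L.d (π x)
  π_bracket : ∀ x y, π x = 0 → π y = 0 → π (M.bracket x y) = 0

/-! ### Polynomial paths, evaluation and integration. -/

section pathFiber

open TensorProduct lineForms

variable {M : DGLA.{u, v} K} {L : DGLA.{u, w} K}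

/-- Polynomial paths `M[t, dt]`. -/
noncomputable abbrev paths (M : DGLA.{u, v} K) : DGLA.{u, max u v} K := (lineForms K).tensor M

/-- Evaluation of a path at a point. -/
noncomputable def evalPath (a : K) : (paths M).carrier →ₗ[K] M.carrier :=
  contract (lineForms.eval a).toLinearMap

theorem evalPath_mem (a : K) {p : ℤ} {x : (paths M).carrier} (hx : x ∈ (paths M).gr p) :
    evalPath a x ∈ M.gr p :=
  contract_mem _ (fun _ _ h h' => lineForms.eval_eq_zero a h h') hx

theorem evalPath_bracket (a : K) (x y : (paths M).carrier) :
    evalPath a ((paths M).bracket x y) = M.bracket (evalPath a x) (evalPath a y) :=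
  contract_bracket _ (fun _ _ h h' => lineForms.eval_eq_zero a h h') x y

theorem evalPath_d (a : K) (x : (paths M).carrier) :
    evalPath a ((paths M).d x) = M.d (evalPath a x) := by
  change contract (lineForms.eval a).toLinearMap (CDGA.tensorD _ _ x)
    = M.d (contract (lineForms.eval a).toLinearMap x)
  induction x using CDGA.tensor_induction with
  | ha x y hx hy => simp only [map_add, hx, hy]
  | hm p q b m hb hm =>
    rw [CDGA.tensorD_tmul hb, map_add, Units.smul_def, map_zsmul]
    simp only [contract_tmul, AlgHom.toLinearMap_apply, eval_d, zero_smul, zero_add, map_smul]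
    by_cases hp : p = 0
    · subst hp; simp
    · rw [lineForms.eval_eq_zero a hp hb]; simp

/-- The path `ω ⊗ m`. -/
noncomputable def pathMk (b : (lineForms K).carrier) (m : M.carrier) : (paths M).carrier :=
  b ⊗ₜ[K] m

theorem pathMk_zero_left (m : M.carrier) : pathMk 0 m = 0 := TensorProduct.zero_tmul _ _

theorem pathMk_zero_right (b : (lineForms K).carrier) : pathMk b (0 : M.carrier) = 0 :=
  TensorProduct.tmul_zero _ _

theorem pathMk_add_right (b : (lineForms K).carrier) (m m' : M.carrier) :
    pathMk b (m + m') = pathMk b m + pathMk b m' := TensorProduct.tmul_add _ _ _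

theorem pathMk_neg_right (b : (lineForms K).carrier) (m : M.carrier) :
    pathMk b (-m) = -pathMk b m := TensorProduct.tmul_neg _ _

theorem pathMk_smul_right (b : (lineForms K).carrier) (c : K) (m : M.carrier) :
    pathMk b (c • m) = c • pathMk b m := TensorProduct.tmul_smul _ _ _

theorem pathMk_sub_left (b b' : (lineForms K).carrier) (m : M.carrier) :
    pathMk (b - b') m = pathMk b m - pathMk b' m := TensorProduct.sub_tmul _ _ _

theorem pathMk_smul_left (b : (lineForms K).carrier) (c : K) (m : M.carrier) :
    pathMk (c • b) m = c • pathMk b m := (TensorProduct.smul_tmul' _ _ _).symm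

theorem evalPath_pathMk (a : K) (b : (lineForms K).carrier) (m : M.carrier) :
    evalPath a (pathMk b m) = lineForms.eval a b • m := contract_tmul _ _ _

/-- Integration of paths from the origin. -/
noncomputable def integratePath : (paths M).carrier →ₗ[K] (paths M).carrier :=
  TensorProduct.map integrate LinearMap.id

theorem integratePath_pathMk (b : (lineForms K).carrier) (m : M.carrier) :
    integratePath (pathMk b m) = pathMk (integrate b) m := rfl

theorem integratePath_mem {p : ℤ} {x : (paths M).carrier} (hx : x ∈ (paths M).gr p) :
    integratePath x ∈ (paths M).gr (p - 1) := by
  change x ∈ CDGA.tensorGr _ _ p at hx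
  change TensorProduct.map integrate LinearMap.id x ∈ CDGA.tensorGr _ _ (p - 1)
  induction hx using CDGA.tensorGr_induction with
  | ha x y _ _ hx hy => rw [map_add]; exact add_mem hx hy
  | hm p' q b m h hb hm =>
    rw [TensorProduct.map_tmul, LinearMap.id_apply]
    rcases exists_eq_of_mem hb with ⟨rfl, f, rfl⟩ | ⟨rfl, f, rfl⟩ | rfl
    · rw [integrate_fn, TensorProduct.zero_tmul]; exact zero_mem _
    · exact CDGA.tmul_mem_tensorGr (fn_mem _) hm (by omega)
    · rw [map_zero, TensorProduct.zero_tmul]; exact zero_mem _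

theorem d_pathMk_fn (f : Polynomial K) (m : M.carrier) :
    (paths M).d (pathMk (fn f) m)
      = pathMk (form (Polynomial.derivative f)) m + pathMk (fn f) (M.d m) := by
  refine (CDGA.tensorD_tmul (fn_mem f) m).trans ?_
  rw [Int.negOnePow_zero, one_smul, d_fn]
  rfl

theorem d_pathMk_form (f : Polynomial K) (m : M.carrier) :
    (paths M).d (pathMk (form f) m) = -pathMk (form f) (M.d m) := by
  refine (CDGA.tensorD_tmul (form_mem f) m).trans ?_
  rw [d_form, TensorProduct.zero_tmul, zero_add, Int.negOnePow_one, Units.neg_smul, one_smul]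
  rfl

theorem pathMk_mem {p q r : ℤ} {b : (lineForms K).carrier} {m : M.carrier}
    (hb : b ∈ (lineForms K).gr p) (hm : m ∈ M.gr q) (h : p + q = r) :
    pathMk b m ∈ (paths M).gr r := CDGA.tmul_mem_tensorGr hb hm h

theorem path_induction {P : (paths M).carrier → Prop} (hf : ∀ f m, P (pathMk (fn f) m))
    (hg : ∀ f m, P (pathMk (form f) m)) (ha : ∀ x y, P x → P y → P (x + y))
    (x : (paths M).carrier) : P x := by
  refine TensorProduct.induction_on x ?_ (fun b m => ?_) ha
  · have := hf 0 0
    rwa [pathMk, TensorProduct.tmul_zero] at this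
  · obtain ⟨f, g, rfl⟩ := exists_eq b
    rw [TensorProduct.add_tmul]
    exact ha _ _ (hf f m) (hg g m)

/-- The fundamental theorem of calculus: integration from the origin is a homotopy from the identity
to the constant path at the starting point. For functions it reads ∫ f' = f - f(0), for one-forms (∫
f)' = f. -/
theorem d_integratePath [CharZero K] (x : (paths M).carrier) :
    (paths M).d (integratePath x) + integratePath ((paths M).d x)
      = x - pathMk 1 (evalPath 0 x) := by
  induction x using path_induction with
  | ha x y hx hy =>
    simp only [map_add] at hx hy ⊢
    rw [pathMk_add_right, add_add_add_comm, hx, hy]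
    abel
  | hf f m =>
    rw [d_pathMk_fn, map_add, integratePath_pathMk, integratePath_pathMk, integratePath_pathMk,
      integrate_fn, integrate_form, evalPath_pathMk, eval_fn, primitive_derivative,
      pathMk_smul_right, ← pathMk_smul_left, ← pathMk_sub_left, pathMk_zero_left, pathMk_zero_left,
      map_zero, zero_add, add_zero]
    congr 1
    exact TrivSqZeroExt.ext
      (show f - Polynomial.C (f.eval 0) = f - f.eval 0 • (1 : Polynomial K) by
        rw [Polynomial.smul_eq_C_mul, mul_one])
      (show (0 : Polynomial K) = 0 - f.eval 0 • (0 : Polynomial K) by simp)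
  | hg f m =>
    rw [d_pathMk_form, map_neg, integratePath_pathMk, integratePath_pathMk,
      integrate_form, evalPath_pathMk, eval_form, d_pathMk_fn, derivative_primitive, zero_smul,
      pathMk_zero_right]
    abel

end pathFiber

end DGLA

/-! ### The homotopy fibre of the inclusion of ker π, and its periods. -/

namespace DGLA

variable {K : Type u} [Field K]

section pathFiber

open lineForms

variable {M : DGLA.{u, v} K} {L : DGLA.{u, w} K}

namespace Complement

/-- Paths starting at `0` and ending in `ker π`. -/
noncomputable def fiberSubmodule (D : Complement M L) : Submodule K (paths M).carrier :=
  LinearMap.ker (evalPath 0) ⊓ LinearMap.ker (D.π ∘ₗ evalPath 1)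

theorem mem_fiberSubmodule (D : Complement M L) {x : (paths M).carrier} :
    x ∈ D.fiberSubmodule ↔ evalPath 0 x = 0 ∧ D.π (evalPath 1 x) = 0 := Iff.rfl

theorem d_mem_fiberSubmodule (D : Complement M L) (x : (paths M).carrier)
    (hx : x ∈ D.fiberSubmodule) : (paths M).d x ∈ D.fiberSubmodule := by
  rw [mem_fiberSubmodule] at hx ⊢
  rw [evalPath_d, evalPath_d, hx.1, map_zero, D.π_d, hx.2, map_zero, neg_zero]
  exact ⟨rfl, rfl⟩

theorem bracket_mem_fiberSubmodule (D : Complement M L) (x : (paths M).carrier)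
    (hx : x ∈ D.fiberSubmodule) (y : (paths M).carrier) (hy : y ∈ D.fiberSubmodule) :
    (paths M).bracket x y ∈ D.fiberSubmodule := by
  rw [mem_fiberSubmodule] at hx hy ⊢
  rw [evalPath_bracket, evalPath_bracket, hx.1, map_zero, LinearMap.zero_apply]
  exact ⟨rfl, D.π_bracket _ _ hx.2 hy.2⟩

/-- The homotopy fiber of the inclusion `ker π → M`. -/
noncomputable def fiber (D : Complement M L) : DGLA.{u, max u v} K :=
  (paths M).restrict D.fiberSubmodule D.d_mem_fiberSubmodule D.bracket_mem_fiberSubmodule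

/-- The inclusion of the fiber in the space of paths. -/
noncomputable def incl (D : Complement M L) : D.fiber.carrier →ₗ[K] (paths M).carrier :=
  Submodule.subtype _

theorem incl_injective (D : Complement M L) : Function.Injective D.incl := Subtype.val_injective

theorem mem_fiber_gr (D : Complement M L) {p : ℤ} {x : D.fiber.carrier} :
    x ∈ D.fiber.gr p ↔ D.incl x ∈ D.fiberSubmodule ∧ D.incl x ∈ (paths M).gr p := Iff.rfl

theorem incl_mem (D : Complement M L) (x : D.fiber.carrier) : D.incl x ∈ D.fiberSubmodule :=
  restrict_coe_mem _ _ _ _ x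

theorem incl_d (D : Complement M L) (x : D.fiber.carrier) :
    D.incl (D.fiber.d x) = (paths M).d (D.incl x) := rfl

theorem incl_bracket (D : Complement M L) (x y : D.fiber.carrier) :
    D.incl (D.fiber.bracket x y) = (paths M).bracket (D.incl x) (D.incl y) := rfl

theorem exists_incl_eq (D : Complement M L) {p : ℤ} {x : (paths M).carrier}
    (hx : x ∈ D.fiberSubmodule) (hp : x ∈ (paths M).gr p) :
    ∃ y ∈ D.fiber.gr p, D.incl y = x :=
  ⟨restrictMk _ _ _ _ hx hp, ⟨hx, hp⟩, rfl⟩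

/-- The class in `L` of a path: the image under `π` of its integral. -/
noncomputable def period (D : Complement M L) : (paths M).carrier →ₗ[K] L.carrier :=
  D.π ∘ₗ evalPath 1 ∘ₗ integratePath

theorem period_apply (D : Complement M L) (x : (paths M).carrier) :
    D.period x = D.π (evalPath 1 (integratePath x)) := rfl

theorem period_mem (D : Complement M L) {p : ℤ} {x : (paths M).carrier}
    (hx : x ∈ (paths M).gr p) : D.period x ∈ L.gr p := by
  have := D.π_mem (evalPath_mem 1 (integratePath_mem hx))
  rwa [sub_add_cancel] at this

theorem evalPath_zero_integratePath (x : (paths M).carrier) :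
    evalPath 0 (integratePath x) = 0 := by
  induction x using path_induction with
  | ha x y hx hy => rw [map_add, map_add, hx, hy, add_zero]
  | hf f m => rw [integratePath_pathMk, integrate_fn, pathMk_zero_left, map_zero]
  | hg f m =>
    rw [integratePath_pathMk, integrate_form, evalPath_pathMk, eval_fn, eval_zero_primitive,
      zero_smul]

theorem d_integratePath_of_fiber [CharZero K] (D : Complement M L) {x : (paths M).carrier}
    (hx : x ∈ D.fiberSubmodule) :
    (paths M).d (integratePath x) = x - integratePath ((paths M).d x) := by
  rw [eq_sub_iff_add_eq, d_integratePath, hx.1, pathMk_zero_right, sub_zero]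

/-- Project the end points in d ∫x = x - ∫dx. The condition at 0 has removed the constant path, the
condition at 1 kills the term x, and the sign in `π_d` cancels the remaining one. -/
theorem period_d [CharZero K] (D : Complement M L) {x : (paths M).carrier} (hx : x ∈ D.fiberSubmodule) :
    D.period ((paths M).d x) = L.d (D.period x) := by
  have h := congrArg (D.π ∘ₗ evalPath 1) (D.d_integratePath_of_fiber hx)
  simp only [map_sub, LinearMap.comp_apply, evalPath_d, D.π_d] at h
  rw [((D.mem_fiberSubmodule).1 hx).2, zero_sub] at h
  exact (neg_injective h).symm

/-- The standard cocycle in the fiber with a given period. -/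
noncomputable def cocycle (D : Complement M L) (x : L.carrier) : (paths M).carrier :=
  -- The path t ⊗ s x runs from 0 to s x, which need not lie in ker π. After applying d the end
  -- point is d (s x), with projection -d x, so for closed x the result lies in the fibre.
  (paths M).d (pathMk (fn Polynomial.X) (D.s x))

theorem evalPath_pathMk_X (a : K) (m : M.carrier) :
    evalPath a (pathMk (fn Polynomial.X) m) = a • m := by
  rw [evalPath_pathMk, eval_fn, Polynomial.eval_X]

theorem cocycle_mem_gr (D : Complement M L) {p : ℤ} {x : L.carrier} (hx : x ∈ L.gr p) :
    D.cocycle x ∈ (paths M).gr p := by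
  have := (paths M).isDGLA.d_mem (pathMk_mem (fn_mem Polynomial.X) (D.s_mem hx) (zero_add _))
  rwa [sub_add_cancel] at this

theorem cocycle_mem (D : Complement M L) {x : L.carrier} (hx : L.d x = 0) :
    D.cocycle x ∈ D.fiberSubmodule := by
  rw [mem_fiberSubmodule, cocycle, evalPath_d, evalPath_d, evalPath_pathMk_X, evalPath_pathMk_X,
    zero_smul, map_zero, one_smul, D.π_d, D.π_s, hx, neg_zero]
  exact ⟨rfl, rfl⟩

theorem integrate_one_form :
    integrate (form (1 : Polynomial K)) = fn Polynomial.X := by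
  rw [integrate_form, ← Polynomial.monomial_zero_one, primitive_monomial]
  simp [Polynomial.monomial_one_one_eq_X]

theorem period_pathMk_form (D : Complement M L) (m : M.carrier) :
    D.period (pathMk (form 1) m) = D.π m := by
  rw [period_apply, integratePath_pathMk, integrate_one_form, evalPath_pathMk_X, one_smul]

/-- Only the summand dt ⊗ s x has a nonzero integral, and that integral ends at s x. -/
theorem period_cocycle (D : Complement M L) (x : L.carrier) : D.period (D.cocycle x) = x := by
  rw [cocycle, d_pathMk_fn, map_add, Polynomial.derivative_X, period_pathMk_form, period_apply,
    integratePath_pathMk, integrate_fn, pathMk_zero_left, map_zero, map_zero, add_zero, D.π_s]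

/-- The period detects exactness: together with `period_cocycle` this identifies the cohomology of
the fibre with that of L. -/
theorem exists_primitive [CharZero K] (D : Complement M L) {p : ℤ} {x : D.fiber.carrier}
    (hx : x ∈ D.fiber.gr p) (hd : D.fiber.d x = 0) {c : L.carrier}
    (hc : c ∈ L.gr (p - 1)) (h : D.period (D.incl x) = L.d c) :
    ∃ y ∈ D.fiber.gr (p - 1), D.fiber.d y = x := by
  have hd' : (paths M).d (D.incl x) = 0 := by rw [← incl_d, hd, map_zero]
  rw [mem_fiber_gr] at hx
  -- The integral is a primitive starting at 0, but its end point projects to d c. Adding d (t ⊗ s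
  -- c), which is closed, shifts this projection by π (d (s c)) = -d c.
  obtain ⟨y, hy, hyx⟩ := D.exists_incl_eq (p := p - 1)
    (x := integratePath (D.incl x) + D.cocycle c) (by
      rw [mem_fiberSubmodule, map_add, map_add, map_add, evalPath_zero_integratePath,
        ← period_apply, h, cocycle, evalPath_d, evalPath_d, evalPath_pathMk_X, evalPath_pathMk_X,
        zero_smul, map_zero, one_smul, D.π_d, D.π_s, add_zero]
      exact ⟨rfl, add_neg_cancel _⟩)
    (add_mem (integratePath_mem hx.2) (D.cocycle_mem_gr hc))
  refine ⟨y, hy, D.incl_injective ?_⟩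
  rw [incl_d, hyx, map_add, D.d_integratePath_of_fiber hx.1, hd', map_zero, sub_zero, cocycle,
    (paths M).isDGLA.d_d, add_zero]

/-- A morphism to the fiber is a quasi-isomorphism if, on cocycles, its composition with the period
is bijective in cohomology. -/
theorem isQuasiIso_of_period [CharZero K] (D : Complement M L)
    {N : DGLA.{u, max u v} K} (f : Hom N D.fiber)
    (surj : ∀ p y, y ∈ L.gr p → L.d y = 0 → ∃ x ∈ N.gr p, N.d x = 0 ∧
      D.period (D.incl (f.toLinearMap x)) = y)
    (inj : ∀ p x, x ∈ N.gr p → N.d x = 0 → ∀ c ∈ L.gr (p - 1),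
      D.period (D.incl (f.toLinearMap x)) = L.d c → ∃ z ∈ N.gr (p - 1), N.d z = x) :
    f.IsQuasiIso := by
  refine Hom.isQuasiIso_of f ?_ ?_
  · intro p y hy hdy
    obtain ⟨x, hx, hdx, h⟩ := surj p (D.period (D.incl y)) (D.period_mem hy.2)
      (by rw [← D.period_d (D.incl_mem y), ← incl_d, hdy, map_zero, map_zero])
    have hdfx : D.fiber.d (f.toLinearMap x) = 0 := by rw [← f.map_d, hdx, map_zero]
    obtain ⟨w, hw, hdw⟩ := D.exists_primitive (p := p) (x := f.toLinearMap x - y)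
      (sub_mem (f.map_mem hx) hy) (by rw [map_sub, hdfx, hdy, sub_zero])
      (zero_mem _) (by rw [map_sub, map_sub, h, sub_self, map_zero])
    exact ⟨x, hx, hdx, w, hw, hdw⟩
  · intro p x hx hdx w hw hdw
    refine inj p x hx hdx (D.period (D.incl w)) (D.period_mem hw.2) ?_
    rw [← D.period_d (D.incl_mem w), ← incl_d, hdw]

/-- Functoriality of the fiber. -/
noncomputable def fiberMap {M' : DGLA.{u, v} K} (D : Complement M L) (D' : Complement M' L)
    (g : Hom M M') (hg : ∀ x, D'.π (g.toLinearMap x) = D.π x) : Hom D.fiber D'.fiber :=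
  restrictLift _ _ _ _
    (L := D.fiber)
    { toLinearMap := (CDGA.tensorMap (𝟙 (lineForms K)) g).toLinearMap ∘ₗ D.incl
      map_mem := fun hx => (CDGA.tensorMap (𝟙 (lineForms K)) g).map_mem hx.2
      map_d := fun x => (CDGA.tensorMap (𝟙 (lineForms K)) g).map_d (D.incl x)
      map_bracket := fun x y =>
        (CDGA.tensorMap (𝟙 (lineForms K)) g).map_bracket (D.incl x) (D.incl y) }
    (fun p x hx => by
      have key : ∀ a : K, ∀ x, evalPath a ((CDGA.tensorMap (𝟙 (lineForms K)) g).toLinearMap x)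
          = g.toLinearMap (evalPath a x) := fun a x => by
        induction x using path_induction with
        | ha x y hx hy => rw [map_add, map_add, map_add, map_add, hx, hy]
        | hf f m =>
          refine (evalPath_pathMk a (fn f) (g.toLinearMap m)).trans ?_
          rw [evalPath_pathMk, map_smul]
        | hg f m =>
          refine (evalPath_pathMk a (form f) (g.toLinearMap m)).trans ?_
          rw [evalPath_pathMk, map_smul]
      have h := D.incl_mem x
      rw [mem_fiberSubmodule] at h ⊢
      refine ⟨(key 0 (D.incl x)).trans ?_, (congrArg D'.π (key 1 (D.incl x))).trans ?_⟩
      · rw [h.1, map_zero]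
      · rw [hg, h.2])

theorem period_fiberMap {M' : DGLA.{u, v} K} (D : Complement M L) (D' : Complement M' L)
    (g : Hom M M') (hg : ∀ x, D'.π (g.toLinearMap x) = D.π x) (x : D.fiber.carrier) :
    D'.period (D'.incl ((fiberMap D D' g hg).toLinearMap x)) = D.period (D.incl x) := by
  change D'.period ((CDGA.tensorMap (𝟙 (lineForms K)) g).toLinearMap (D.incl x)) = _
  generalize D.incl x = z
  induction z using path_induction with
  | ha x y hx hy => rw [map_add, map_add, map_add, hx, hy]
  | hf f m =>
    refine (period_apply D' (pathMk (fn f) (g.toLinearMap m))).trans ?_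
    rw [period_apply, integratePath_pathMk, integratePath_pathMk, integrate_fn, pathMk_zero_left,
      pathMk_zero_left, map_zero, map_zero, map_zero, map_zero]
  | hg f m =>
    refine (period_apply D' (pathMk (form f) (g.toLinearMap m))).trans ?_
    rw [period_apply, integratePath_pathMk, integratePath_pathMk, integrate_form, evalPath_pathMk,
      evalPath_pathMk, map_smul, map_smul, hg]

/-- Both fibres have the cohomology of L through the period, and the map preserves periods. No
comparison between M and M' themselves is needed. -/
theorem fiberMap_isQuasiIso [CharZero K] {M' : DGLA.{u, v} K} (D : Complement M L)
    (D' : Complement M' L) (g : Hom M M') (hg : ∀ x, D'.π (g.toLinearMap x) = D.π x) :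
    (fiberMap D D' g hg).IsQuasiIso := by
  refine isQuasiIso_of_period _ _ ?_ ?_
  · intro p y hy hdy
    obtain ⟨x, hx, hxy⟩ := D.exists_incl_eq (D.cocycle_mem hdy) (D.cocycle_mem_gr hy)
    refine ⟨x, hx, D.incl_injective ?_, ?_⟩
    · rw [incl_d, hxy, map_zero]
      exact (paths M).isDGLA.d_d _
    · rw [period_fiberMap, hxy, period_cocycle]
  · intro p x hx hdx c hc h
    rw [period_fiberMap] at h
    exact D.exists_primitive hx hdx hc h

end Complement

end pathFiber

end DGLA

/-! ### The cone of a DGLA and the fibre of its inclusion. -/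

namespace DGLA

variable {K : Type u} [Field K]

section cone

open TensorProduct

variable {L : DGLA.{u, v} K}

/-- The cone `L ⊕ L ε` of a DGLA. -/
noncomputable abbrev cone (L : DGLA.{u, v} K) : DGLA.{u, max u v} K := (coneAlg K).tensor L

/-- The projection of the cone onto `L`. -/
noncomputable def coneFst : (cone L).carrier →ₗ[K] L.carrier := contract coneAlg.aug.toLinearMap

/-- The `ε`-coefficient of an element of the cone. -/
noncomputable def coneSnd : (cone L).carrier →ₗ[K] L.carrier := contract coneAlg.coeff

/-- The inclusion of `L` in the cone. -/
noncomputable def coneInl : L.carrier →ₗ[K] (cone L).carrier := TensorProduct.mk K _ _ 1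

/-- The map `b ↦ ε b`. -/
noncomputable def coneInr : L.carrier →ₗ[K] (cone L).carrier :=
  TensorProduct.mk K _ _ coneAlg.eps

/-- The element `a + ε b` of the cone. -/
noncomputable def coneMk (a b : L.carrier) : (cone L).carrier := coneInl a + coneInr b

theorem coneMk_zero_right (a : L.carrier) : coneMk a 0 = coneInl a := by
  rw [coneMk, map_zero, add_zero]

theorem coneMk_zero_left (b : L.carrier) : coneMk 0 b = coneInr b := by
  rw [coneMk, map_zero, zero_add]

theorem coneFst_coneMk (a b : L.carrier) : coneFst (coneMk a b) = a := by
  have h1 : coneFst (coneInl a) = (1 : K) • a := contract_tmul _ _ _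
  have h2 : coneFst (coneInr b) = (0 : K) • b := contract_tmul _ _ _
  rw [coneMk, map_add, h1, h2, one_smul, zero_smul, add_zero]

theorem coneSnd_coneMk (a b : L.carrier) : coneSnd (coneMk a b) = b := by
  have h1 : coneSnd (coneInl a) = (0 : K) • a := contract_tmul _ _ _
  have h2 : coneSnd (coneInr b) = (1 : K) • b := contract_tmul _ _ _
  rw [coneMk, map_add, h1, h2, one_smul, zero_smul, zero_add]

theorem coneMk_add (a b a' b' : L.carrier) :
    coneMk a b + coneMk a' b' = coneMk (a + a') (b + b') := by
  simp only [coneMk, map_add]; abel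

@[elab_as_elim]
theorem cone_induction {P : (cone L).carrier → Prop}
    (h₁ : ∀ p a, a ∈ L.gr p → P (coneMk a 0)) (h₂ : ∀ p a, a ∈ L.gr p → P (coneMk 0 a))
    (ha : ∀ x y, P x → P y → P (x + y)) (x : (cone L).carrier) : P x := by
  induction x using CDGA.tensor_induction with
  | ha x y hx hy => exact ha x y hx hy
  | hm p q b a hb ha =>
    rcases coneAlg.exists_eq_of_mem hb with ⟨_, c, rfl⟩ | ⟨_, c, rfl⟩ | rfl
    · have := h₁ q (c • a) (Submodule.smul_mem _ c ha)
      rw [coneMk_zero_right] at this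
      rwa [TensorProduct.smul_tmul]
    · have := h₂ q (c • a) (Submodule.smul_mem _ c ha)
      rw [coneMk_zero_left] at this
      rwa [TensorProduct.smul_tmul]
    · have := h₁ q 0 (zero_mem _)
      rw [coneMk_zero_right, map_zero] at this
      rwa [TensorProduct.zero_tmul]

theorem coneMk_eta (x : (cone L).carrier) : coneMk (coneFst x) (coneSnd x) = x := by
  induction x using cone_induction with
  | h₁ p a _ => rw [coneFst_coneMk, coneSnd_coneMk]
  | h₂ p a _ => rw [coneFst_coneMk, coneSnd_coneMk]
  | ha x y hx hy => rw [map_add, map_add, ← coneMk_add, hx, hy]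

theorem d_coneMk (a b : L.carrier) :
    (cone L).d (coneMk a b) = coneMk (L.d a + b) (-L.d b) := by
  have h1 : (cone L).d (coneInl a) = coneInl (L.d a) := by
    refine (CDGA.tensorD_tmul CDGA.one_mem_gr a).trans ?_
    rw [CDGA.d_one, TensorProduct.zero_tmul, Int.negOnePow_zero, one_smul, zero_add]
    rfl
  have h2 : (cone L).d (coneInr b) = coneInl b - coneInr (L.d b) := by
    refine (CDGA.tensorD_tmul coneAlg.eps_mem b).trans ?_
    rw [coneAlg.d_eps, Int.negOnePow_neg, Int.negOnePow_one, Units.neg_smul, one_smul,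
      ← sub_eq_add_neg]
    rfl
  rw [coneMk, coneMk, map_add, h1, h2, map_add, map_neg]
  abel

theorem coneFst_d (x : (cone L).carrier) :
    coneFst ((cone L).d x) = L.d (coneFst x) + coneSnd x := by
  rw [← coneMk_eta x, d_coneMk]
  simp only [coneFst_coneMk, coneSnd_coneMk]

theorem coneSnd_d (x : (cone L).carrier) : coneSnd ((cone L).d x) = -L.d (coneSnd x) := by
  rw [← coneMk_eta x, d_coneMk]
  simp only [coneSnd_coneMk]

theorem coneFst_mem {p : ℤ} {x : (cone L).carrier} (hx : x ∈ (cone L).gr p) :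
    coneFst x ∈ L.gr p :=
  contract_mem _ (fun _ _ h h' => coneAlg.aug_eq_zero h h') hx

theorem coneSnd_mem {p : ℤ} {x : (cone L).carrier} (hx : x ∈ (cone L).gr p) :
    coneSnd x ∈ L.gr (p + 1) := by
  change x ∈ CDGA.tensorGr _ _ p at hx
  change contract coneAlg.coeff x ∈ L.gr (p + 1)
  induction hx using CDGA.tensorGr_induction with
  | ha x y _ _ hx hy => rw [map_add]; exact add_mem hx hy
  | hm p' q b a h hb ha =>
    rw [contract_tmul]
    rcases coneAlg.exists_eq_of_mem hb with ⟨_, c, rfl⟩ | ⟨rfl, c, rfl⟩ | rfl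
    · rw [map_smul, coneAlg.coeff_one, smul_zero, zero_smul]; exact zero_mem _
    · obtain rfl : q = p + 1 := by omega
      exact Submodule.smul_mem _ _ ha
    · rw [map_zero, zero_smul]; exact zero_mem _

theorem coneFst_bracket (x y : (cone L).carrier) :
    coneFst ((cone L).bracket x y) = L.bracket (coneFst x) (coneFst y) :=
  contract_bracket _ (fun _ _ h h' => coneAlg.aug_eq_zero h h') x y

/-- The sign comes from moving the odd element ε past a; the term with two factors ε disappears. -/
theorem coneSnd_bracket {p q : ℤ} {a a' b b' : L.carrier} (ha : a ∈ L.gr p) (hb : b ∈ L.gr q) :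
    coneSnd ((cone L).bracket (coneMk a b) (coneMk a' b'))
      = p.negOnePow • L.bracket a b' + L.bracket b a' := by
  have e : (cone L).bracket (coneMk a b) (coneMk a' b')
      = CDGA.tensorBracket _ L (1 ⊗ₜ[K] a + coneAlg.eps ⊗ₜ[K] b)
        (1 ⊗ₜ[K] a' + coneAlg.eps ⊗ₜ[K] b') := rfl
  have h1 : (p * -1).negOnePow = p.negOnePow := by
    rw [mul_neg, mul_one, Int.negOnePow_neg]
  rw [e, map_add, map_add, LinearMap.add_apply, LinearMap.add_apply,
    CDGA.tensorBracket_tmul 1 ha CDGA.one_mem_gr, CDGA.tensorBracket_tmul 1 ha coneAlg.eps_mem,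
    CDGA.tensorBracket_tmul _ hb CDGA.one_mem_gr, CDGA.tensorBracket_tmul _ hb coneAlg.eps_mem,
    coneAlg.eps_mul_eps, h1]
  change contract coneAlg.coeff _ = _
  simp only [mul_one, one_mul, mul_zero, Int.negOnePow_zero, one_smul, TensorProduct.zero_tmul,
    smul_zero, add_zero, map_add, Units.smul_def, map_zsmul, contract_tmul, coneAlg.coeff_one,
    coneAlg.coeff_eps, zero_smul, zero_add]
  exact add_comm _ _

/-- The cone of `L` with its sub-DGLA `L`. -/
noncomputable def coneComplement (L : DGLA.{u, v} K) : Complement (cone L) L where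
  π := coneSnd
  s := coneInr
  π_mem := coneSnd_mem
  s_mem hx := CDGA.tmul_mem_tensorGr coneAlg.eps_mem hx (by ring)
  π_s x := by
    have := coneSnd_coneMk 0 x
    rwa [coneMk_zero_left] at this
  π_d := coneSnd_d
  π_bracket x y hx hy := by
    rw [← coneMk_eta x, ← coneMk_eta y, hx, hy]
    generalize coneFst x = a
    induction a using graded_induction L.isDGLA.isInternal with
    | hm p a ha => rw [coneSnd_bracket ha (zero_mem (L.gr 0))]; simp
    | ha a a' h h' =>
      have e := coneMk_add a 0 a' 0
      rw [add_zero] at e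
      rw [← e, map_add, LinearMap.add_apply, map_add, h, h', add_zero]

open DGLA.Complement in
/-- The fiber of `L → cone L` projects to `L`, by evaluation at the end point. -/
noncomputable def coneFiberHom (L : DGLA.{u, v} K) : Hom (coneComplement L).fiber L where
  toLinearMap := coneFst ∘ₗ evalPath 1 ∘ₗ (coneComplement L).incl
  map_mem hx := coneFst_mem (evalPath_mem 1 hx.2)
  map_d x := by
    have h := ((coneComplement L).incl_mem x).2
    change coneSnd (evalPath 1 ((coneComplement L).incl x)) = 0 at h
    simp only [LinearMap.comp_apply, incl_d, evalPath_d, coneFst_d, h, add_zero]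
  map_bracket x y := by
    simp only [LinearMap.comp_apply, incl_bracket, evalPath_bracket, coneFst_bracket]

open DGLA.Complement lineForms in
-- The cocycle d (t ⊗ ε x) attached to a closed x ends at d (ε x) = x, which gives surjectivity.
-- Injectivity follows by computing the period of a cocycle whose end point is exact.
theorem coneFiberHom_isQuasiIso [CharZero K] (L : DGLA.{u, v} K) :
    (coneFiberHom L).IsQuasiIso := by
  have key : ∀ x, L.d x = 0 →
      coneFst (evalPath 1 ((coneComplement L).cocycle x)) = x := fun x hx => by
    have h : (coneComplement L).s x = coneMk 0 x := (coneMk_zero_left x).symm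
    rw [cocycle, evalPath_d, evalPath_pathMk_X, one_smul, h, coneFst_d, coneFst_coneMk,
      coneSnd_coneMk, map_zero, zero_add]
  refine Hom.isQuasiIso_of _ ?_ ?_
  · intro p y hy hdy
    obtain ⟨x, hx, hxy⟩ := (coneComplement L).exists_incl_eq
      ((coneComplement L).cocycle_mem hdy) ((coneComplement L).cocycle_mem_gr hy)
    refine ⟨x, hx, incl_injective _ ?_, 0, zero_mem _, ?_⟩
    · rw [incl_d, hxy, map_zero]
      exact (paths (cone L)).isDGLA.d_d _
    · rw [map_zero, eq_comm, sub_eq_zero]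
      exact (congrArg (fun z => coneFst (evalPath 1 z)) hxy).trans (key y hdy)
  · intro p x hx hdx w hw hdw
    have hdx' : (paths (cone L)).d ((coneComplement L).incl x) = 0 := by
      rw [← incl_d, hdx, map_zero]
    have h1 := (coneComplement L).d_integratePath_of_fiber ((coneComplement L).incl_mem x)
    rw [hdx', map_zero, sub_zero] at h1
    have h2 : coneFst (evalPath 1 ((coneComplement L).incl x)) = L.d w := hdw.symm
    have hu := evalPath_mem 1 (integratePath_mem hx.2)
    -- Put z = ∫x, so that x = d z. The first component of x(1) is d of the first component of z(1)
    -- plus the period of x; as it also equals d w, the period is d of the element c chosen here.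
    refine (coneComplement L).exists_primitive hx hdx
      (c := w - coneFst (evalPath 1 (integratePath ((coneComplement L).incl x))))
      (sub_mem hw (coneFst_mem hu)) ?_
    rw [map_sub, ← h2, eq_sub_iff_add_eq]
    conv_rhs => rw [← h1]
    rw [evalPath_d, coneFst_d, add_comm]
    rfl

end cone

/-! ### A criterion for homotopy abelianity. -/

section criterion

open DGLA.Complement lineForms

/-- The map `a + ε b ↦ d (s a) + s (d a) + s b` from the cone of `L` to `M`. -/
noncomputable def coneLinearMap {L : DGLA.{u, v} K} {M : DGLA.{u, max u v} K}
    (D : Complement M L) : (cone L).carrier →ₗ[K] M.carrier :=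
  (M.d ∘ₗ D.s + D.s ∘ₗ L.d) ∘ₗ coneFst + D.s ∘ₗ coneSnd

theorem coneLinearMap_apply {L : DGLA.{u, v} K} {M : DGLA.{u, max u v} K}
    (D : Complement M L) (x : (cone L).carrier) : coneLinearMap D x
      = M.d (D.s (coneFst x)) + D.s (L.d (coneFst x)) + D.s (coneSnd x) := rfl

/-- The morphism from the cone generated by an abelian section whose derived bracket is the bracket
of `L`. -/
noncomputable def coneHom {L : DGLA.{u, v} K} {M : DGLA.{u, max u v} K} (D : Complement M L)
    (hs : ∀ x y, M.bracket (D.s x) (D.s y) = 0)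
    (hα : ∀ p x, x ∈ L.gr p → ∀ y,
      M.bracket (M.d (D.s x) + D.s (L.d x)) (D.s y) = p.negOnePow • D.s (L.bracket x y)) :
    Hom (cone L) M where
  toLinearMap := coneLinearMap D
  map_mem {p x} hx := by
    have h1 := coneFst_mem hx
    have h2 := D.s_mem (coneSnd_mem hx)
    have h3 := M.isDGLA.d_mem (D.s_mem h1)
    have h4 := D.s_mem (L.isDGLA.d_mem h1)
    rw [add_sub_cancel_right] at h2 h4
    rw [sub_add_cancel] at h3
    exact add_mem (add_mem h3 h4) h2
  map_d x := by
    simp only [coneLinearMap_apply, coneFst_d, coneSnd_d, map_add, map_neg,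
      L.isDGLA.d_d, M.isDGLA.d_d, map_zero]
    abel
  map_bracket x y := by
    -- The mirror image of `hα`, by antisymmetry in M and in L.
    have hα' : ∀ p q x y, x ∈ L.gr p → y ∈ L.gr q →
        M.bracket (D.s y) (M.d (D.s x) + D.s (L.d x)) = D.s (L.bracket y x) := by
      intro p q x y hx hy
      have h3 := M.isDGLA.d_mem (D.s_mem hx)
      have h4 := D.s_mem (L.isDGLA.d_mem hx)
      rw [add_sub_cancel_right] at h4
      rw [sub_add_cancel] at h3
      rw [M.isDGLA.antisymm (D.s_mem hy) (add_mem h3 h4), hα p x hx, L.isDGLA.antisymm hy hx,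
        map_neg, smul_smul, ← Int.negOnePow_add, Units.smul_def, Units.smul_def, map_zsmul,
        negOnePow_congr (a := (q - 1) * p + p) (b := q * p) ⟨0, by ring⟩]
    -- Write α x = d (s x) + s (d x), so that d (α x) = α (d x). Applying d to `hα` computes [α x, d
    -- (s y)] by Leibniz; adding [α x, s (d y)] gives α of the bracket.
    have hαα : ∀ p x y, x ∈ L.gr p → M.bracket (M.d (D.s x) + D.s (L.d x))
        (M.d (D.s y) + D.s (L.d y)) = M.d (D.s (L.bracket x y)) + D.s (L.d (L.bracket x y)) := by
      intro p x y hx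
      have h3 := M.isDGLA.d_mem (D.s_mem hx)
      have h4 := D.s_mem (L.isDGLA.d_mem hx)
      rw [add_sub_cancel_right] at h4
      rw [sub_add_cancel] at h3
      have h := M.isDGLA.leibniz (add_mem h3 h4) (D.s y)
      have h5 := hα (p + 1) (L.d x) (L.isDGLA.d_mem hx) y
      rw [L.isDGLA.d_d, map_zero, add_zero, Int.negOnePow_succ] at h5
      rw [hα p x hx, map_add M.d, M.isDGLA.d_d, zero_add, h5] at h
      rw [map_add (M.bracket (M.d (D.s x) + D.s (L.d x))), hα p x hx, L.isDGLA.leibniz hx,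
        map_add D.s]
      generalize M.d (D.s x) + D.s (L.d x) = z at h ⊢
      rcases Int.units_eq_one_or p.negOnePow with hp | hp
      · simp only [hp, Units.neg_smul, one_smul] at h ⊢
        rw [h]
        abel
      · simp only [hp, Units.neg_smul, one_smul, map_neg, neg_neg] at h ⊢
        rw [neg_eq_iff_eq_neg.1 h]
        abel
    induction x using cone_induction with
    | ha x x' hx hx' => rw [LinearMap.map_add₂, map_add, hx, hx', map_add, LinearMap.map_add₂]
    | h₁ p a ha =>
      induction y using cone_induction with
      | ha y y' hy hy' => rw [map_add, map_add, hy, hy', map_add, map_add]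
      | h₁ q b hb =>
        simp only [coneLinearMap_apply, coneFst_bracket, coneFst_coneMk,
          coneSnd_coneMk, coneSnd_bracket ha (zero_mem (L.gr 0)), map_zero, smul_zero, add_zero,
          LinearMap.zero_apply, hαα p a b ha]
      | h₂ q b hb =>
        simp only [coneLinearMap_apply, coneFst_bracket, coneFst_coneMk,
          coneSnd_coneMk, coneSnd_bracket ha (zero_mem (L.gr 0)), map_zero, add_zero, zero_add]
        rw [hα p a ha, Units.smul_def, map_zsmul, Units.smul_def]
    | h₂ p a ha =>
      induction y using cone_induction with
      | ha y y' hy hy' => rw [map_add, map_add, hy, hy', map_add, map_add]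
      | h₁ q b hb =>
        simp only [coneLinearMap_apply, coneFst_bracket, coneFst_coneMk,
          coneSnd_coneMk, coneSnd_bracket (zero_mem (L.gr 0)) ha, map_zero, smul_zero, add_zero,
          LinearMap.zero_apply, zero_add]
        exact (hα' q p b a hb ha).symm
      | h₂ q b hb =>
        simp only [coneLinearMap_apply, coneFst_bracket, coneFst_coneMk,
          coneSnd_coneMk, coneSnd_bracket (zero_mem (L.gr 0)) ha, map_zero, smul_zero, add_zero,
          LinearMap.zero_apply, zero_add, hs]

/-- The map `m ↦ dt ⊗ m`. -/
noncomputable def formMk {M : DGLA.{u, v} K} : M.carrier →ₗ[K] (paths M).carrier :=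
  TensorProduct.mk K _ _ (form 1)

theorem formMk_apply {M : DGLA.{u, v} K} (m : M.carrier) : formMk m = pathMk (form 1) m := rfl

/-- Since dt² = 0, the one-forms dt ⊗ m span an abelian subalgebra of the paths. This is where the
vanishing bracket comes from. -/
theorem bracket_formMk {M : DGLA.{u, v} K} (m m' : M.carrier) :
    (paths M).bracket (formMk m) (formMk m') = 0 := by
  induction m using graded_induction M.isDGLA.isInternal with
  | hm p m hm =>
    refine (CDGA.tensorBracket_tmul _ hm (form_mem 1) m').trans ?_
    rw [form_mul_form, TensorProduct.zero_tmul, smul_zero]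
    rfl
  | ha x x' hx hx' => rw [map_add, LinearMap.map_add₂, hx, hx', add_zero]

/-- A splitting of complexes `τ` of `π` embeds an abelian DGLA in the fiber. -/
noncomputable def splitHom {L : DGLA.{u, v} K} {M : DGLA.{u, max u v} K} (D : Complement M L)
    (τ : L.carrier →ₗ[K] M.carrier) (hτ : ∀ p x, x ∈ L.gr p → τ x ∈ M.gr (p - 1))
    (hτd : ∀ x, M.d (τ x) = -τ (L.d x)) : Hom L.abelianization D.fiber :=
  restrictLift _ _ _ _
    (L := L.abelianization)
    { toLinearMap := formMk ∘ₗ τ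
      map_mem := fun hx => pathMk_mem (form_mem 1) (hτ _ _ hx) (by ring)
      map_d := fun (x : L.carrier) => by
        change formMk (τ (L.d x)) = (paths M).d (formMk (τ x))
        rw [formMk_apply (τ x), d_pathMk_form, hτd, pathMk_neg_right, neg_neg, formMk_apply]
      map_bracket := fun x y => (map_zero _).trans (bracket_formMk _ _).symm }
    (fun p x _ => by
      rw [mem_fiberSubmodule]
      have e : ∀ a : K, evalPath a (formMk (τ x)) = 0 := fun a => by
        rw [formMk_apply, evalPath_pathMk, eval_form, zero_smul]
      exact ⟨e 0, (congrArg D.π (e 1)).trans (map_zero _)⟩)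

/-- The period of dt ⊗ τ x is π (τ x) = x, so `isQuasiIso_of_period` applies with the identity of L
as composition. -/
theorem splitHom_isQuasiIso [CharZero K] {L : DGLA.{u, max u v} K} {M : DGLA.{u, max u v} K}
    (D : Complement M L)
    (τ : L.carrier →ₗ[K] M.carrier) (hτ : ∀ p x, x ∈ L.gr p → τ x ∈ M.gr (p - 1))
    (hτd : ∀ x, M.d (τ x) = -τ (L.d x)) (hπ : ∀ x, D.π (τ x) = x) :
    (splitHom D τ hτ hτd).IsQuasiIso := by
  have key : ∀ x, D.period (D.incl ((splitHom D τ hτ hτd).toLinearMap x)) = x := fun x =>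
    (D.period_pathMk_form (τ x)).trans (hπ x)
  refine isQuasiIso_of_period _ _ ?_ ?_
  · intro p y hy hdy
    exact ⟨y, hy, hdy, key y⟩
  · intro p x hx hdx c hc h
    rw [key] at h
    exact ⟨c, hc, h.symm⟩

/-- A DGLA `L` is homotopy abelian if `L[1]` is a quotient complex `M / ker π` of a DGLA by a
sub-DGLA, in such a way that the bracket of `L` is the derived bracket of an abelian section `s`,
and the projection `π` splits as a morphism of complexes. -/
theorem isHomotopyAbelian_of_complement [CharZero K] {L : DGLA.{u, max u v} K}
    {M : DGLA.{u, max u v} K} (D : Complement M L)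
    (hs : ∀ x y, M.bracket (D.s x) (D.s y) = 0)
    (hα : ∀ p x, x ∈ L.gr p → ∀ y,
      M.bracket (M.d (D.s x) + D.s (L.d x)) (D.s y) = p.negOnePow • D.s (L.bracket x y))
    (τ : L.carrier →ₗ[K] M.carrier) (hτ : ∀ p x, x ∈ L.gr p → τ x ∈ M.gr (p - 1))
    (hτd : ∀ x, M.d (τ x) = -τ (L.d x)) (hπ : ∀ x, D.π (τ x) = x) : L.IsHomotopyAbelian := by
  refine ⟨L.abelianization, fun _ _ => rfl, ?_⟩
  -- The zigzag is L ← fibre of the cone → fibre of D ← L with zero bracket.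
  have h1 : QuasiIsomorphic (coneComplement L).fiber L :=
    .rel _ _ ⟨coneFiberHom L, coneFiberHom_isQuasiIso L⟩
  -- The morphism from the cone respects the projections because π (d (s a) + s (d a) + s b) = -d a
  -- + d a + b = b.
  have h2 : QuasiIsomorphic (coneComplement L).fiber D.fiber :=
    .rel _ _ ⟨fiberMap _ D (coneHom.{u, max u v} D hs hα) (fun x => by
      have : (coneComplement L).π x = coneSnd x := rfl
      simp only [coneHom, coneLinearMap_apply, map_add, D.π_d, D.π_s, this,
        neg_add_cancel, zero_add]), fiberMap_isQuasiIso _ _ _ _⟩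
  have h3 : QuasiIsomorphic L.abelianization D.fiber :=
    .rel _ _ ⟨splitHom.{u, max u v} D τ hτ hτd, splitHom_isQuasiIso.{u, v} D τ hτ hτd hπ⟩
  exact .trans _ _ _ (.symm _ _ h1) (.trans _ _ _ h2 (.symm _ _ h3))

end criterion

end DGLA

/-! ### DGLAs obtained as quotients of graded Lie algebras by graded ideals. -/

/-- A graded Lie algebra `⨁ R p`, up to a graded ideal `⨁ J p`, with an element `Q` of degree one
whose square is zero modulo the ideal; everything lies in an ambient vector space `W` with a
bilinear operation `β`. -/
structure GradedLieSubquotient (K : Type u) [Field K] (W : Type v) [AddCommGroup W]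
    [Module K W] where
  R : ℤ → Submodule K W
  J : ℤ → Submodule K W
  J_le : ∀ p, J p ≤ R p
  indep : iSupIndep R
  β : W →ₗ[K] W →ₗ[K] W
  Q : W
  Q_mem : Q ∈ R 1
  β_mem : ∀ {p q f g}, f ∈ R p → g ∈ R q → β f g ∈ R (p + q)
  β_mem_J : ∀ {p q f g}, f ∈ J p → g ∈ R q → β f g ∈ J (p + q)
  antisymm : ∀ {p q f g}, f ∈ R p → g ∈ R q → β f g = -((p * q).negOnePow • β g f)
  jacobi : ∀ {p q r f g h}, f ∈ R p → g ∈ R q → h ∈ R r →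
    β f (β g h) = β (β f g) h + (p * q).negOnePow • β g (β f h)
  β_Q_Q : β Q Q ∈ J 2

namespace GradedLieSubquotient

variable {K : Type u} [Field K] {W : Type v} [AddCommGroup W] [Module K W]
  (D : GradedLieSubquotient K W)

/-- The graded Lie algebra before passing to the quotient. -/
def total : Submodule K W := ⨆ p, D.R p

/-- The ideal, as a subspace of `total`. -/
def ideal : Submodule K D.total := (⨆ p, D.J p).comap D.total.subtype

variable {D}

theorem mem_total {p : ℤ} {f : W} (hf : f ∈ D.R p) : f ∈ D.total :=
  Submodule.mem_iSup_of_mem p hf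

theorem mem_ideal {p : ℤ} {f : D.total} (hf : f.1 ∈ D.J p) : f ∈ D.ideal :=
  Submodule.mem_iSup_of_mem (p := D.J) p hf

theorem β_mem_J_right {p q : ℤ} {f g : W} (hf : f ∈ D.R p) (hg : g ∈ D.J q) :
    D.β f g ∈ D.J (p + q) := by
  rw [D.antisymm hf (D.J_le q hg), add_comm]
  exact neg_mem (CDGA.units_smul_mem _ _ (D.β_mem_J hg hf))

theorem β_mem_total {f g : W} (hf : f ∈ D.total) (hg : g ∈ D.total) : D.β f g ∈ D.total := by
  induction hf using Submodule.iSup_induction' with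
  | zero => rw [map_zero]; exact zero_mem _
  | add x y _ _ hx hy => rw [map_add]; exact add_mem hx hy
  | mem p x hx =>
    induction hg using Submodule.iSup_induction' with
    | mem q y hy => exact mem_total (D.β_mem hx hy)
    | zero => rw [map_zero]; exact zero_mem _
    | add x y _ _ hx hy => rw [map_add]; exact add_mem hx hy

theorem β_mem_iSup_J {f g : W} (hf : f ∈ ⨆ p, D.J p) (hg : g ∈ D.total) :
    D.β f g ∈ ⨆ p, D.J p := by
  induction hf using Submodule.iSup_induction' with
  | zero => rw [map_zero]; exact zero_mem _
  | add x y _ _ hx hy => rw [map_add]; exact add_mem hx hy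
  | mem p x hx =>
    induction hg using Submodule.iSup_induction' with
    | mem q y hy => exact Submodule.mem_iSup_of_mem _ (D.β_mem_J hx hy)
    | zero => rw [map_zero]; exact zero_mem _
    | add x y _ _ hx hy => rw [map_add]; exact add_mem hx hy

theorem β_mem_iSup_J_right {f g : W} (hf : f ∈ D.total) (hg : g ∈ ⨆ p, D.J p) :
    D.β f g ∈ ⨆ p, D.J p := by
  induction hf using Submodule.iSup_induction' with
  | zero => rw [map_zero]; exact zero_mem _
  | add x y _ _ hx hy => rw [map_add]; exact add_mem hx hy
  | mem p x hx =>
    induction hg using Submodule.iSup_induction' with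
    | mem q y hy => exact Submodule.mem_iSup_of_mem _ (β_mem_J_right hx hy)
    | zero => rw [map_zero]; exact zero_mem _
    | add x y _ _ hx hy => rw [map_add]; exact add_mem hx hy

variable (D)

/-- The bracket on `total`, with values in the quotient. -/
noncomputable def totalBracket : D.total →ₗ[K] D.total →ₗ[K] D.total ⧸ D.ideal :=
  (LinearMap.mk₂ K (fun x y => (⟨D.β x.1 y.1, β_mem_total x.2 y.2⟩ : D.total))
    (fun _ _ _ => by ext1; simp) (fun _ _ _ => by ext1; simp)
    (fun _ _ _ => by ext1; simp) (fun _ _ _ => by ext1; simp)).compr₂ D.ideal.mkQ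

/-- The bracket on the quotient. -/
noncomputable def bracket :
    (D.total ⧸ D.ideal) →ₗ[K] (D.total ⧸ D.ideal) →ₗ[K] D.total ⧸ D.ideal :=
  D.ideal.liftQ (D.ideal.liftQ D.totalBracket.flip (fun y hy => by
    ext x
    exact (Submodule.Quotient.mk_eq_zero _).2 (β_mem_iSup_J_right (D := D) x.2 hy))).flip
    (fun x hx => by
      ext y
      exact (Submodule.Quotient.mk_eq_zero _).2 (β_mem_iSup_J (D := D) hx y.2))

variable {D}

/-- The class of an element of the graded Lie algebra. -/
def cls {f : W} (hf : f ∈ D.total) : D.total ⧸ D.ideal := D.ideal.mkQ ⟨f, hf⟩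

theorem bracket_cls {f g : W} (hf : f ∈ D.total) (hg : g ∈ D.total) :
    D.bracket (cls hf) (cls hg) = cls (β_mem_total hf hg) := rfl

theorem cls_congr {f g : W} (h : f = g) (hf : f ∈ D.total) (hg : g ∈ D.total) :
    cls hf = cls hg := by subst h; rfl

theorem cls_eq_zero {f : W} (hf : f ∈ D.total) (h : f ∈ ⨆ p, D.J p) : cls hf = 0 :=
  (Submodule.Quotient.mk_eq_zero _).2 h

variable (D)

/-- The homogeneous parts of the quotient. -/
def gr (p : ℤ) : Submodule K (D.total ⧸ D.ideal) :=
  ((D.R p).comap D.total.subtype).map D.ideal.mkQ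

variable {D}

theorem cls_mem_gr {p : ℤ} {f : W} (hf : f ∈ D.R p) : cls (mem_total hf) ∈ D.gr p :=
  ⟨_, hf, rfl⟩

theorem exists_cls {p : ℤ} {x : D.total ⧸ D.ideal} (hx : x ∈ D.gr p) :
    ∃ (f : W) (hf : f ∈ D.R p), x = cls (mem_total hf) := by
  obtain ⟨f, hf, rfl⟩ := hx
  exact ⟨f.1, hf, rfl⟩

/-- The ideal is spanned by homogeneous elements, so the splitting of `total` into components
descends to the quotient. -/
theorem gr_isInternal : DirectSum.IsInternal D.gr := by
  have hS : DirectSum.IsInternal fun p => (D.R p).comap D.total.subtype :=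
    isInternal_comap_iSup D.indep
  refine isInternal_of_split ?_
    (D.ideal.liftQ (Finsupp.mapRange.linearMap D.ideal.mkQ ∘ₗ gradedSplit hS) ?_) ?_
  · have h := hS.submodule_iSup_eq_top
    have h' := congrArg (Submodule.map D.ideal.mkQ) h
    rw [Submodule.map_iSup, Submodule.map_top, Submodule.range_mkQ] at h'
    exact h'
  · rintro ⟨f, hf⟩ (hJ : f ∈ ⨆ p, D.J p)
    rw [LinearMap.mem_ker]
    induction hJ using Submodule.iSup_induction' with
    | mem p f h =>
      rw [LinearMap.comp_apply, gradedSplit_apply hS (p := p) (x := ⟨f, hf⟩) (D.J_le p h)]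
      have : (⟨f, hf⟩ : D.total) ∈ D.ideal := mem_ideal h
      rw [Finsupp.mapRange.linearMap_apply, Finsupp.mapRange_single, Submodule.mkQ_apply,
        (Submodule.Quotient.mk_eq_zero _).2 this, Finsupp.single_zero]
    | zero => exact map_zero _
    | add x y hx hy ihx ihy =>
      have hle : ⨆ p, D.J p ≤ D.total := iSup_mono D.J_le
      have := congrArg₂ (· + ·) (ihx (hle hx)) (ihy (hle hy))
      rw [add_zero] at this
      simp only [← map_add] at this
      exact this
  · rintro p _ ⟨f, hf, rfl⟩
    rw [Submodule.mkQ_apply, Submodule.liftQ_apply, LinearMap.comp_apply,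
      gradedSplit_apply hS hf, Finsupp.mapRange.linearMap_apply, Finsupp.mapRange_single]
    rfl

/-- Q is odd, so Jacobi gives [[Q, Q], f] = 2 [Q, [Q, f]], and [Q, Q] is in the ideal. -/
theorem β_Q_β_Q [CharZero K] {p : ℤ} {f : W} (hf : f ∈ D.R p) :
    D.β D.Q (D.β D.Q f) ∈ D.J (p + 2) := by
  have h := D.jacobi D.Q_mem D.Q_mem hf
  rw [one_mul, Int.negOnePow_one, Units.neg_smul, one_smul, eq_add_neg_iff_add_eq,
    ← two_smul K] at h
  have h' := Submodule.smul_mem _ (2 : K)⁻¹ (D.β_mem_J D.β_Q_Q hf)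
  rwa [← h, inv_smul_smul₀ two_ne_zero, add_comm] at h'

theorem cls_add {f g : W} (hf : f ∈ D.total) (hg : g ∈ D.total) :
    cls hf + cls hg = cls (add_mem hf hg) := rfl

theorem neg_cls {f : W} (hf : f ∈ D.total) : -cls hf = cls (neg_mem hf) := rfl

theorem units_smul_cls (c : ℤˣ) {f : W} (hf : f ∈ D.total) :
    c • cls hf = cls (CDGA.units_smul_mem _ c hf) := by
  rcases Int.units_eq_one_or c with rfl | rfl
  · rw [one_smul]; exact cls_congr (one_smul _ _).symm _ _
  · rw [Units.neg_smul, one_smul, neg_cls]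
    exact cls_congr (by rw [Units.neg_smul, one_smul]) _ _

theorem bracket_antisymm {p q : ℤ} {x y : D.total ⧸ D.ideal} (hx : x ∈ D.gr p) (hy : y ∈ D.gr q) :
    D.bracket x y = -((p * q).negOnePow • D.bracket y x) := by
  obtain ⟨f, hf, rfl⟩ := exists_cls hx
  obtain ⟨g, hg, rfl⟩ := exists_cls hy
  rw [bracket_cls, bracket_cls, units_smul_cls, neg_cls]
  exact cls_congr (D.antisymm hf hg) _ _

theorem bracket_jacobi_of_mem {p q r : ℤ} {x y z : D.total ⧸ D.ideal} (hx : x ∈ D.gr p)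
    (hy : y ∈ D.gr q) (hz : z ∈ D.gr r) :
    D.bracket x (D.bracket y z)
      = D.bracket (D.bracket x y) z + (p * q).negOnePow • D.bracket y (D.bracket x z) := by
  obtain ⟨f, hf, rfl⟩ := exists_cls hx
  obtain ⟨g, hg, rfl⟩ := exists_cls hy
  obtain ⟨h, hh, rfl⟩ := exists_cls hz
  rw [bracket_cls (mem_total hg), bracket_cls (mem_total hf), bracket_cls (mem_total hf),
    bracket_cls, bracket_cls (mem_total hf), bracket_cls (mem_total hg), units_smul_cls, cls_add]
  exact cls_congr (D.jacobi hf hg hh) _ _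

theorem bracket_jacobi {p q : ℤ} {x y : D.total ⧸ D.ideal} (hx : x ∈ D.gr p)
    (hy : y ∈ D.gr q) (z : D.total ⧸ D.ideal) :
    D.bracket x (D.bracket y z)
      = D.bracket (D.bracket x y) z + (p * q).negOnePow • D.bracket y (D.bracket x z) := by
  induction z using graded_induction D.gr_isInternal with
  | ha z z' h h' =>
    rw [map_add, map_add, map_add, map_add, map_add, smul_add, h, h']
    abel
  | hm r z hz => exact bracket_jacobi_of_mem hx hy hz

theorem bracket_mem {p q : ℤ} {x y : D.total ⧸ D.ideal} (hx : x ∈ D.gr p) (hy : y ∈ D.gr q) :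
    D.bracket x y ∈ D.gr (p + q) := by
  obtain ⟨f, hf, rfl⟩ := exists_cls hx
  obtain ⟨g, hg, rfl⟩ := exists_cls hy
  exact cls_mem_gr (D.β_mem hf hg)

variable (D) in
/-- The class of the distinguished element. -/
def clsQ : D.total ⧸ D.ideal := cls (mem_total D.Q_mem)

theorem clsQ_mem : D.clsQ ∈ D.gr 1 := cls_mem_gr D.Q_mem

theorem bracket_clsQ_clsQ [CharZero K] (x : D.total ⧸ D.ideal) :
    D.bracket D.clsQ (D.bracket D.clsQ x) = 0 := by
  induction x using graded_induction D.gr_isInternal with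
  | ha x y hx hy => rw [map_add, map_add, hx, hy, add_zero]
  | hm p x hx =>
    obtain ⟨f, hf, rfl⟩ := exists_cls hx
    exact cls_eq_zero _ (Submodule.mem_iSup_of_mem _ (β_Q_β_Q hf))

theorem isDGLA [CharZero K] : DGLAData.IsDGLA (K := K)
    { carrier := D.total ⧸ D.ideal, gr := D.gr, d := D.bracket D.clsQ, bracket := D.bracket } where
  isInternal := D.gr_isInternal
  d_mem {p x} hx := (add_comm 1 p ▸ bracket_mem clsQ_mem hx : D.bracket D.clsQ x ∈ D.gr (p + 1))
  d_d := bracket_clsQ_clsQ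
  bracket_mem := bracket_mem
  antisymm := bracket_antisymm
  leibniz {p x} hx y := (bracket_jacobi clsQ_mem hx y).trans (by rw [one_mul])
  jacobi := bracket_jacobi

variable (D) in
/-- The differential graded Lie algebra determined by the data, with differential `[Q, ·]`. -/
noncomputable def toDGLA [CharZero K] : DGLA.{u, v} K where
  carrier := D.total ⧸ D.ideal
  gr := D.gr
  d := D.bracket D.clsQ
  bracket := D.bracket
  isDGLA := D.isDGLA

end GradedLieSubquotient

/-! ### Graded commutators as bilinear operations, and division by X. -/

section superCommutator

variable {K : Type u} [Field K] {S : Type v} [Ring S] [Algebra K S]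

/-- The graded commutator of two elements of degrees `p` and `q` of an associative algebra. -/
def superCommutator (p q : ℤ) (f g : S) : S := f * g - (p * q).negOnePow • (g * f)

/-- The computation of `gradedCommutator_jacobi` for a general associative algebra, needed for power
series with operator coefficients. -/
theorem superCommutator_jacobi (p q r : ℤ) (f g h : S) :
    superCommutator p (q + r) f (superCommutator q r g h)
      = superCommutator (p + q) r (superCommutator p q f g) h
        + (p * q).negOnePow • superCommutator q (p + r) g (superCommutator p r f h) := by
  simp only [superCommutator, smul_sub, smul_smul, mul_sub, sub_mul, smul_mul_assoc,
    mul_smul_comm, mul_assoc, mul_add, add_mul, Int.negOnePow_add]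
  have hu : ∀ x, (p * q).negOnePow * ((p * q).negOnePow * x) = x := fun x => by
    rw [← mul_assoc, negOnePow_mul_self, one_mul]
  simp only [mul_comm q p, hu]
  rw [mul_comm (q * r).negOnePow (p * r).negOnePow, mul_comm (q * r).negOnePow (p * q).negOnePow,
    mul_left_comm (p * r).negOnePow]
  abel

/-- The bilinear extension of the graded commutator, for a linear map `Θ` acting on elements of
degree `p` as `(-1)^p`. -/
noncomputable def superBracket (Θ : S →ₗ[K] S) : S →ₗ[K] S →ₗ[K] S :=
  let m := LinearMap.mul K S
  m - (2 : K)⁻¹ • (m + m.compl₂ Θ + m ∘ₗ Θ - m.compl₁₂ Θ Θ).flip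

/-- The sign (-1)^(pq) equals (1 + (-1)^p + (-1)^q - (-1)^(p+q)) / 2, and each summand is realised
by Θ. This extends the commutator bilinearly to elements without a degree. -/
theorem superBracket_apply [CharZero K] {Θ : S →ₗ[K] S} {p q : ℤ} {f g : S}
    (hf : Θ f = p.negOnePow • f) (hg : Θ g = q.negOnePow • g) :
    superBracket Θ f g = superCommutator p q f g := by
  have key : ∀ x : S, (2 : K)⁻¹ • (x + x) = x := fun x => by
    rw [← two_smul K, inv_smul_smul₀ two_ne_zero]
  have h : superBracket Θ f g
      = f * g - (2 : K)⁻¹ • (g * f + g * Θ f + Θ g * f - Θ g * Θ f) := rfl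
  rw [h, hf, hg, superCommutator]
  rcases Int.even_or_odd p with hp | hp
  · rw [Int.negOnePow_even p hp, negOnePow_mul_of_even_left q hp, one_smul, one_smul,
      add_sub_cancel_right, key]
  · rw [Int.negOnePow_odd p hp, negOnePow_mul_of_odd_left q hp]
    rcases Int.units_eq_one_or q.negOnePow with h | h <;> rw [h]
    · simp only [one_smul, Units.neg_smul, mul_neg, sub_neg_eq_add, add_neg_cancel, zero_add, key]
    · simp only [one_smul, Units.neg_smul, mul_neg, sub_neg_eq_add, add_neg_cancel, zero_add,
        neg_mul, neg_neg]
      rw [show -(g * f) - g * f = -(g * f + g * f) by abel, smul_neg, key]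
      abel

end superCommutator

namespace PowerSeries

variable {S : Type v} [Ring S]

/-- Identities for commutators divided by X are checked after multiplying by X, which this makes
harmless. -/
theorem X_mul_injective' : Function.Injective fun f : PowerSeries S => X * f := fun f g h => by
  ext n
  have := congrArg (coeff (n + 1)) h
  simpa only [coeff_succ_X_mul] using this

theorem superCommutator_X_mul_right (p q : ℤ) (f g : PowerSeries S) :
    superCommutator p q f (X * g) = X * superCommutator p q f g := by
  rw [superCommutator, superCommutator, mul_sub, mul_smul_comm, ← mul_assoc, (commute_X f).eq,
    mul_assoc, mul_assoc]

theorem superCommutator_X_mul_left (p q : ℤ) (f g : PowerSeries S) :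
    superCommutator p q (X * f) g = X * superCommutator p q f g := by
  rw [superCommutator, superCommutator, mul_sub, mul_smul_comm, ← mul_assoc g, (commute_X g).eq,
    mul_assoc, mul_assoc]

end PowerSeries

/-! ### The Lie algebra of series of operators filtered by order. -/

namespace CDGA

variable {K : Type u} [Field K] (A : CDGA.{u, v} K)

/-- Conjugation of operators with the parity involution. -/
noncomputable def conjParity : Module.End K A.carrier →ₗ[K] Module.End K A.carrier :=
  LinearMap.mulLeft K A.parity ∘ₗ LinearMap.mulRight K A.parity

variable {A}

theorem parity_units_smul (c : ℤˣ) (a : A.carrier) : A.parity (c • a) = c • A.parity a := by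
  rw [Units.smul_def, map_zsmul, ← Units.smul_def]

theorem map_units_smul {M N : Type*} [AddCommGroup M] [Module K M] [AddCommGroup N] [Module K N]
    (f : M →ₗ[K] N) (c : ℤˣ) (x : M) : f (c • x) = c • f x := by
  rw [Units.smul_def, map_zsmul, ← Units.smul_def]

theorem HasDegree.conjParity {m : ℤ} {f : Module.End K A.carrier} (hf : A.HasDegree m f) :
    A.conjParity f = m.negOnePow • f := by
  ext a
  induction a using graded_induction A.isInternal with
  | ha a b iha ihb => rw [map_add, map_add, iha, ihb]
  | hm p a ha =>
    change A.parity (f (A.parity a)) = m.negOnePow • f a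
    rw [A.parity_apply ha, map_units_smul, parity_units_smul, A.parity_apply (hf _ _ ha), smul_smul,
      Int.negOnePow_add, mul_left_comm, negOnePow_mul_self, mul_one]

variable (A) in
/-- Power series with operators as coefficients. -/
@[ext]
structure OpSeries where
  /-- The coefficients. -/
  coeff : ℕ → Module.End K A.carrier

namespace OpSeries

noncomputable instance : CoeFun A.OpSeries fun _ => ℕ → Module.End K A.carrier := ⟨coeff⟩

variable (A) in
/-- Series are the same as sequences of operators. -/
def equivCoeff : A.OpSeries ≃ (ℕ → Module.End K A.carrier) where
  toFun := coeff
  invFun := mk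

noncomputable instance : AddCommGroup A.OpSeries := (equivCoeff A).addCommGroup

noncomputable instance : Module K A.OpSeries := (equivCoeff A).module K

theorem ext' {f g : A.OpSeries} (h : ∀ n, f n = g n) : f = g := OpSeries.ext (funext h)

variable (f g : A.OpSeries) (n : ℕ)

theorem zero_apply : (0 : A.OpSeries) n = 0 := rfl
theorem add_apply : (f + g) n = f n + g n := rfl
theorem neg_apply : (-f) n = -f n := rfl
theorem smul_apply (c : K) : (c • f) n = c • f n := rfl
theorem units_smul_apply (c : ℤˣ) : (c • f) n = c • f n := rfl

/-- The coefficients of a series, as linear maps. -/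
def lcoeff : A.OpSeries →ₗ[K] Module.End K A.carrier where
  toFun f := f n
  map_add' _ _ := rfl
  map_smul' _ _ := rfl

/-- A linear map to series, from its coefficients. -/
def ofCoeff {V : Type*} [AddCommGroup V] [Module K V] (φ : ℕ → V →ₗ[K] Module.End K A.carrier) :
    V →ₗ[K] A.OpSeries where
  toFun x := ⟨fun n => φ n x⟩
  map_add' _ _ := ext' fun _ => map_add _ _ _
  map_smul' _ _ := ext' fun _ => map_smul _ _ _

end OpSeries

variable (A) (k : ℤ)

/-- Series `∑ Xⁿ fₙ` of operators, with `fₙ` of order `≤ n` and degree `p - 2k(n-1)`. -/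
def seriesOps (p : ℤ) : Submodule K A.OpSeries where
  carrier := {f | ∀ n : ℕ, A.IsDiffOp n (p - 2 * k * (n - 1)) (f n)}
  zero_mem' _ := IsDiffOp.zero _ _
  add_mem' hf hg n := (hf n).add (hg n)
  smul_mem' c _ hf n := (hf n).smul c

/-- Series `∑ Xⁿ fₙ` of operators, with `fₙ` of order `≤ n - 1` and degree `p - 2k(n-1)`. -/
def seriesOpsLow (p : ℤ) : Submodule K A.OpSeries where
  carrier := {f | f 0 = 0 ∧ ∀ n : ℕ, A.IsDiffOp n (p - 2 * k * n) (f (n + 1))}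
  zero_mem' := ⟨rfl, fun _ => IsDiffOp.zero _ _⟩
  add_mem' {f g} hf hg := ⟨by rw [OpSeries.add_apply, hf.1, hg.1, add_zero],
    fun n => (hf.2 n).add (hg.2 n)⟩
  smul_mem' c f hf := ⟨by rw [OpSeries.smul_apply, hf.1, smul_zero], fun n => (hf.2 n).smul c⟩

variable {A k}

theorem seriesOpsLow_le (p : ℤ) : A.seriesOpsLow k p ≤ A.seriesOps k p := by
  rintro f ⟨h0, h⟩ n
  cases n with
  | zero => rw [h0]; exact IsDiffOp.zero _ _
  | succ n => exact (h n).succ.congr_degree (by push_cast; ring)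

/-- The maps `φ i q` are probes: they kill the pieces of degree other than q and jointly detect
degree q. No decomposition of the ambient space is required, which matters since it consists of
infinite families. -/
theorem iSupIndep_of_separating {W N ι : Type*} [AddCommGroup W] [Module K W] [AddCommGroup N]
    [Module K N] {R : ℤ → Submodule K W} (φ : ι → ℤ → W →ₗ[K] N)
    (h₀ : ∀ i p q x, x ∈ R p → p ≠ q → φ i q x = 0)
    (h₁ : ∀ q x, x ∈ R q → (∀ i, φ i q x = 0) → x = 0) : iSupIndep R := by
  intro q
  rw [Submodule.disjoint_def]
  refine fun x hx hx' => h₁ q x hx fun i => ?_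
  have : ⨆ p, ⨆ (_ : p ≠ q), R p ≤ LinearMap.ker (φ i q) :=
    iSup₂_le fun p hp x hx => h₀ i p q x hx hp
  exact this hx'

/-- The probe for n and a homogeneous a of degree r is the component of f n a in degree q - 2k(n-1)
+ r; on series of degree p it can be nonzero only for p = q. -/
theorem iSupIndep_seriesOps : iSupIndep (A.seriesOps k) := by
  refine iSupIndep_of_separating (ι := ℕ × (Σ r, A.gr r)) (fun x q =>
    Finsupp.lapply (q - 2 * k * (x.1 - 1) + x.2.1) ∘ₗ gradedSplit A.isInternal ∘ₗ
      LinearMap.applyₗ (x.2.2 : A.carrier) ∘ₗ OpSeries.lcoeff x.1) ?_ ?_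
  · rintro ⟨n, r, a, ha⟩ p q f hf hpq
    change gradedSplit A.isInternal (f n a) (q - 2 * k * (n - 1) + r) = 0
    rw [gradedSplit_apply _ ((hf n).hasDegree _ _ ha), Finsupp.single_apply, if_neg (by lia)]
  · intro q f hf h
    refine OpSeries.ext' fun n => LinearMap.ext fun a => ?_
    induction a using graded_induction A.isInternal with
    | ha a b iha ihb => rw [map_add, iha, ihb, map_add]
    | hm r a ha =>
      have := h ⟨n, r, a, ha⟩
      change gradedSplit A.isInternal (f n a) (q - 2 * k * (n - 1) + r) = 0 at this
      rwa [gradedSplit_apply _ ((hf n).hasDegree _ _ ha), Finsupp.single_eq_same] at this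

variable (A) in
/-- The graded commutator of series of operators, divided by the formal parameter. -/
noncomputable def seriesBracket : A.OpSeries →ₗ[K]
    A.OpSeries →ₗ[K] A.OpSeries :=
  LinearMap.mk₂ K (fun f g => ⟨fun n => ∑ x ∈ Finset.HasAntidiagonal.antidiagonal (n + 1),
      superBracket A.conjParity (f x.1) (g x.2)⟩)
    (fun _ _ _ => OpSeries.ext' fun n => by
      simp [OpSeries.add_apply, Finset.sum_add_distrib])
    (fun _ _ _ => OpSeries.ext' fun n => by simp [OpSeries.smul_apply, Finset.smul_sum])
    (fun _ _ _ => OpSeries.ext' fun n => by simp [OpSeries.add_apply, Finset.sum_add_distrib])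
    (fun _ _ _ => OpSeries.ext' fun n => by simp [OpSeries.smul_apply, Finset.smul_sum])

/-- The degrees of the coefficients of a homogeneous series differ by multiples of 2k, so they have
one common parity and the commutator sign does not depend on the coefficient. -/
theorem conjParity_of_mem {p : ℤ} {f : A.OpSeries}
    (hf : f ∈ A.seriesOps k p) (n : ℕ) : A.conjParity (f n) = p.negOnePow • f n := by
  rw [(hf n).hasDegree.conjParity,
    negOnePow_congr (a := p - 2 * k * (n - 1)) (b := p) ⟨-k * (n - 1), by ring⟩]

theorem seriesBracket_apply [CharZero K] {p q : ℤ} {f g : A.OpSeries}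
    (hf : f ∈ A.seriesOps k p) (hg : g ∈ A.seriesOps k q) (n : ℕ) :
    A.seriesBracket f g n = ∑ x ∈ Finset.HasAntidiagonal.antidiagonal (n + 1),
      gradedCommutator p q (f x.1) (g x.2) := by
  change ∑ x ∈ Finset.HasAntidiagonal.antidiagonal (n + 1),
    superBracket A.conjParity (f x.1) (g x.2) = _
  exact Finset.sum_congr rfl fun x _ =>
    superBracket_apply (conjParity_of_mem hf x.1) (conjParity_of_mem hg x.2)

theorem coeff_superCommutator (p q : ℤ) (n : ℕ) (f g : A.OpSeries) :
    PowerSeries.coeff n (superCommutator p q (PowerSeries.mk f.coeff) (PowerSeries.mk g.coeff))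
      = ∑ x ∈ Finset.HasAntidiagonal.antidiagonal n, gradedCommutator p q (f x.1) (g x.2) := by
  simp only [gradedCommutator]
  rw [superCommutator, map_sub, Units.smul_def, map_zsmul, PowerSeries.coeff_mul,
    PowerSeries.coeff_mul, Finset.sum_sub_distrib, Finset.smul_sum,
    ← Finset.Nat.sum_antidiagonal_swap (f := fun x => _ • (_ * _))]
  simp only [PowerSeries.coeff_mk]
  rfl

theorem commutator_zero_zero {p q : ℤ} {f g : Module.End K A.carrier} {r s : ℤ}
    (hf : A.IsDiffOp 0 r f) (hg : A.IsDiffOp 0 s g) (hr : Even (p - r)) (hs : Even (q - s)) :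
    gradedCommutator p q f g = 0 :=
  (gradedCommutator_congr hr hs _ _).trans (IsDiffOp.gradedCommutator_zero_zero hf hg)

/-- The weight n - 1 in the degree is additive: (a - 1) + (b - 1) = n - 1 when a + b = n + 1, as
happens after division by X. This explains the normalisation in `seriesOps`. -/
theorem isDiffOp_commutator_of_add_eq {p q : ℤ} {r s a b n : ℕ}
    {f g : Module.End K A.carrier} (hf : A.IsDiffOp r (p - 2 * k * (a - 1)) f)
    (hg : A.IsDiffOp s (q - 2 * k * (b - 1)) g) (hab : a + b = n + 1) {t : ℕ} (h : r + s = t + 1) :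
    A.IsDiffOp t (p + q - 2 * k * (n - 1)) (gradedCommutator p q f g) := by
  rw [gradedCommutator_congr (p' := p - 2 * k * (a - 1)) (q' := q - 2 * k * (b - 1))
    ⟨k * (a - 1), by ring⟩ ⟨k * (b - 1), by ring⟩]
  have e : (a : ℤ) + b = n + 1 := by exact_mod_cast hab
  refine (hf.gradedCommutator hg h).congr_degree ?_
  linear_combination (-2 * k) * e

theorem antidiagonal_one_cases {x : ℕ × ℕ} (hx : x ∈ Finset.HasAntidiagonal.antidiagonal (0 + 1)) :
    x = (0, 1) ∨ x = (1, 0) := by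
  have hx := Finset.HasAntidiagonal.mem_antidiagonal.1 hx
  obtain ⟨a, b⟩ := x
  simp only [Prod.mk.injEq] at hx ⊢
  omega

/-- The constant term of the commutator is that of two operators of order 0, which commute. Hence
the commutator is divisible by X, and `seriesBracket` is the quotient. -/
theorem X_mul_seriesBracket [CharZero K] {p q : ℤ} {f g : A.OpSeries}
    (hf : f ∈ A.seriesOps k p) (hg : g ∈ A.seriesOps k q) :
    PowerSeries.X * PowerSeries.mk (A.seriesBracket f g).coeff
      = superCommutator p q (PowerSeries.mk f.coeff) (PowerSeries.mk g.coeff) := by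
  ext1 n
  rw [coeff_superCommutator]
  cases n with
  | zero =>
    rw [PowerSeries.coeff_zero_X_mul, Finset.Nat.antidiagonal_zero, Finset.sum_singleton]
    exact (commutator_zero_zero (hf 0) (hg 0) ⟨-k, by push_cast; ring⟩
      ⟨-k, by push_cast; ring⟩).symm
  | succ n => rw [PowerSeries.coeff_succ_X_mul, PowerSeries.coeff_mk, seriesBracket_apply hf hg]

theorem seriesBracket_mem [CharZero K] {p q : ℤ} {f g : A.OpSeries}
    (hf : f ∈ A.seriesOps k p) (hg : g ∈ A.seriesOps k q) :
    A.seriesBracket f g ∈ A.seriesOps k (p + q) := fun n => by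
  rw [seriesBracket_apply hf hg]
  refine IsDiffOp.sum fun x hx => ?_
  have hx := Finset.HasAntidiagonal.mem_antidiagonal.1 hx
  exact isDiffOp_commutator_of_add_eq (hf _) (hg _) hx hx

/-- An order saved in f is saved in every commutator. For the constant coefficient, f₀ is 0 and f₁
has order 0, so f₁ commutes with g₀. -/
theorem seriesBracket_mem_low [CharZero K] {p q : ℤ} {f g : A.OpSeries}
    (hf : f ∈ A.seriesOpsLow k p) (hg : g ∈ A.seriesOps k q) :
    A.seriesBracket f g ∈ A.seriesOpsLow k (p + q) := by
  have hf' := seriesOpsLow_le p hf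
  refine ⟨?_, fun n => ?_⟩
  · rw [seriesBracket_apply hf' hg]
    refine Finset.sum_eq_zero fun x hx => ?_
    obtain rfl | rfl := antidiagonal_one_cases hx
    · rw [hf.1, gradedCommutator_zero_left]
    · exact commutator_zero_zero (hf.2 0) (hg 0) (by simp) ⟨-k, by push_cast; ring⟩
  · rw [seriesBracket_apply hf' hg]
    refine (IsDiffOp.sum (r := n) (m := p + q - 2 * k * ((n + 1 : ℕ) - 1)) fun x hx => ?_
      ).congr_degree (by push_cast; ring)
    have hx := Finset.HasAntidiagonal.mem_antidiagonal.1 hx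
    obtain ⟨a, b⟩ := x
    cases a with
    | zero => rw [hf.1, gradedCommutator_zero_left]; exact IsDiffOp.zero _ _
    | succ a =>
      refine isDiffOp_commutator_of_add_eq (a := a + 1) ((hf.2 a).congr_degree (by push_cast; ring))
        (hg b) hx ?_
      simp only at hx
      omega

theorem seriesBracket_antisymm [CharZero K] {p q : ℤ} {f g : A.OpSeries}
    (hf : f ∈ A.seriesOps k p) (hg : g ∈ A.seriesOps k q) :
    A.seriesBracket f g = -((p * q).negOnePow • A.seriesBracket g f) := by
  refine OpSeries.ext' fun n => ?_
  rw [OpSeries.neg_apply, OpSeries.units_smul_apply, seriesBracket_apply hf hg, seriesBracket_apply hg hf,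
    ← Finset.Nat.sum_antidiagonal_swap, Finset.smul_sum, ← Finset.sum_neg_distrib]
  exact Finset.sum_congr rfl fun _ _ => gradedCommutator_antisymm _ _ _ _

/-- After multiplication by X² every nested bracket becomes a nested commutator in the associative
algebra of power series. -/
theorem seriesBracket_jacobi [CharZero K] {p q r : ℤ} {f g h : A.OpSeries}
    (hf : f ∈ A.seriesOps k p) (hg : g ∈ A.seriesOps k q) (hh : h ∈ A.seriesOps k r) :
    A.seriesBracket f (A.seriesBracket g h) = A.seriesBracket (A.seriesBracket f g) h
      + (p * q).negOnePow • A.seriesBracket g (A.seriesBracket f h) := by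
  have e : PowerSeries.mk (A.seriesBracket f (A.seriesBracket g h)).coeff
      = PowerSeries.mk (A.seriesBracket (A.seriesBracket f g) h).coeff
        + (p * q).negOnePow • PowerSeries.mk (A.seriesBracket g (A.seriesBracket f h)).coeff := by
    apply PowerSeries.X_mul_injective'
    apply PowerSeries.X_mul_injective'
    dsimp only
    rw [mul_add, mul_smul_comm, X_mul_seriesBracket hf (seriesBracket_mem hg hh),
      X_mul_seriesBracket (seriesBracket_mem hf hg) hh,
      X_mul_seriesBracket hg (seriesBracket_mem hf hh), mul_add, mul_smul_comm,
      ← PowerSeries.superCommutator_X_mul_right, ← PowerSeries.superCommutator_X_mul_right _ _ (PowerSeries.mk g.coeff),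
      ← PowerSeries.superCommutator_X_mul_left _ _ _ (PowerSeries.mk h.coeff),
      X_mul_seriesBracket hf hg, X_mul_seriesBracket hf hh, X_mul_seriesBracket hg hh,
      superCommutator_jacobi]
  refine OpSeries.ext' fun n => ?_
  have := congrArg (PowerSeries.coeff n) e
  rwa [map_add, Units.smul_def, map_zsmul, PowerSeries.coeff_mk, PowerSeries.coeff_mk,
    PowerSeries.coeff_mk] at this

variable (A) in
/-- The series `X d + X² l`. -/
noncomputable def seriesDifferential (l : Module.End K A.carrier) : A.OpSeries where
  coeff
  | 1 => A.d
  | 2 => l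
  | _ => 0

variable {l : Module.End K A.carrier}

theorem seriesDifferential_mem (hl : A.IsBracketGenerator (1 - 2 * k) l) :
    A.seriesDifferential l ∈ A.seriesOps k 1 := fun n =>
  match n with
  | 0 => IsDiffOp.zero _ _
  | 1 => isDiffOp_d.congr_degree (by push_cast; ring)
  | 2 => hl.isDiffOp.congr_degree (by push_cast; ring)
  | _ + 3 => IsDiffOp.zero _ _

theorem gradedCommutator_d_d : gradedCommutator 1 1 A.d A.d = 0 := by
  have hd : A.d * A.d = 0 := LinearMap.ext A.d_d
  simp [gradedCommutator, hd]

/-- The terms from d with d and from d with l vanish. What remains is [l, l], at X⁴ before division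
by X and hence at X³, where an operator of order 2 counts as lower. -/
theorem seriesBracket_differential_mem [CharZero K] (hl : A.IsBracketGenerator (1 - 2 * k) l) :
    A.seriesBracket (A.seriesDifferential l) (A.seriesDifferential l) ∈ A.seriesOpsLow k 2 := by
  have hQ := seriesDifferential_mem hl
  have hdl : gradedCommutator 1 1 A.d l = 0 :=
    (gradedCommutator_congr ⟨0, by ring⟩ ⟨k, by ring⟩ _ _).trans hl.commutator_d
  have zl : ∀ g, gradedCommutator 1 1 (0 : Module.End K A.carrier) g = 0 :=
    gradedCommutator_zero_left _ _
  have zr : ∀ g, gradedCommutator 1 1 g (0 : Module.End K A.carrier) = 0 :=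
    gradedCommutator_zero_right _ _
  have of_eq_zero : ∀ {n m} {f : Module.End K A.carrier}, f = 0 → A.IsDiffOp n m f :=
    fun h => h ▸ IsDiffOp.zero _ _
  refine ⟨?_, fun n => ?_⟩
  · rw [seriesBracket_apply hQ hQ]
    refine Finset.sum_eq_zero fun x hx => ?_
    obtain rfl | rfl := antidiagonal_one_cases hx
    · exact zl _
    · exact zr _
  · rw [seriesBracket_apply hQ hQ]
    refine IsDiffOp.sum fun x hx => ?_
    have hx := Finset.HasAntidiagonal.mem_antidiagonal.1 hx
    obtain ⟨a, b⟩ := x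
    match a, b with
    | 0, _ => exact of_eq_zero (zl _)
    | _, 0 => exact of_eq_zero (zr _)
    | _ + 3, _ => exact of_eq_zero (zl _)
    | _, _ + 3 => exact of_eq_zero (zr _)
    | 1, 1 => exact of_eq_zero gradedCommutator_d_d
    | 1, 2 => exact of_eq_zero hdl
    | 2, 1 =>
      refine of_eq_zero ((gradedCommutator_antisymm 1 1 l A.d).trans ?_)
      rw [hdl, smul_zero, neg_zero]
    | 2, 2 =>
      obtain rfl : n = 2 := by simp only at hx; omega
      have := gradedCommutator_congr (p := 1) (q := 1) (p' := 1 - 2 * k) (q' := 1 - 2 * k)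
        ⟨k, by ring⟩ ⟨k, by ring⟩ l l
      exact (this ▸ hl.commutator_self).congr_degree (by push_cast; ring)

variable (A k l) in
/-- The Lie algebra of series of operators modulo those of lower order. -/
noncomputable def seriesSubquotient [CharZero K] (hl : A.IsBracketGenerator (1 - 2 * k) l) :
    GradedLieSubquotient K A.OpSeries where
  R := A.seriesOps k
  J := A.seriesOpsLow k
  J_le := seriesOpsLow_le
  indep := iSupIndep_seriesOps
  β := A.seriesBracket
  Q := A.seriesDifferential l
  Q_mem := seriesDifferential_mem hl
  β_mem := seriesBracket_mem
  β_mem_J := seriesBracket_mem_low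
  antisymm := seriesBracket_antisymm
  jacobi := seriesBracket_jacobi
  β_Q_Q := seriesBracket_differential_mem hl

end CDGA

/-! ### Iterated commutators with i, and left multiplications as constant series. -/

namespace CDGA

variable {K : Type u} [Field K] {A : CDGA.{u, v} K}

theorem parity_parity (a : A.carrier) : A.parity (A.parity a) = a := by
  induction a using graded_induction A.isInternal with
  | ha a b iha ihb => rw [map_add, map_add, iha, ihb]
  | hm p a ha =>
    rw [A.parity_apply ha, parity_units_smul, A.parity_apply ha, smul_smul, negOnePow_mul_self,
      one_smul]

theorem parity_mem {p : ℤ} {a : A.carrier} (ha : a ∈ A.gr p) : A.parity a ∈ A.gr p := by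
  rw [A.parity_apply ha]; exact units_smul_mem _ _ ha

theorem parity_d (a : A.carrier) : A.parity (A.d a) = -A.d (A.parity a) := by
  induction a using graded_induction A.isInternal with
  | ha a b iha ihb => simp only [map_add, iha, ihb, neg_add]
  | hm p a ha =>
    rw [A.parity_apply ha, A.parity_apply (A.d_mem ha), Int.negOnePow_succ, Units.neg_smul,
      map_units_smul]

section adjoint

variable (i : Module.End K A.carrier)

/-- The (ungraded) commutator with an operator. -/
noncomputable def adOp : Module.End K A.carrier →ₗ[K] Module.End K A.carrier :=
  LinearMap.mulLeft K i - LinearMap.mulRight K i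

theorem adOp_apply (f : Module.End K A.carrier) : adOp i f = i * f - f * i := rfl

/-- No sign appears when ad i passes f because i is treated as even; its actual degree is -2k. -/
theorem adOp_gradedCommutator (p q : ℤ) (f g : Module.End K A.carrier) :
    adOp i (gradedCommutator p q f g)
      = gradedCommutator p q (adOp i f) g + gradedCommutator p q f (adOp i g) := by
  simp only [adOp_apply, gradedCommutator, mul_sub, sub_mul, mul_smul_comm, smul_mul_assoc,
    smul_sub, mul_assoc]
  abel

variable {i} {k : ℤ}

theorem gradedCommutator_eq_adOp (q : ℤ) (f : Module.End K A.carrier) :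
    gradedCommutator (-(2 * k)) q i f = adOp i f := by
  rw [gradedCommutator, negOnePow_mul_of_even_left q ⟨-k, by ring⟩, one_smul, adOp_apply]

theorem lieOp_eq_adOp : A.lieOp k i = adOp i A.d := gradedCommutator_eq_adOp _ _

theorem IsDiffOp.adOp {r : ℕ} {m : ℤ} {f : Module.End K A.carrier}
    (hi : A.IsDiffOp 2 (-(2 * k)) i) (hf : A.IsDiffOp r m f) :
    A.IsDiffOp (r + 1) (m - 2 * k) (adOp i f) := by
  rw [← gradedCommutator_eq_adOp (k := k) m]
  exact (hi.gradedCommutator hf (by omega)).congr_degree (by ring)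

theorem IsDiffOp.adOp_pow {m : ℤ} {f : Module.End K A.carrier}
    (hi : A.IsDiffOp 2 (-(2 * k)) i) (hf : A.IsDiffOp 0 m f) (n : ℕ) :
    A.IsDiffOp n (m - 2 * k * n) ((CDGA.adOp i)^[n] f) := by
  induction n with
  | zero => exact hf.congr_degree (by push_cast; ring)
  | succ n ih =>
    rw [Function.iterate_succ_apply']
    exact (IsDiffOp.adOp hi ih).congr_degree (by push_cast; ring)

/-- The commutator of `d` with `exp(ad i)` is `-[l, exp(ad i) ·]` up to operators of lower order. -/
theorem isDiffOp_commutator_adOp_pow {m : ℤ} {f : Module.End K A.carrier}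
    (hi : A.IsDiffOp 2 (-(2 * k)) i)
    (hl : A.IsDiffOp 2 (1 - 2 * k - 2 * k) (adOp i (A.lieOp k i)))
    (hf : A.IsDiffOp 0 m f) (n : ℕ) :
    A.IsDiffOp n (m + 1 - 2 * k * (n + 1)) (gradedCommutator 1 m A.d ((adOp i)^[n + 1] f)
      + (n + 1 : K) • gradedCommutator 1 m (A.lieOp k i) ((adOp i)^[n] f)
      - (adOp i)^[n + 1] (gradedCommutator 1 m A.d f)) := by
  have key : ∀ g, gradedCommutator 1 m A.d (adOp i g)
      = adOp i (gradedCommutator 1 m A.d g) - gradedCommutator 1 m (A.lieOp k i) g := fun g => by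
    rw [adOp_gradedCommutator, ← lieOp_eq_adOp (k := k)]; abel
  induction n with
  | zero =>
    have : (adOp i)^[0 + 1] = adOp i := rfl
    rw [this, key]
    simpa using IsDiffOp.zero _ _
  | succ n ih =>
    -- Applying ad i to the previous relation gives the next one plus n + 1 times [[i, l], (ad i)ⁿ
    -- f]. Since [i, l] has order at most 2 and not merely 3, that error has order at most n + 1 and
    -- may be discarded. This is the second use of the hypothesis on [l, i].
    have h := IsDiffOp.adOp hi ih
    have h2 := (hl.gradedCommutator (IsDiffOp.adOp_pow hi hf n) (t := n + 1) (by omega)).smul (n + 1 : K)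
    rw [gradedCommutator_congr (p' := 1) (q' := m) ⟨-(2 * k), by ring⟩ ⟨-(k * n), by ring⟩] at h2
    have e := (h.congr_degree (m' := m + 1 - 2 * k * ((n + 1 : ℕ) + 1)) (by push_cast; ring)).sub
      (h2.congr_degree (by push_cast; ring))
    convert e using 1
    rw [map_sub, map_add, map_smul, adOp_gradedCommutator, adOp_gradedCommutator,
      ← lieOp_eq_adOp (k := k)]
    simp only [← Function.iterate_succ_apply' (adOp i)]
    push_cast
    simp only [smul_add, add_smul, one_smul]
    abel

end adjoint

section complement

variable {k : ℤ} {l : Module.End K A.carrier} 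

variable (A) in
/-- The series with a single coefficient. -/
noncomputable def seriesSingle (n : ℕ) : Module.End K A.carrier →ₗ[K] A.OpSeries :=
  OpSeries.ofCoeff fun m => if m = n then LinearMap.id else 0

theorem seriesSingle_same (n : ℕ) (f : Module.End K A.carrier) : A.seriesSingle n f n = f :=
  congrArg (fun φ : Module.End K A.carrier →ₗ[K] Module.End K A.carrier => φ f) (if_pos rfl)

theorem seriesSingle_of_ne {m n : ℕ} (h : m ≠ n) (f : Module.End K A.carrier) :
    A.seriesSingle n f m = 0 :=
  congrArg (fun φ : Module.End K A.carrier →ₗ[K] Module.End K A.carrier => φ f) (if_neg h)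

/-- Coefficient n of the bracket pairs indices with sum n + 1, and a constant series leaves only the
pair (n + 1, 0). -/
theorem seriesBracket_single_right (f : A.OpSeries) (g : Module.End K A.carrier)
    (n : ℕ) : A.seriesBracket f (A.seriesSingle 0 g) n = superBracket A.conjParity (f (n + 1)) g := by
  change ∑ x ∈ Finset.HasAntidiagonal.antidiagonal (n + 1),
    superBracket A.conjParity (f x.1) (A.seriesSingle 0 g x.2) = _
  rw [Finset.sum_eq_single (n + 1, 0)]
  · rw [seriesSingle_same]
  · rintro ⟨a, b⟩ hx hne
    have hx := Finset.HasAntidiagonal.mem_antidiagonal.1 hx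
    have : b ≠ 0 := by
      rintro rfl
      exact hne (by simp only [add_zero] at hx; rw [hx])
    rw [seriesSingle_of_ne this, map_zero]
  · intro h
    exact absurd (Finset.HasAntidiagonal.mem_antidiagonal.2 (add_zero _)) h

variable (A) in
/-- The operators of left multiplication, as constant series. -/
noncomputable def seriesMul : A.carrier →ₗ[K] A.OpSeries :=
  -- The parity makes [d, ·] act on these multiplications as -d, which is the sign required by
  -- `DGLA.Complement.π_d`.
  A.seriesSingle 0 ∘ₗ LinearMap.mul K A.carrier ∘ₗ
    A.parity

theorem seriesMul_apply (a : A.carrier) :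
    A.seriesMul a = A.seriesSingle 0 (LinearMap.mulLeft K (A.parity a)) := rfl

theorem seriesMul_mem {p : ℤ} {a : A.carrier} (ha : a ∈ A.gr p) :
    A.seriesMul a ∈ A.seriesOps k (p - 2 * k) := fun n => by
  rw [seriesMul_apply]
  cases n with
  | zero =>
    rw [seriesSingle_same]
    exact (isDiffOp_mulLeft (parity_mem ha)).congr_degree (by push_cast; ring)
  | succ n => rw [seriesSingle_of_ne (by omega)]; exact IsDiffOp.zero _ _

theorem apply_zero_of_mem_iSup {f : A.OpSeries} (hf : f ∈ ⨆ p, A.seriesOps k p) :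
    f 0 = LinearMap.mulLeft K (f 0 1) := by
  induction hf using Submodule.iSup_induction' with
  | mem p f hf => exact (hf 0).eq_mulLeft
  | zero => ext; simp [OpSeries.zero_apply]
  | add f g _ _ hf hg =>
    rw [OpSeries.add_apply, LinearMap.add_apply, mulLeft_add, ← hf, ← hg]

theorem seriesMul_mem_iSup (a : A.carrier) : A.seriesMul a ∈ ⨆ p, A.seriesOps k p := by
  induction a using graded_induction A.isInternal with
  | ha a b iha ihb => rw [map_add]; exact add_mem iha ihb
  | hm p a ha => exact Submodule.mem_iSup_of_mem _ (seriesMul_mem ha)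

theorem gradedCommutator_d_mulLeft_parity (m : ℤ) {p : ℤ} {a : A.carrier} (ha : a ∈ A.gr p)
    (hm : Even (m - p)) : gradedCommutator 1 m A.d (LinearMap.mulLeft K (A.parity a))
      = -LinearMap.mulLeft K (A.parity (A.d a)) := by
  rw [gradedCommutator_congr (p' := 1) (q' := p) ⟨0, by ring⟩ hm,
    gradedCommutator_d_mulLeft (parity_mem ha), parity_d, mulLeft_neg, neg_neg]

/-- The derived bracket representation on series. -/
theorem seriesBracket_differential_seriesMul [CharZero K]
    (hl : A.IsBracketGenerator (1 - 2 * k) l) {p : ℤ} {a : A.carrier} (ha : a ∈ A.gr p) :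
    A.seriesBracket (A.seriesDifferential l) (A.seriesMul a) + A.seriesMul (A.d a)
      = A.seriesSingle 1 (gradedCommutator 1 p l (LinearMap.mulLeft K (A.parity a))) := by
  have hQ := conjParity_of_mem (seriesDifferential_mem hl)
  have hA : A.conjParity (LinearMap.mulLeft K (A.parity a))
      = p.negOnePow • LinearMap.mulLeft K (A.parity a) :=
    (A.mulLeft_hasDegree (parity_mem ha)).conjParity
  refine OpSeries.ext' fun n => ?_
  rw [OpSeries.add_apply, seriesMul_apply, seriesBracket_single_right, superBracket_apply (hQ _) hA,
    seriesMul_apply]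
  match n with
  | 0 =>
    rw [seriesSingle_same, seriesSingle_of_ne zero_ne_one]
    refine (congrArg (· + _) (gradedCommutator_d_mulLeft_parity p ha (by simp))).trans ?_
    exact neg_add_cancel _
  | 1 =>
    rw [seriesSingle_same, seriesSingle_of_ne one_ne_zero, add_zero]
    rfl
  | n + 2 =>
    rw [seriesSingle_of_ne (by omega), seriesSingle_of_ne (by omega), add_zero]
    exact gradedCommutator_zero_left 1 p _

theorem seriesBracket_single_one_single_zero [CharZero K] {p q : ℤ} {f g : Module.End K A.carrier}
    (hf : A.conjParity f = p.negOnePow • f) (hg : A.conjParity g = q.negOnePow • g) :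
    A.seriesBracket (A.seriesSingle 1 f) (A.seriesSingle 0 g) = A.seriesSingle 0 (gradedCommutator p q f g) := by
  refine OpSeries.ext' fun n => ?_
  rw [seriesBracket_single_right]
  cases n with
  | zero =>
    rw [seriesSingle_same, seriesSingle_same, superBracket_apply hf hg]
    rfl
  | succ n =>
    rw [seriesSingle_of_ne (by omega), seriesSingle_of_ne (by omega), map_zero,
      LinearMap.zero_apply]

/-- By `mulLeft_bracketOf` the double commutator is multiplication by the bracket. The sign left
over collects the parities of a, b and of their bracket, which has odd degree relative to a b. -/
theorem seriesBracket_commutator_seriesMul [CharZero K]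
    (hl : A.IsBracketGenerator (1 - 2 * k) l) {p : ℤ} {a : A.carrier} (ha : a ∈ A.gr p)
    (b : A.carrier) :
    A.seriesBracket (A.seriesSingle 1 (gradedCommutator 1 p l (LinearMap.mulLeft K (A.parity a))))
      (A.seriesMul b) = -(p.negOnePow • A.seriesMul (A.bracketOf l a b)) := by
  induction b using graded_induction A.isInternal with
  | ha b c hb hc => simp only [map_add, hb, hc, smul_add, neg_add]
  | hm q b hb =>
    have hc := gradedCommutator_congr (p := 1) (p' := 1 - 2 * k) (q := p) (q' := p) ⟨k, by ring⟩
      ⟨0, by ring⟩ l (LinearMap.mulLeft K (A.parity a))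
    have hA : A.conjParity (gradedCommutator 1 p l (LinearMap.mulLeft K (A.parity a)))
        = (1 - 2 * k + p).negOnePow • gradedCommutator 1 p l (LinearMap.mulLeft K (A.parity a)) := by
      rw [hc]
      exact (hl.isDiffOp.commutator (parity_mem ha)).hasDegree.conjParity
    have hB : A.conjParity (LinearMap.mulLeft K (A.parity b))
        = q.negOnePow • LinearMap.mulLeft K (A.parity b) :=
      (A.mulLeft_hasDegree (parity_mem hb)).conjParity
    have hm := A.bracketOf_mem hl.isDiffOp.hasDegree ha hb
    rw [seriesMul_apply, seriesMul_apply, seriesBracket_single_one_single_zero hA hB, hc,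
      A.parity_apply ha, A.parity_apply hb, mulLeft_units_smul, mulLeft_units_smul,
      gradedCommutator_units_smul_right, gradedCommutator_units_smul_right,
      gradedCommutator_units_smul_left, ← hl.mulLeft_bracketOf ha hb, A.parity_apply hm,
      mulLeft_units_smul]
    refine OpSeries.ext' fun n => ?_
    cases n with
    | zero =>
      rw [OpSeries.neg_apply, OpSeries.units_smul_apply, seriesSingle_same, seriesSingle_same, smul_smul,
        ← Units.neg_smul]
      congr 1
      rw [Int.negOnePow_add, Int.negOnePow_add, Int.negOnePow_odd (1 - 2 * k) ⟨-k, by ring⟩]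
      rcases Int.units_eq_one_or p.negOnePow with h | h <;> rw [h] <;> simp
    | succ n =>
      rw [OpSeries.neg_apply, OpSeries.units_smul_apply, seriesSingle_of_ne (by omega), seriesSingle_of_ne (by omega),
        smul_zero, neg_zero]

end complement

end CDGA

/-! ### Linear maps into and out of the quotient. -/

namespace GradedLieSubquotient

variable {K : Type u} [Field K] {W : Type v} [AddCommGroup W] [Module K W]
  (D : GradedLieSubquotient K W) {V : Type w} [AddCommGroup V] [Module K V]

variable {D} in
theorem cls_mem_gr' {p : ℤ} {f : W} (hf : f ∈ D.R p) (h : f ∈ D.total) : cls h ∈ D.gr p :=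
  cls_mem_gr hf

/-- The map to the quotient induced by a map to the graded Lie algebra. -/
noncomputable def toQuotient (φ : V →ₗ[K] W) (h : ∀ x, φ x ∈ D.total) :
    V →ₗ[K] D.total ⧸ D.ideal :=
  D.ideal.mkQ ∘ₗ φ.codRestrict D.total h

variable {D}

/-- The map from the quotient induced by a linear map vanishing on the ideal. -/
noncomputable def ofQuotient (ψ : W →ₗ[K] V) (h : ⨆ p, D.J p ≤ LinearMap.ker ψ) :
    D.total ⧸ D.ideal →ₗ[K] V :=
  D.ideal.liftQ (ψ ∘ₗ D.total.subtype) fun _ hf => h hf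

theorem cls_surjective (x : D.total ⧸ D.ideal) : ∃ (f : W) (hf : f ∈ D.total), x = cls hf := by
  obtain ⟨f, rfl⟩ := D.ideal.mkQ_surjective x
  exact ⟨f.1, f.2, rfl⟩

end GradedLieSubquotient

/-! ### Homotopy abelianity for a single algebra. -/

namespace CDGA

open GradedLieSubquotient

variable {K : Type u} [Field K] (A : CDGA.{u, v} K)

/-- The DGLA `(A[2k-1], d, [ , ]_l)`, `l = [i, d]`. -/
noncomputable def koszul (k : ℤ) (i : Module.End K A.carrier) (h : (A.koszulData k i).IsDGLA) :
    DGLA.{u, v} K :=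
  { A.koszulData k i with isDGLA := h }

variable {A} {k : ℤ} {i l : Module.End K A.carrier}

theorem seriesBracket_zero (f g : A.OpSeries) (hf : f 0 = 0) (hg : g 0 = 0) :
    A.seriesBracket f g 0 = 0 := by
  change ∑ x ∈ Finset.HasAntidiagonal.antidiagonal (0 + 1),
    superBracket A.conjParity (f x.1) (g x.2) = 0
  refine Finset.sum_eq_zero fun x hx => ?_
  obtain rfl | rfl := antidiagonal_one_cases hx
  · rw [hf, map_zero, LinearMap.zero_apply]
  · rw [hg, map_zero]

/-- Q starts with X d, so the constant term of [Q, f] is [d, f₀]; as d 1 = 0, its value at the unit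
is d (f₀ 1). -/
theorem seriesBracket_differential_zero [CharZero K] (hl : A.IsBracketGenerator (1 - 2 * k) l)
    {f : A.OpSeries} (hf : f ∈ ⨆ p, A.seriesOps k p) :
    A.seriesBracket (A.seriesDifferential l) f 0 1 = A.d (f 0 1) := by
  induction hf using Submodule.iSup_induction' with
  | zero => simp [OpSeries.zero_apply]
  | add f g _ _ hf hg =>
    rw [map_add, OpSeries.add_apply, LinearMap.add_apply, hf, hg, OpSeries.add_apply, LinearMap.add_apply,
      map_add]
  | mem p f hf =>
    rw [seriesBracket_apply (seriesDifferential_mem hl) hf]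
    have : Finset.HasAntidiagonal.antidiagonal (0 + 1) = {(0, 1), (1, 0)} := rfl
    rw [this, Finset.sum_pair (by simp)]
    have h0 : A.seriesDifferential l 0 = 0 := rfl
    have h1 : A.seriesDifferential l 1 = A.d := rfl
    simp [h0, h1, gradedCommutator, d_one]

/-- Evaluation of the constant term at the unit. -/
noncomputable def seriesEval : A.OpSeries →ₗ[K] A.carrier :=
  A.parity ∘ₗ LinearMap.applyₗ (1 : A.carrier) ∘ₗ OpSeries.lcoeff 0

theorem seriesEval_apply (f : A.OpSeries) : seriesEval f = A.parity (f 0 1) := rfl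

theorem iSup_seriesOpsLow_le :
    ⨆ p, A.seriesOpsLow k p ≤ LinearMap.ker (seriesEval (A := A)) :=
  iSup_le fun p f hf => by
    rw [LinearMap.mem_ker, seriesEval_apply, hf.1, LinearMap.zero_apply, map_zero]

section complement

variable [CharZero K] (hl : A.IsBracketGenerator (1 - 2 * k) l)

/-- Evaluation of the constant term at the unit, on the quotient. -/
noncomputable def seriesProj :
    (A.seriesSubquotient k l hl).total ⧸ (A.seriesSubquotient k l hl).ideal →ₗ[K] A.carrier :=
  ofQuotient seriesEval iSup_seriesOpsLow_le

/-- Left multiplications, in the quotient. -/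
noncomputable def seriesSection : A.carrier →ₗ[K]
    (A.seriesSubquotient k l hl).total ⧸ (A.seriesSubquotient k l hl).ideal :=
  toQuotient _ A.seriesMul seriesMul_mem_iSup

variable {hl}

theorem seriesProj_cls {f : A.OpSeries}
    (hf : f ∈ (A.seriesSubquotient k l hl).total) :
    seriesProj hl (cls hf) = A.parity (f 0 1) := rfl

theorem seriesProj_mem {p : ℤ} {x} (hx : x ∈ (A.seriesSubquotient k l hl).gr p) :
    seriesProj hl x ∈ A.gr (2 * k - 1 + (p + 1)) := by
  obtain ⟨f, hf, rfl⟩ := exists_cls hx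
  rw [seriesProj_cls]
  have := (hf 0).hasDegree 0 1 one_mem_gr
  rw [show p - 2 * k * ((0 : ℕ) - 1) + 0 = 2 * k - 1 + (p + 1) by push_cast; ring] at this
  exact parity_mem this

theorem seriesSection_mem {p : ℤ} {x : A.carrier} (hx : x ∈ A.gr (2 * k - 1 + p)) :
    seriesSection hl x ∈ (A.seriesSubquotient k l hl).gr (p - 1) := by
  have := seriesMul_mem (k := k) hx
  rw [show 2 * k - 1 + p - 2 * k = p - 1 by ring] at this
  exact cls_mem_gr' (D := A.seriesSubquotient k l hl) this _

theorem seriesProj_seriesSection (x : A.carrier) : seriesProj hl (seriesSection hl x) = x := by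
  change A.parity (A.seriesSingle 0 (LinearMap.mulLeft K (A.parity x)) 0 1) = x
  rw [seriesSingle_same, LinearMap.mulLeft_apply, mul_one, parity_parity]

theorem seriesProj_bracket_clsQ (x) :
    seriesProj hl ((A.seriesSubquotient k l hl).bracket (A.seriesSubquotient k l hl).clsQ x)
      = -A.d (seriesProj hl x) := by
  obtain ⟨f, hf, rfl⟩ := cls_surjective x
  change A.parity (A.seriesBracket (A.seriesDifferential l) f 0 1) = -A.d (A.parity (f 0 1))
  rw [seriesBracket_differential_zero hl hf, parity_d]

/-- The constant term is multiplication by its value at 1, so the kernel consists of classes of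
series without constant term. The constant term of a bracket pairs indices (0, 1) and (1, 0), hence
involves f₀ or g₀ in every summand. -/
theorem seriesProj_bracket (x y) (hx : seriesProj hl x = 0) (hy : seriesProj hl y = 0) :
    seriesProj hl ((A.seriesSubquotient k l hl).bracket x y) = 0 := by
  obtain ⟨f, hf, rfl⟩ := cls_surjective x
  obtain ⟨g, hg, rfl⟩ := cls_surjective y
  have key : ∀ f ∈ ⨆ p, A.seriesOps k p, A.parity (f 0 1) = 0 → f 0 = 0 := fun f hf h => by
    rw [apply_zero_of_mem_iSup hf, ← parity_parity (f 0 1), h, map_zero]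
    ext; simp
  change A.parity (A.seriesBracket f g 0 1) = 0
  rw [seriesBracket_zero _ _ (key f hf hx) (key g hg hy), LinearMap.zero_apply, map_zero]

/-- After division by X, coefficient n of the bracket uses coefficient n + 1 of a constant series.
-/
theorem bracket_seriesSection_seriesSection (x y : A.carrier) :
    (A.seriesSubquotient k l hl).bracket (seriesSection hl x) (seriesSection hl y) = 0 := by
  refine cls_eq_zero (D := A.seriesSubquotient k l hl) _ ?_
  have : A.seriesBracket (A.seriesMul x) (A.seriesMul y) = 0 := by
    refine OpSeries.ext' fun n => ?_
    rw [seriesMul_apply, seriesMul_apply, seriesBracket_single_right,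
      seriesSingle_of_ne (by omega), map_zero]
    rfl
  exact this ▸ zero_mem _

/-- Adding s (d x) cancels the constant term of [Q, s x] and leaves X [l, x] up to parity; its
bracket with s y is the derived bracket. The sign uses that 2k - 1 + p + 1 has the parity of p. -/
theorem bracket_seriesSection {p : ℤ} {x : A.carrier} (hx : x ∈ A.gr (2 * k - 1 + p))
    (y : A.carrier) : (A.seriesSubquotient k l hl).bracket
      ((A.seriesSubquotient k l hl).bracket (A.seriesSubquotient k l hl).clsQ (seriesSection hl x)
        + seriesSection hl (A.d x)) (seriesSection hl y)
      = p.negOnePow • seriesSection hl (A.bracketOf l x y) := by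
  have h : A.seriesBracket (A.seriesBracket (A.seriesDifferential l) (A.seriesMul x)
      + A.seriesMul (A.d x)) (A.seriesMul y) = p.negOnePow • A.seriesMul (A.bracketOf l x y) := by
    rw [seriesBracket_differential_seriesMul hl hx, seriesBracket_commutator_seriesMul hl hx,
      ← Units.neg_smul, ← Int.negOnePow_succ,
      negOnePow_congr (a := 2 * k - 1 + p + 1) (b := p) ⟨k, by ring⟩]
  exact (cls_congr (D := A.seriesSubquotient k l hl) h _ _).trans
    (units_smul_cls (D := A.seriesSubquotient k l hl) _ (seriesMul_mem_iSup _)).symm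

end complement

variable (A) in
/-- The space `A[2k]` as a complement of the sub-DGLA of series annihilating the unit. -/
noncomputable def seriesComplement [CharZero K] (hl : A.IsBracketGenerator (1 - 2 * k) (A.lieOp k i))
    (h : (A.koszulData k i).IsDGLA) :
    DGLA.Complement (A.seriesSubquotient k _ hl).toDGLA (A.koszul k i h) where
  π := seriesProj hl
  s := seriesSection hl
  π_mem := seriesProj_mem
  s_mem := seriesSection_mem
  π_s := seriesProj_seriesSection
  π_d := seriesProj_bracket_clsQ
  π_bracket := seriesProj_bracket

variable (A i) in
/-- The series `exp(ad i)` applied to left multiplications. -/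
noncomputable def seriesExp : A.carrier →ₗ[K] A.OpSeries :=
  OpSeries.ofCoeff fun n => ((n.factorial : K)⁻¹ • adOp i ^ n) ∘ₗ LinearMap.mul K A.carrier ∘ₗ A.parity

theorem seriesExp_apply (a : A.carrier) (n : ℕ) : seriesExp A i a n
    = (n.factorial : K)⁻¹ • (adOp i)^[n] (LinearMap.mulLeft K (A.parity a)) := by
  rw [← Module.End.pow_apply]; rfl

theorem seriesExp_mem (hi : A.IsDiffOp 2 (-(2 * k)) i) {p : ℤ} {a : A.carrier} (ha : a ∈ A.gr p) :
    seriesExp A i a ∈ A.seriesOps k (p - 2 * k) := fun n => by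
  rw [seriesExp_apply]
  exact ((IsDiffOp.adOp_pow hi (isDiffOp_mulLeft (parity_mem ha)) n).smul _).congr_degree (by ring)

theorem seriesExp_mem_iSup (hi : A.IsDiffOp 2 (-(2 * k)) i) (a : A.carrier) :
    seriesExp A i a ∈ ⨆ p, A.seriesOps k p := by
  induction a using graded_induction A.isInternal with
  | ha a b iha ihb => rw [map_add]; exact add_mem iha ihb
  | hm p a ha => exact Submodule.mem_iSup_of_mem _ (seriesExp_mem hi ha)

theorem seriesBracket_differential_apply [CharZero K] {f : A.OpSeries} {p : ℤ}
    (hl : A.IsBracketGenerator (1 - 2 * k) l) (hf : f ∈ A.seriesOps k p) (n : ℕ) :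
    A.seriesBracket (A.seriesDifferential l) f (n + 1)
      = gradedCommutator 1 p A.d (f (n + 1)) + gradedCommutator 1 p l (f n) := by
  rw [seriesBracket_apply (seriesDifferential_mem hl) hf,
    Finset.Nat.sum_antidiagonal_eq_sum_range_succ_mk, Finset.sum_range_succ', Finset.sum_range_succ',
    Finset.sum_range_succ', Finset.sum_eq_zero]
  · refine (congrArg (_ + ·) (gradedCommutator_zero_left 1 p _)).trans ?_
    rw [zero_add, add_zero, add_comm]
    rfl
  · intro x _
    exact gradedCommutator_zero_left 1 p _

/-- In the quotient, exp(ad i) intertwines d with [Q, ·] up to the sign of the shift. The constant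
coefficient cancels exactly; coefficient n + 1 is the operator of `isDiffOp_commutator_adOp_pow`
divided by (n + 1)!. -/
theorem seriesBracket_differential_seriesExp [CharZero K] (hi : A.IsDiffOp 2 (-(2 * k)) i)
    (hl : A.IsBracketGenerator (1 - 2 * k) (A.lieOp k i))
    (hil : A.IsDiffOp 2 (1 - 2 * k - 2 * k) (adOp i (A.lieOp k i))) {p : ℤ} {a : A.carrier}
    (ha : a ∈ A.gr p) :
    A.seriesBracket (A.seriesDifferential (A.lieOp k i)) (seriesExp A i a) + seriesExp A i (A.d a)
      ∈ A.seriesOpsLow k (p - 2 * k + 1) := by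
  have hQ := seriesDifferential_mem hl
  have hd := gradedCommutator_d_mulLeft_parity p ha (by simp)
  refine ⟨?_, fun n => ?_⟩
  · rw [OpSeries.add_apply, seriesBracket_apply hQ (seriesExp_mem hi ha)]
    have e : Finset.HasAntidiagonal.antidiagonal (0 + 1) = {(0, 1), (1, 0)} := rfl
    have h0 : A.seriesDifferential (A.lieOp k i) 0 = 0 := rfl
    have h1 : A.seriesDifferential (A.lieOp k i) 1 = A.d := rfl
    rw [e, Finset.sum_pair (by simp), seriesExp_apply, seriesExp_apply, seriesExp_apply]
    simp only [h0, h1, gradedCommutator_zero_left, Nat.factorial_zero, Nat.cast_one, inv_one,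
      one_smul, Function.iterate_zero, id]
    rw [gradedCommutator_congr (p' := 1) (q' := p) ⟨0, by ring⟩ ⟨-k, by ring⟩, hd]
    abel
  · rw [OpSeries.add_apply, seriesBracket_differential_apply hl (seriesExp_mem hi ha)]
    have h := (isDiffOp_commutator_adOp_pow hi hil (isDiffOp_mulLeft (parity_mem ha)) n).smul
      (((n + 1).factorial : K)⁻¹)
    convert h.congr_degree ?_ using 1
    -- The factor n + 1 in front of [l, (ad i)ⁿ a] converts 1/(n+1)! into 1/n!, the coefficient in
    -- the exponential.
    · have hn : ((n + 1).factorial : K)⁻¹ * (n + 1) = (n.factorial : K)⁻¹ := by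
        have : (n + 1 : K) ≠ 0 := by exact_mod_cast n.succ_ne_zero
        rw [Nat.factorial_succ]
        push_cast
        field_simp
      have hc := fun f g : Module.End K A.carrier => gradedCommutator_congr (p := 1) (p' := 1)
        (q := p - 2 * k) (q' := p) ⟨0, by ring⟩ ⟨-k, by ring⟩ f g
      rw [hc, hc, hd, seriesExp_apply, seriesExp_apply, seriesExp_apply,
        gradedCommutator_smul_right, gradedCommutator_smul_right, smul_sub, smul_add, smul_smul, hn,
        iterate_map_neg, smul_neg, sub_neg_eq_add]
    · ring

section exponential

variable [CharZero K] (hi : A.IsDiffOp 2 (-(2 * k)) i)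
  (hl : A.IsBracketGenerator (1 - 2 * k) (A.lieOp k i))

/-- The series `exp(ad i)` applied to left multiplications, in the quotient. -/
noncomputable def seriesSplit : A.carrier →ₗ[K] (A.seriesSubquotient k (A.lieOp k i) hl).total ⧸
    (A.seriesSubquotient k (A.lieOp k i) hl).ideal :=
  toQuotient _ (seriesExp A i) (seriesExp_mem_iSup hi)

variable {hi hl}

theorem seriesSplit_mem {p : ℤ} {x : A.carrier} (hx : x ∈ A.gr (2 * k - 1 + p)) :
    seriesSplit hi hl x ∈ (A.seriesSubquotient k (A.lieOp k i) hl).gr (p - 1) := by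
  have := seriesExp_mem hi hx
  rw [show 2 * k - 1 + p - 2 * k = p - 1 by ring] at this
  exact cls_mem_gr' (D := A.seriesSubquotient k _ hl) this _

theorem bracket_clsQ_seriesSplit (hil : A.IsDiffOp 2 (1 - 2 * k - 2 * k) (adOp i (A.lieOp k i)))
    (x : A.carrier) : (A.seriesSubquotient k (A.lieOp k i) hl).bracket
      (A.seriesSubquotient k (A.lieOp k i) hl).clsQ (seriesSplit hi hl x)
      = -seriesSplit hi hl (A.d x) := by
  induction x using graded_induction A.isInternal with
  | ha x y hx hy => rw [map_add, map_add, map_add, map_add, hx, hy, neg_add]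
  | hm p x hx =>
    refine eq_neg_of_add_eq_zero_left ?_
    exact cls_eq_zero (D := A.seriesSubquotient k _ hl) _ (Submodule.mem_iSup_of_mem _
      (seriesBracket_differential_seriesExp hi hl hil hx))

theorem seriesProj_seriesSplit (x : A.carrier) : seriesProj hl (seriesSplit hi hl x) = x := by
  change A.parity (seriesExp A i x 0 1) = x
  rw [seriesExp_apply]
  simp [parity_parity]

end exponential

/-- The criterion applies with left multiplications as s and exp(ad i) as τ. The universe `max u v`
accommodates the path spaces, which are tensor products with forms over K. -/
theorem koszul_isHomotopyAbelian [CharZero K] (A : CDGA.{u, max u v} K) {i : Module.End K A.carrier}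
    (hi : A.IsQuasiBV (-(2 * k)) i)
    (h : A.IsQuasiBV (1 - 2 * k + -(2 * k))
      (gradedCommutator (1 - 2 * k) (-(2 * k)) (A.lieOp k i) i)) :
    (A.koszul k i (koszulData_isDGLA hi h)).IsHomotopyAbelian := by
  have hl := isBracketGenerator_lieOp hi h.1
  have hil : A.IsDiffOp 2 (1 - 2 * k - 2 * k) (adOp i (A.lieOp k i)) := by
    rw [← gradedCommutator_eq_adOp (k := k) (1 - 2 * k), gradedCommutator_antisymm]
    exact (h.1.units_smul _).neg
  exact DGLA.isHomotopyAbelian_of_complement.{u, v} (A.seriesComplement hl (koszulData_isDGLA hi h))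
    bracket_seriesSection_seriesSection (fun p x hx y => bracket_seriesSection hx y)
    (seriesSplit hi.1 hl) (fun p x hx => seriesSplit_mem hx)
    (bracket_clsQ_seriesSplit hil) seriesProj_seriesSplit

end CDGA

/-! ### The tensor product of two differential graded commutative algebras. -/

namespace CDGA

open TensorProduct GradedTensorProduct

variable {K : Type u} [Field K]

/-- The underlying complex of a CDGA, as a DGLA with zero bracket. -/
noncomputable def toAbelianDGLA (A : CDGA.{u, v} K) : DGLA.{u, v} K where
  carrier := A.carrier
  gr := A.gr
  d := A.d
  bracket := 0
  isDGLA :=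
    { isInternal := A.isInternal
      d_mem := A.d_mem
      d_d := A.d_d
      bracket_mem := fun _ _ => zero_mem _
      antisymm := fun _ _ => by simp
      leibniz := fun _ _ => by simp
      jacobi := fun _ _ _ => by simp }

variable (B : CDGA.{u, w} K) (A : CDGA.{u, v} K)

/-- The algebra underlying the tensor product of two CDGAs. -/
def TensorAlg : Type (max w v) := GradedTensorProduct K B.gr A.gr

noncomputable instance : Ring (TensorAlg B A) :=
  inferInstanceAs (Ring (GradedTensorProduct K B.gr A.gr))

noncomputable instance : Algebra K (TensorAlg B A) :=
  inferInstanceAs (Algebra K (GradedTensorProduct K B.gr A.gr))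

variable {B A} in
/-- Pure tensors. -/
noncomputable def tm (b : B.carrier) (a : A.carrier) : TensorAlg B A := GradedTensorProduct.tmul K b a

theorem tm_add_left (b b' : B.carrier) (a : A.carrier) : tm (b + b') a = tm b a + tm b' a :=
  TensorProduct.add_tmul b b' a

theorem tm_add_right (b : B.carrier) (a a' : A.carrier) : tm b (a + a') = tm b a + tm b a' :=
  TensorProduct.tmul_add b a a'

theorem tm_sub_right (b : B.carrier) (a a' : A.carrier) : tm b (a - a') = tm b a - tm b a' :=
  TensorProduct.tmul_sub b a a'

theorem units_smul_tm (c : ℤˣ) (b : B.carrier) (a : A.carrier) : tm (c • b) a = c • tm b a :=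
  sign_smul_tmul (L := A.toAbelianDGLA) c b a

theorem tm_units_smul (c : ℤˣ) (b : B.carrier) (a : A.carrier) : tm b (c • a) = c • tm b a :=
  tmul_sign_smul (L := A.toAbelianDGLA) c b a

theorem tm_mul_tm {p q : ℤ} (b : B.carrier) {a : A.carrier} (ha : a ∈ A.gr p) {b' : B.carrier}
    (hb' : b' ∈ B.gr q) (a' : A.carrier) :
    tm b a * tm b' a' = (p * q).negOnePow • tm (b * b') (a * a') :=
  tmul_coe_mul_coe_tmul B.gr A.gr b ⟨a, ha⟩ ⟨b', hb'⟩ a'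

theorem one_eq_tm : (1 : TensorAlg B A) = tm 1 1 := rfl

/-- The grading of the tensor product. -/
noncomputable def tensorAlgGr (r : ℤ) : Submodule K (TensorAlg B A) :=
  -- The grading and the differential of a tensor product ignore the bracket, so the construction
  -- for DGLAs is reused with zero bracket and only the product is new.
  (tensorGr B A.toAbelianDGLA r : Submodule K (B.carrier ⊗[K] A.carrier))

variable {B A}

theorem tm_mem {p q r : ℤ} {b : B.carrier} {a : A.carrier} (hb : b ∈ B.gr p) (ha : a ∈ A.gr q)
    (h : p + q = r) : tm b a ∈ tensorAlgGr B A r :=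
  tmul_mem_tensorGr (L := A.toAbelianDGLA) hb ha h

@[elab_as_elim]
theorem tensorAlgGr_induction {r : ℤ} {P : ∀ x : TensorAlg B A, x ∈ tensorAlgGr B A r → Prop}
    (hm : ∀ (p q : ℤ) (b : B.carrier) (a : A.carrier) (h : p + q = r) (hb : b ∈ B.gr p)
      (ha : a ∈ A.gr q), P (tm b a) (tm_mem hb ha h))
    (ha : ∀ x y hx hy, P x hx → P y hy → P (x + y) (add_mem hx hy))
    {x : TensorAlg B A} (hx : x ∈ tensorAlgGr B A r) : P x hx :=
  tensorGr_induction (L := A.toAbelianDGLA) (P := P) hm ha hx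

theorem tensorAlgGr_isInternal : DirectSum.IsInternal (tensorAlgGr B A) :=
  tensorGr_isInternal (B := B) (L := A.toAbelianDGLA)

@[elab_as_elim]
theorem tensorAlg_induction {P : TensorAlg B A → Prop}
    (hm : ∀ (p q : ℤ) (b : B.carrier) (a : A.carrier), b ∈ B.gr p → a ∈ A.gr q → P (tm b a))
    (ha : ∀ x y, P x → P y → P (x + y)) (x : TensorAlg B A) : P x :=
  tensor_induction (L := A.toAbelianDGLA) (P := P) hm ha x

theorem tensorAlg_mul_mem {r s : ℤ} {x y : TensorAlg B A} (hx : x ∈ tensorAlgGr B A r)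
    (hy : y ∈ tensorAlgGr B A s) : x * y ∈ tensorAlgGr B A (r + s) := by
  induction hx using tensorAlgGr_induction with
  | ha x x' _ _ hx hx' => rw [add_mul]; exact add_mem hx hx'
  | hm p q b a h hb ha =>
    induction hy using tensorAlgGr_induction with
    | ha y y' _ _ hy hy' => rw [mul_add]; exact add_mem hy hy'
    | hm p' q' b' a' h' hb' ha' =>
      rw [tm_mul_tm _ _ b ha hb' a']
      exact units_smul_mem _ _ (tm_mem (SetLike.mul_mem_graded hb hb')
        (SetLike.mul_mem_graded ha ha') (by lia))

noncomputable instance tensorAlgGraded : GradedAlgebra (tensorAlgGr B A) :=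
  { tensorAlgGr_isInternal.chooseDecomposition with
    one_mem := tm_mem one_mem_gr one_mem_gr (add_zero 0)
    mul_mem := fun _ _ _ _ => tensorAlg_mul_mem }

/-- The differential of the tensor product. -/
noncomputable def tensorAlgD : TensorAlg B A →ₗ[K] TensorAlg B A :=
  (tensorD B A.toAbelianDGLA : B.carrier ⊗[K] A.carrier →ₗ[K] B.carrier ⊗[K] A.carrier)

theorem tensorAlgD_tm {p : ℤ} {b : B.carrier} (hb : b ∈ B.gr p) (a : A.carrier) :
    tensorAlgD (tm b a) = tm (B.d b) a + p.negOnePow • tm b (A.d a) :=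
  tensorD_tmul (L := A.toAbelianDGLA) hb a

theorem tensorAlgD_mul {r : ℤ} {x : TensorAlg B A} (hx : x ∈ tensorAlgGr B A r)
    (y : TensorAlg B A) :
    tensorAlgD (x * y) = tensorAlgD x * y + r.negOnePow • (x * tensorAlgD y) := by
  induction hx using tensorAlgGr_induction with
  | ha x x' _ _ hx hx' =>
    simp only [map_add, add_mul, hx, hx', smul_add]
    abel
  | hm p q b a h hb ha =>
    induction y using tensorAlg_induction with
    | ha y y' hy hy' =>
      simp only [map_add, mul_add, hy, hy', smul_add]
      abel
    | hm p' q' b' a' hb' ha' =>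
      subst h
      rw [tm_mul_tm _ _ b ha hb' a', tensorAlgD_tm hb, tensorAlgD_tm hb', mul_add, add_mul,
        map_units_smul, smul_mul_assoc, mul_smul_comm, tm_mul_tm _ _ _ ha hb',
        tm_mul_tm _ _ _ ha (B.d_mem hb'), tm_mul_tm _ _ _ (A.d_mem ha) hb', tm_mul_tm _ _ _ ha hb',
        tensorAlgD_tm (SetLike.mul_mem_graded hb hb'), B.d_mul hb, A.d_mul ha, tm_add_left,
        tm_add_right, tm_units_smul, units_smul_tm]
      simp only [smul_add, smul_smul, ← Int.negOnePow_add]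
      rw [negOnePow_congr (a := (p + q) + q * (p' + 1)) (b := q * p' + p) ⟨q, by ring⟩,
        negOnePow_congr (a := p + (q + 1) * p') (b := q * p' + (p + p')) ⟨0, by ring⟩,
        negOnePow_congr (a := (p + q) + (p' + q * p')) (b := q * p' + (p + p' + q)) ⟨0, by ring⟩]
      abel

theorem tensorAlg_comm {r s : ℤ} {x y : TensorAlg B A} (hx : x ∈ tensorAlgGr B A r)
    (hy : y ∈ tensorAlgGr B A s) : x * y = (r * s).negOnePow • (y * x) := by
  induction hx using tensorAlgGr_induction with
  | ha x x' _ _ hx hx' => rw [add_mul, mul_add, hx, hx', smul_add]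
  | hm p q b a h hb ha =>
    induction hy using tensorAlgGr_induction with
    | ha y y' _ _ hy hy' => rw [add_mul, mul_add, hy, hy', smul_add]
    | hm p' q' b' a' h' hb' ha' =>
      rw [tm_mul_tm _ _ b ha hb' a', tm_mul_tm _ _ b' ha' hb a, B.graded_comm hb hb',
        A.graded_comm ha ha', tm_units_smul, units_smul_tm]
      simp only [smul_smul, ← Int.negOnePow_add]
      congr 1
      subst h h'
      exact negOnePow_congr ⟨-(q' * p), by ring⟩

variable (B A) in
/-- The tensor product of CDGAs. -/
noncomputable def tensorAlg : CDGA.{u, max w v} K where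
  carrier := TensorAlg B A
  gr := tensorAlgGr B A
  d := tensorAlgD
  d_mem := fun h => tensorD_mem (L := A.toAbelianDGLA) h
  d_d := tensorD_tensorD (L := A.toAbelianDGLA)
  d_mul := tensorAlgD_mul
  graded_comm := tensorAlg_comm

section functoriality

variable {B' : CDGA.{u, w} K} {A' : CDGA.{u, v} K} (f : Hom B B') (g : Hom A A')

/-- The linear map underlying `f ⊗ g`. -/
noncomputable def tensorAlgLinearMap : TensorAlg B A →ₗ[K] TensorAlg B' A' :=
  (TensorProduct.map f.toAlgHom.toLinearMap g.toAlgHom.toLinearMap :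
    B.carrier ⊗[K] A.carrier →ₗ[K] B'.carrier ⊗[K] A'.carrier)

theorem tensorAlgLinearMap_tm (b : B.carrier) (a : A.carrier) :
    tensorAlgLinearMap f g (tm b a) = tm (f.toAlgHom b) (g.toAlgHom a) := rfl

theorem tensorAlgLinearMap_mul (x y : TensorAlg B A) :
    tensorAlgLinearMap f g (x * y) = tensorAlgLinearMap f g x * tensorAlgLinearMap f g y := by
  induction x using tensorAlg_induction with
  | ha x x' hx hx' => rw [add_mul, map_add, map_add, add_mul, hx, hx']
  | hm p q b a hb ha =>
    induction y using tensorAlg_induction with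
    | ha y y' hy hy' => rw [mul_add, map_add, map_add, mul_add, hy, hy']
    | hm p' q' b' a' hb' ha' =>
      rw [tm_mul_tm _ _ b ha hb' a', map_units_smul]
      simp only [tensorAlgLinearMap_tm]
      rw [tm_mul_tm _ _ _ (g.map_mem ha) (f.map_mem hb'), map_mul, map_mul]

/-- The algebra map `f ⊗ g`. -/
noncomputable def tensorAlgAlgHom : TensorAlg B A →ₐ[K] TensorAlg B' A' :=
  AlgHom.ofLinearMap (tensorAlgLinearMap f g)
    (by rw [one_eq_tm, tensorAlgLinearMap_tm, map_one, map_one, one_eq_tm])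
    (tensorAlgLinearMap_mul f g)

/-- The morphism `f ⊗ g` of CDGAs. -/
noncomputable def tensorAlgMap : Hom (tensorAlg B A) (tensorAlg B' A') where
  toAlgHom := tensorAlgAlgHom f g
  map_mem {r x} hx := by
    refine tensorAlgGr_induction (P := fun x _ => tensorAlgLinearMap f g x ∈ tensorAlgGr B' A' r)
      ?_ ?_ hx
    · intro p q b a h hb ha
      exact tm_mem (f.map_mem hb) (g.map_mem ha) h
    · intro x y _ _ hx hy
      rw [map_add]
      exact add_mem hx hy
  map_d x := by
    refine tensorAlg_induction (P := fun x => tensorAlgLinearMap f g (tensorAlgD x)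
      = tensorAlgD (tensorAlgLinearMap f g x)) ?_ ?_ x
    · intro p q b a hb ha
      rw [tensorAlgD_tm hb, map_add, map_units_smul]
      simp only [tensorAlgLinearMap_tm]
      rw [tensorAlgD_tm (f.map_mem hb), f.map_d, g.map_d]
    · intro x y hx hy
      rw [map_add, map_add, map_add, map_add, hx, hy]

end functoriality

/-! ### Operators on a tensor product induced from one factor. -/

section operators

/-- The operator `η ⊗ x ↦ (-1)^(m|η|) bη ⊗ f x` for `f` of degree `m`. -/
noncomputable def tensorOp (m : ℤ) (b : B.carrier) (f : Module.End K A.carrier) :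
    Module.End K (TensorAlg B A) :=
  (TensorProduct.map (LinearMap.mulLeft K b ∘ₗ
    gradedScale B.isInternal fun p => ((m * p).negOnePow : ℤ)) f :
    B.carrier ⊗[K] A.carrier →ₗ[K] B.carrier ⊗[K] A.carrier)

theorem tensorOp_tm (m : ℤ) (b : B.carrier) (f : Module.End K A.carrier) {p : ℤ} {η : B.carrier}
    (hη : η ∈ B.gr p) (x : A.carrier) :
    tensorOp m b f (tm η x) = (m * p).negOnePow • tm (b * η) (f x) := by
  refine (congrArg (fun y => tm (b * y) (f x)) (gradedScale_apply B.isInternal _ hη)).trans ?_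
  rw [mul_smul_comm]
  exact units_smul_tm B A _ _ _

theorem tensorAlg_end_ext {f g : Module.End K (TensorAlg B A)}
    (h : ∀ (p q : ℤ) (b : B.carrier) (a : A.carrier), b ∈ B.gr p → a ∈ A.gr q →
      f (tm b a) = g (tm b a)) : f = g := by
  refine LinearMap.ext fun x => ?_
  induction x using tensorAlg_induction with
  | hm p q b a hb ha => exact h p q b a hb ha
  | ha x y hx hy => rw [map_add, map_add, hx, hy]

theorem tensorOp_zero (m : ℤ) (b : B.carrier) : tensorOp (A := A) m b 0 = 0 :=
  tensorAlg_end_ext fun p q η x hη _ => by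
    rw [tensorOp_tm m b 0 hη x]
    have : tm (b * η) (0 : A.carrier) = 0 := TensorProduct.tmul_zero _ _
    rw [LinearMap.zero_apply, this, smul_zero, LinearMap.zero_apply]

/-- Commutators with pure tensors stay within the operators `tensorOp`, at the price of replacing b
by b b'. This is why `tensorOp` carries a factor b although only b = 1 is wanted. -/
theorem gradedCommutator_tensorOp_mulLeft {m β p q r : ℤ} {b b' : B.carrier} {a : A.carrier}
    {f : Module.End K A.carrier} (hb : b ∈ B.gr β) (hb' : b' ∈ B.gr p) (ha : a ∈ A.gr q)
    (h : p + q = r) :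
    gradedCommutator (β + m) r (tensorOp m b f) (LinearMap.mulLeft K (tm b' a))
      = (m * p).negOnePow • tensorOp (m + q) (b * b')
        (gradedCommutator m q f (LinearMap.mulLeft K a)) :=
  tensorAlg_end_ext fun s t η x hη hx => by
    subst h
    simp only [gradedCommutator, LinearMap.sub_apply, LinearMap.smul_apply, Module.End.mul_apply,
      LinearMap.mulLeft_apply]
    rw [tm_mul_tm _ _ _ ha hη, map_units_smul, tensorOp_tm m b f (SetLike.mul_mem_graded hb' hη),
      tensorOp_tm m b f hη, mul_smul_comm, tm_mul_tm _ _ _ ha (SetLike.mul_mem_graded hb hη),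
      tensorOp_tm _ _ _ hη]
    simp only [LinearMap.sub_apply, LinearMap.smul_apply, Module.End.mul_apply,
      LinearMap.mulLeft_apply]
    rw [tm_sub_right, tm_units_smul, ← mul_assoc b' b, B.graded_comm hb' hb, smul_mul_assoc,
      units_smul_tm, mul_assoc b b']
    simp only [smul_sub, smul_smul, ← Int.negOnePow_add]
    rw [negOnePow_congr (a := q * s + m * (p + s)) (b := m * p + (m + q) * s) ⟨0, by ring⟩,
      negOnePow_congr (a := (β + m) * (p + q) + (m * s + (q * (β + s) + p * β)))
        (b := m * p + ((m + q) * s + m * q)) ⟨β * p + β * q, by ring⟩]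

theorem gradedCommutator_mulLeft_add {R : Type v} [Ring R] [Algebra K R] (m s : ℤ)
    (f : Module.End K R) (x y : R) :
    gradedCommutator m s f (LinearMap.mulLeft K (x + y))
      = gradedCommutator m s f (LinearMap.mulLeft K x)
        + gradedCommutator m s f (LinearMap.mulLeft K y) := by
  have : LinearMap.mulLeft K (x + y) = LinearMap.mulLeft K x + LinearMap.mulLeft K y := by
    ext c; simp [add_mul]
  rw [this, gradedCommutator_add_right]

theorem hasDegree_tensorOp {m β : ℤ} {b : B.carrier} {f : Module.End K A.carrier}
    (hf : A.HasDegree m f) (hb : b ∈ B.gr β) :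
    (tensorAlg B A).HasDegree (β + m) (tensorOp m b f) := by
  intro r x hx
  refine tensorAlgGr_induction (P := fun x _ => tensorOp m b f x ∈ tensorAlgGr B A (β + m + r))
    ?_ ?_ hx
  · intro p q η a h hη ha
    rw [tensorOp_tm m b f hη]
    exact units_smul_mem _ _ (tm_mem (SetLike.mul_mem_graded hb hη) (hf _ _ ha) (by lia))
  · intro x y _ _ hx hy
    rw [map_add]
    exact add_mem hx hy

/-- The induction on the order runs over all b at once, since b changes when commutators are taken;
pure tensors suffice by additivity. -/
theorem isDiffOp_tensorOp {r : ℕ} {m β : ℤ} {b : B.carrier} {f : Module.End K A.carrier}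
    (hf : A.IsDiffOp r m f) (hb : b ∈ B.gr β) :
    (tensorAlg B A).IsDiffOp r (β + m) (tensorOp m b f) := by
  induction r generalizing m β b f with
  | zero =>
    refine ⟨hasDegree_tensorOp hf.hasDegree hb, fun s x hx => ?_⟩
    refine tensorAlgGr_induction (P := fun x _ =>
      gradedCommutator (β + m) s (tensorOp m b f) (LinearMap.mulLeft K x) = 0) ?_ ?_ hx
    · intro p q b' a h hb' ha
      rw [gradedCommutator_tensorOp_mulLeft hb hb' ha h, hf.commutator_eq_zero ha,
        tensorOp_zero, smul_zero]
    · intro x y _ _ hx hy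
      rw [gradedCommutator_mulLeft_add, hx, hy, add_zero]
  | succ r ih =>
    refine ⟨hasDegree_tensorOp hf.hasDegree hb, fun s x hx => ?_⟩
    refine tensorAlgGr_induction (P := fun x _ => (tensorAlg B A).IsDiffOp r (β + m + s)
      (gradedCommutator (β + m) s (tensorOp m b f) (LinearMap.mulLeft K x))) ?_ ?_ hx
    · intro p q b' a h hb' ha
      have e := gradedCommutator_tensorOp_mulLeft (f := f) (m := m) hb hb' ha h
      exact (congrArg ((tensorAlg B A).IsDiffOp r (β + m + s)) e).mpr
        (((ih (hf.commutator ha) (SetLike.mul_mem_graded hb hb')).units_smul _).congr_degree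
          (by lia))
    · intro x y _ _ hx hy
      have e := gradedCommutator_mulLeft_add (β + m) s (tensorOp m b f) x y
      exact (congrArg ((tensorAlg B A).IsDiffOp r (β + m + s)) e).mpr (hx.add hy)

theorem gradedCommutator_tensorOp_tensorOp (m n : ℤ) (f g : Module.End K A.carrier) :
    gradedCommutator m n (tensorOp (B := B) m 1 f) (tensorOp n 1 g)
      = tensorOp (m + n) 1 (gradedCommutator m n f g) :=
  tensorAlg_end_ext fun s t η x hη hx => by
    simp only [gradedCommutator, LinearMap.sub_apply, LinearMap.smul_apply, Module.End.mul_apply]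
    rw [tensorOp_tm n 1 g hη, tensorOp_tm m 1 f hη, tensorOp_tm _ _ _ hη, map_units_smul,
      map_units_smul, one_mul, tensorOp_tm n 1 g hη, tensorOp_tm m 1 f hη]
    simp only [LinearMap.sub_apply, LinearMap.smul_apply, Module.End.mul_apply, one_mul]
    rw [tm_sub_right, tm_units_smul]
    simp only [smul_sub, smul_smul, ← Int.negOnePow_add]
    rw [negOnePow_congr (a := n * s + m * s) (b := (m + n) * s) ⟨0, by ring⟩,
      negOnePow_congr (a := m * n + (m * s + n * s)) (b := (m + n) * s + m * n) ⟨0, by ring⟩]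

/-- As i has even degree, 1 ⊗ i commutes with the differential of B, and only its commutator with
the differential of A survives. -/
theorem lieOp_tensorOp (k : ℤ) (i : Module.End K A.carrier) :
    (tensorAlg B A).lieOp k (tensorOp (-(2 * k)) 1 i)
      = tensorOp (1 - 2 * k) 1 (A.lieOp k i) :=
  tensorAlg_end_ext fun p q η x hη hx => by
    have e : ((-(2 * k)) * 1).negOnePow = 1 := Int.negOnePow_even _ ⟨-k, by ring⟩
    have e' : ∀ s, (-(2 * k) * s).negOnePow = 1 := fun s => Int.negOnePow_even _ ⟨-k * s, by ring⟩
    change tensorOp (-(2 * k)) 1 i (tensorAlgD (tm η x))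
      - ((-(2 * k)) * 1).negOnePow • tensorAlgD (tensorOp (-(2 * k)) 1 i (tm η x)) = _
    have hl : A.lieOp k i x = i (A.d x) - A.d (i x) := by
      change i (A.d x) - ((-(2 * k)) * 1).negOnePow • A.d (i x) = _
      rw [e, one_smul]
    rw [tensorAlgD_tm hη, map_add, map_units_smul, tensorOp_tm _ _ _ (B.d_mem hη),
      tensorOp_tm _ _ _ hη, tensorOp_tm _ _ _ hη, map_units_smul, one_mul, one_mul,
      tensorAlgD_tm hη, e, e', e', tensorOp_tm _ _ _ hη, hl, tm_sub_right,
      negOnePow_congr (a := (1 - 2 * k) * p) (b := p) ⟨-k * p, by ring⟩, one_mul]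
    simp only [one_smul, smul_sub]
    abel

end operators

end CDGA

/-! ### Algebras of families inside a product. -/

namespace CDGA

variable {K : Type u} [Field K] {N : Type} (F : N → CDGA.{u, w} K)
  (C : Subalgebra K (∀ n, (F n).carrier))

/-- The families of degree `p` belonging to a subalgebra of a product of CDGAs. -/
def familyGr (p : ℤ) : Submodule K (∀ n, (F n).carrier) where
  carrier := {x | x ∈ C ∧ ∀ n, x n ∈ (F n).gr p}
  zero_mem' := ⟨zero_mem _, fun _ => zero_mem _⟩
  add_mem' hx hy := ⟨add_mem hx.1 hy.1, fun n => add_mem (hx.2 n) (hy.2 n)⟩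
  smul_mem' c _ hx := ⟨Subalgebra.smul_mem _ hx.1 c, fun n => Submodule.smul_mem _ c (hx.2 n)⟩

variable {F C}

theorem one_mem_familyGr : 1 ∈ familyGr F C 0 := ⟨one_mem C, fun _ => one_mem_gr⟩

theorem mul_mem_familyGr {p q : ℤ} {x y : ∀ n, (F n).carrier} (hx : x ∈ familyGr F C p)
    (hy : y ∈ familyGr F C q) : x * y ∈ familyGr F C (p + q) :=
  ⟨mul_mem hx.1 hy.1, fun n => SetLike.mul_mem_graded (hx.2 n) (hy.2 n)⟩

theorem mul_mem_iSup_familyGr {x y : ∀ n, (F n).carrier} (hx : x ∈ ⨆ p, familyGr F C p)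
    (hy : y ∈ ⨆ p, familyGr F C p) : x * y ∈ ⨆ p, familyGr F C p := by
  induction hx using Submodule.iSup_induction' with
  | zero => rw [zero_mul]; exact zero_mem _
  | add x x' _ _ hx hx' => rw [add_mul]; exact add_mem hx hx'
  | mem p x hx =>
    induction hy using Submodule.iSup_induction' with
    | mem q y hy => exact Submodule.mem_iSup_of_mem _ (mul_mem_familyGr hx hy)
    | zero => rw [mul_zero]; exact zero_mem _
    | add y y' _ _ hy hy' => rw [mul_add]; exact add_mem hy hy'

theorem iSupIndep_familyGr : iSupIndep (familyGr F C) := by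
  refine iSupIndep_of_separating (ι := Unit) (fun _ q => LinearMap.pi fun n =>
    Finsupp.lapply q ∘ₗ gradedSplit (F n).isInternal ∘ₗ LinearMap.proj n) ?_ ?_
  · intro _ p q x hx hpq
    refine funext fun n => ?_
    change gradedSplit (F n).isInternal (x n) q = 0
    rw [gradedSplit_apply _ (hx.2 n), Finsupp.single_eq_of_ne hpq.symm]
  · intro q x hx h
    refine funext fun n => ?_
    have : gradedSplit (F n).isInternal (x n) q = 0 := congrFun (h ()) n
    rwa [gradedSplit_apply _ (hx.2 n), Finsupp.single_eq_same] at this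

theorem iSup_familyGr_le : ⨆ p, familyGr F C p ≤ Subalgebra.toSubmodule C :=
  iSup_le fun _ _ hx => hx.1

variable (F C) in
/-- The algebra of finite sums of homogeneous families. -/
def familyAlg : Subalgebra K (∀ n, (F n).carrier) :=
  (⨆ p, familyGr F C p).toSubalgebra (Submodule.mem_iSup_of_mem 0 one_mem_familyGr)
    fun _ _ => mul_mem_iSup_familyGr

variable (F C) in
/-- The grading of `familyAlg`. -/
def familyAlgGr (p : ℤ) : Submodule K (familyAlg F C) :=
  (familyGr F C p).comap (familyAlg F C).val.toLinearMap

theorem familyAlgGr_isInternal : DirectSum.IsInternal (familyAlgGr F C) :=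
  isInternal_comap_iSup iSupIndep_familyGr

noncomputable instance familyAlgGraded : GradedAlgebra (familyAlgGr F C) :=
  { familyAlgGr_isInternal.chooseDecomposition with
    one_mem := one_mem_familyGr
    mul_mem := fun _ _ _ _ => mul_mem_familyGr }

variable (F) in
/-- Componentwise application of a family of linear maps. -/
def familyMap (φ : ∀ n, Module.End K (F n).carrier) : Module.End K (∀ n, (F n).carrier) :=
  LinearMap.pi fun n => φ n ∘ₗ LinearMap.proj n

theorem familyMap_mem {φ : ∀ n, Module.End K (F n).carrier} {m : ℤ}
    (hm : ∀ n, (F n).HasDegree m (φ n)) (hC : ∀ x ∈ C, familyMap F φ x ∈ C) {p : ℤ}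
    {x : ∀ n, (F n).carrier} (hx : x ∈ familyGr F C p) :
    familyMap F φ x ∈ familyGr F C (m + p) :=
  ⟨hC x hx.1, fun n => hm n _ _ (hx.2 n)⟩

/-- Componentwise application of a family of homogeneous linear maps preserving `C`. -/
def familyAlgMap (φ : ∀ n, Module.End K (F n).carrier) (m : ℤ)
    (hm : ∀ n, (F n).HasDegree m (φ n)) (hC : ∀ x ∈ C, familyMap F φ x ∈ C) :
    Module.End K (familyAlg F C) :=
  (familyMap F φ).restrict (p := ⨆ p, familyGr F C p) (q := ⨆ p, familyGr F C p) (by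
    intro x hx
    induction hx using Submodule.iSup_induction' with
    | mem p x hx => exact Submodule.mem_iSup_of_mem _ (familyMap_mem hm hC hx)
    | zero => rw [map_zero]; exact zero_mem _
    | add x y _ _ hx hy => rw [map_add]; exact add_mem hx hy)

theorem hasDegree_d (A : CDGA.{u, v} K) : A.HasDegree 1 A.d := fun p _ ha =>
  add_comm p 1 ▸ A.d_mem ha

variable (F C) in
/-- The CDGA of finite sums of homogeneous families belonging to a differential subalgebra of a
product of CDGAs. -/
noncomputable def family (hC : ∀ x ∈ C, familyMap F (fun n => (F n).d) x ∈ C) :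
    CDGA.{u, w} K where
  carrier := familyAlg F C
  gr := familyAlgGr F C
  d := familyAlgMap (fun n => (F n).d) 1 (fun n => hasDegree_d (F n)) hC
  d_mem := fun hx => ⟨hC _ hx.1, fun n => (F n).d_mem (hx.2 n)⟩
  d_d := fun _ => Subtype.ext (funext fun n => (F n).d_d _)
  d_mul := fun hx _ => Subtype.ext (funext fun n => (F n).d_mul (hx.2 n) _)
  graded_comm := fun hx hy => Subtype.ext (funext fun n => (F n).graded_comm (hx.2 n) (hy.2 n))

variable (hC : ∀ x ∈ C, familyMap F (fun n => (F n).d) x ∈ C)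

/-- The components of a family. -/
noncomputable def familyProj (n : N) : Hom (family F C hC) (F n) where
  toAlgHom := (Pi.evalAlgHom K (fun n => (F n).carrier) n).comp (familyAlg F C).val
  map_mem := fun hx => hx.2 n
  map_d := fun _ => rfl

theorem family_ext {x y : (family F C hC).carrier}
    (h : ∀ n, (familyProj hC n).toAlgHom x = (familyProj hC n).toAlgHom y) : x = y :=
  Subtype.ext (funext h)

theorem mem_family_gr {p : ℤ} {x : (family F C hC).carrier}
    (h : ∀ n, (familyProj hC n).toAlgHom x ∈ (F n).gr p) : x ∈ (family F C hC).gr p :=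
  ⟨iSup_familyGr_le x.2, h⟩

theorem familyProj_gradedCommutator {Φ Ψ : Module.End K (family F C hC).carrier}
    {φ ψ : ∀ n, Module.End K (F n).carrier}
    (hΦ : ∀ n x, (familyProj hC n).toAlgHom (Φ x) = φ n ((familyProj hC n).toAlgHom x))
    (hΨ : ∀ n x, (familyProj hC n).toAlgHom (Ψ x) = ψ n ((familyProj hC n).toAlgHom x))
    (p q : ℤ) (n : N) (x : (family F C hC).carrier) :
    (familyProj hC n).toAlgHom (gradedCommutator p q Φ Ψ x)
      = gradedCommutator p q (φ n) (ψ n) ((familyProj hC n).toAlgHom x) := by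
  have e : ∀ (A : CDGA.{u, w} K) (f g : Module.End K A.carrier) (a : A.carrier),
      gradedCommutator p q f g a = f (g a) - ((p * q).negOnePow : ℤ) • g (f a) :=
    fun _ _ _ _ => rfl
  rw [e, e, map_sub, map_zsmul, hΦ, hΨ, hΨ, hΦ]

/-- An operator that is componentwise a differential operator of order `≤ r` is one. -/
theorem isDiffOp_family {r : ℕ} {m : ℤ} {Φ : Module.End K (family F C hC).carrier}
    {φ : ∀ n, Module.End K (F n).carrier}
    (hΦ : ∀ n x, (familyProj hC n).toAlgHom (Φ x) = φ n ((familyProj hC n).toAlgHom x))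
    (h : ∀ n, (F n).IsDiffOp r m (φ n)) : (family F C hC).IsDiffOp r m Φ := by
  have hdeg : (family F C hC).HasDegree m Φ := fun p x hx =>
    mem_family_gr hC fun n => by rw [hΦ]; exact (h n).hasDegree _ _ ((familyProj hC n).map_mem hx)
  have hmul : ∀ (a : (family F C hC).carrier) n x,
      (familyProj hC n).toAlgHom (LinearMap.mulLeft K a x)
        = LinearMap.mulLeft K ((familyProj hC n).toAlgHom a) ((familyProj hC n).toAlgHom x) :=
    fun a n x => map_mul (familyProj hC n).toAlgHom a x
  induction r generalizing m Φ φ with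
  | zero =>
    refine ⟨hdeg, fun p a ha => LinearMap.ext fun x => family_ext hC fun n => ?_⟩
    rw [familyProj_gradedCommutator hC hΦ (hmul a),
      (h n).commutator_eq_zero ((familyProj hC n).map_mem ha), LinearMap.zero_apply,
      LinearMap.zero_apply, map_zero]
  | succ r ih =>
    refine ⟨hdeg, fun p a ha => ?_⟩
    -- Commutators of families are componentwise, so the inductive hypothesis applies to the family
    -- of commutators.
    have h' := fun n => (h n).commutator ((familyProj hC n).map_mem ha)
    have hc := familyProj_gradedCommutator hC hΦ (hmul a) m p
    exact ih hc h' fun q x hx => mem_family_gr hC fun n => by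
      rw [hc]; exact (h' n).hasDegree _ _ ((familyProj hC n).map_mem hx)

theorem isQuasiBV_family {m : ℤ} {Φ : Module.End K (family F C hC).carrier}
    {φ : ∀ n, Module.End K (F n).carrier}
    (hΦ : ∀ n x, (familyProj hC n).toAlgHom (Φ x) = φ n ((familyProj hC n).toAlgHom x))
    (h : ∀ n, (F n).IsQuasiBV m (φ n)) : (family F C hC).IsQuasiBV m Φ :=
  ⟨isDiffOp_family hC hΦ fun n => (h n).1, family_ext hC fun n => by
    rw [hΦ, map_one, map_zero, (h n).2]⟩

theorem isQuasiBV_tensorOp {B : CDGA.{u, w} K} {A : CDGA.{u, v} K} {m : ℤ}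
    {f : Module.End K A.carrier} (hf : A.IsQuasiBV m f) :
    (tensorAlg B A).IsQuasiBV m (tensorOp m 1 f) := by
  refine ⟨(isDiffOp_tensorOp hf.1 one_mem_gr).congr_degree (zero_add m), ?_⟩
  have h : tm (1 * 1 : B.carrier) (0 : A.carrier) = 0 := TensorProduct.tmul_zero _ _
  have : tensorOp m 1 f (tm (1 : B.carrier) 1) = 0 := by
    rw [tensorOp_tm m 1 f one_mem_gr, hf.2, h, smul_zero]
  exact this

end CDGA

/-! ### The derived bracket commutes with tensor products. -/

namespace CDGA

open TensorProduct

variable {K : Type u} [Field K]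

section comparison

variable {B : CDGA.{u, w} K} {A : CDGA.{u, v} K} {k : ℤ} {i : Module.End K A.carrier}
  (h : (A.koszulData k i).IsDGLA)

theorem tensorGr_koszul_le {r : ℤ} {x : B.carrier ⊗[K] A.carrier}
    (hx : x ∈ tensorGr B (A.koszul k i h) r) : x ∈ tensorAlgGr B A (2 * k - 1 + r) := by
  refine tensorGr_induction (L := A.koszul k i h)
    (P := fun x _ => x ∈ tensorAlgGr B A (2 * k - 1 + r)) ?_ ?_ hx
  · intro p q b a hr hb ha
    exact tm_mem hb (show a ∈ A.gr (2 * k - 1 + q) from ha) (by lia)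
  · intro x y _ _ hx hy
    exact add_mem hx hy

theorem tensorAlgGr_le_tensorGr_koszul {r : ℤ} {x : TensorAlg B A}
    (hx : x ∈ tensorAlgGr B A (2 * k - 1 + r)) : x ∈ tensorGr B (A.koszul k i h) r := by
  refine tensorAlgGr_induction (P := fun x _ => x ∈ tensorGr B (A.koszul k i h) r) ?_ ?_ hx
  · intro p q b a hr hb ha
    have ha' : a ∈ (A.koszul k i h).gr (q - (2 * k - 1)) :=
      show a ∈ A.gr (2 * k - 1 + (q - (2 * k - 1))) by rwa [add_sub_cancel]
    exact tmul_mem_tensorGr (L := A.koszul k i h) hb ha' (by lia)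
  · intro x y _ _ hx hy
    exact add_mem hx hy

theorem tensorD_koszul (x : TensorAlg B A) : tensorD B (A.koszul k i h) x = tensorAlgD x := by
  refine tensorAlg_induction (P := fun x => tensorD B (A.koszul k i h) x = tensorAlgD x) ?_ ?_ x
  · intro p q b a hb ha
    exact (tensorD_tmul (L := A.koszul k i h) hb a).trans (tensorAlgD_tm hb a).symm
  · intro x y hx hy
    exact (map_add (tensorD B (A.koszul k i h)) x y).trans
      ((congrArg₂ (· + ·) hx hy).trans (map_add (tensorAlgD (B := B) (A := A)) x y).symm)

/-- The sign is the Koszul sign of moving b' past a in its shifted degree: as l is odd, the shift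
makes a of parity q + 1. -/
theorem bracketOf_tensorOp_tm {l : Module.End K A.carrier} {m p p' q : ℤ} (hm : m.negOnePow = -1)
    (hl : A.HasDegree m l) {b b' : B.carrier} {a : A.carrier} (hb : b ∈ B.gr p)
    (hb' : b' ∈ B.gr p') (ha : a ∈ A.gr q) (a' : A.carrier) :
    (tensorAlg B A).bracketOf (tensorOp m 1 l) (tm b a) (tm b' a')
      = ((q + 1) * p').negOnePow • tm (b * b') (A.bracketOf l a a') := by
  have hodd : Odd m := by
    rcases Int.even_or_odd m with h | h
    · rw [Int.negOnePow_even _ h] at hm; exact absurd hm (by decide)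
    · exact h
  obtain ⟨c, rfl⟩ := hodd
  refine ((tensorAlg B A).bracketOf_apply (tensorOp (2 * c + 1) 1 l) (tm_mem hb ha rfl)
    (tm b' a')).trans ?_
  change (p + q).negOnePow • (tensorOp (2 * c + 1) 1 l (tm b a * tm b' a')
    - tensorOp (2 * c + 1) 1 l (tm b a) * tm b' a')
    - tm b a * tensorOp (2 * c + 1) 1 l (tm b' a') = _
  rw [A.bracketOf_apply l ha, tm_mul_tm _ _ _ ha hb', map_units_smul,
    tensorOp_tm _ _ _ (SetLike.mul_mem_graded hb hb'), tensorOp_tm _ _ _ hb, tensorOp_tm _ _ _ hb',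
    one_mul, one_mul, one_mul, smul_mul_assoc, mul_smul_comm, tm_mul_tm _ _ _ (hl _ _ ha) hb',
    tm_mul_tm _ _ _ ha hb', tm_sub_right, tm_units_smul, tm_sub_right]
  simp only [smul_sub, smul_smul, ← Int.negOnePow_add]
  rw [negOnePow_congr (a := p + q + (q * p' + (2 * c + 1) * (p + p'))) (b := (q + 1) * p' + q)
      ⟨c * (p + p') + p, by ring⟩,
    negOnePow_congr (a := p + q + ((2 * c + 1) * p + (2 * c + 1 + q) * p'))
      (b := (q + 1) * p' + q) ⟨c * p + p + c * p', by ring⟩,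
    negOnePow_congr (a := (2 * c + 1) * p' + q * p') (b := (q + 1) * p') ⟨c * p', by ring⟩]

/-- Bilinearity reduces this to `bracketOf_tensorOp_tm`; the shifted degree q - (2k - 1) has the
parity of q + 1, so the two Koszul signs agree. -/
theorem tensorBracket_koszul (hi : A.HasDegree (1 - 2 * k) (A.lieOp k i)) (x y : TensorAlg B A) :
    tensorBracket B (A.koszul k i h) x y
      = (tensorAlg B A).bracketOf (tensorOp (1 - 2 * k) 1 (A.lieOp k i)) x y := by
  refine tensorAlg_induction (P := fun x => tensorBracket B (A.koszul k i h) x y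
    = (tensorAlg B A).bracketOf (tensorOp (1 - 2 * k) 1 (A.lieOp k i)) x y) ?_ ?_ x
  · intro p q b a hb ha
    refine tensorAlg_induction (P := fun y => tensorBracket B (A.koszul k i h) (tm b a) y
      = (tensorAlg B A).bracketOf (tensorOp (1 - 2 * k) 1 (A.lieOp k i)) (tm b a) y) ?_ ?_ y
    · intro p' q' b' a' hb' ha'
      have ha₀ : a ∈ (A.koszul k i h).gr (q - (2 * k - 1)) :=
        show a ∈ A.gr (2 * k - 1 + (q - (2 * k - 1))) by rwa [add_sub_cancel]
      refine (tensorBracket_tmul (L := A.koszul k i h) b ha₀ hb' a').trans ?_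
      refine Eq.trans ?_ (bracketOf_tensorOp_tm (Int.negOnePow_odd _ ⟨-k, by ring⟩) hi hb hb' ha
        a').symm
      rw [negOnePow_congr (a := (q - (2 * k - 1)) * p') (b := (q + 1) * p') ⟨-k * p', by ring⟩]
      rfl
    · intro y y' hy hy'
      exact (map_add (tensorBracket B (A.koszul k i h) (tm b a)) y y').trans
        ((congrArg₂ (· + ·) hy hy').trans (map_add ((tensorAlg B A).bracketOf
          (tensorOp (1 - 2 * k) 1 (A.lieOp k i)) (tm b a)) y y').symm)
  · intro x x' hx hx'
    exact (LinearMap.map_add₂ (tensorBracket B (A.koszul k i h)) x x' y).trans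
      ((congrArg₂ (· + ·) hx hx').trans (LinearMap.map_add₂ ((tensorAlg B A).bracketOf
        (tensorOp (1 - 2 * k) 1 (A.lieOp k i))) x x' y).symm)

end comparison

end CDGA

/-! ### Naturality of the operators, and isomorphisms of complexes. -/

namespace CDGA

section functoriality

variable {K : Type u} [Field K] {B B' : CDGA.{u, w} K} {A A' : CDGA.{u, v} K}

theorem tensorAlgMap_tensorOp (f : Hom B B') (g : Hom A A') {i : Module.End K A.carrier}
    {j : Module.End K A'.carrier} (h : ∀ a, j (g.toAlgHom a) = g.toAlgHom (i a)) (m : ℤ)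
    (x : TensorAlg B A) :
    tensorOp m 1 j (tensorAlgLinearMap f g x) = tensorAlgLinearMap f g (tensorOp m 1 i x) := by
  refine tensorAlg_induction (P := fun x => tensorOp m 1 j (tensorAlgLinearMap f g x)
    = tensorAlgLinearMap f g (tensorOp m 1 i x)) ?_ ?_ x
  · intro p q b a hb _
    rw [tensorAlgLinearMap_tm, tensorOp_tm _ _ _ (f.map_mem hb), tensorOp_tm _ _ _ hb,
      map_units_smul, tensorAlgLinearMap_tm, one_mul, one_mul, h]
  · intro x y hx hy
    simp only [map_add, hx, hy]

end functoriality

end CDGA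

/-- Such a morphism is an isomorphism of complexes, so primitives can be lifted and differentials
compared directly. -/
theorem DGLA.Hom.isQuasiIso_of_injective {K : Type u} [Field K] {L : DGLA.{u, v} K}
    {M : DGLA.{u, w} K} (f : Hom L M) (inj : Function.Injective f.toLinearMap)
    (surj : ∀ p y, y ∈ M.gr p → ∃ x ∈ L.gr p, f.toLinearMap x = y) : f.IsQuasiIso := by
  refine isQuasiIso_of f ?_ ?_
  · intro p y hy hdy
    obtain ⟨x, hx, rfl⟩ := surj p y hy
    refine ⟨x, hx, inj ?_, 0, zero_mem _, ?_⟩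
    · rw [f.map_d, hdy, map_zero]
    · rw [map_zero, sub_self]
  · intro p x hx hdx w hw hdw
    obtain ⟨z, hz, rfl⟩ := surj (p - 1) w hw
    exact ⟨z, hz, inj ((f.map_d z).trans hdw)⟩

/-! ### The totalization as the DGLA of one algebra. -/

namespace Totalization

open CDGA

variable {K : Type u} [Field K] (A : CosimplicialObject (CDGA.{u, v} K))

/-- The factor `Ωₙ ⊗ Aₙ` of the totalization of a cosimplicial CDGA. -/
noncomputable def algFactor (n : SimplexCategory) : CDGA.{u, max u v} K :=
  tensorAlg ((polyForms K).obj (Opposite.op n)) (A.obj n)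

/-- The algebra of compatible families. -/
noncomputable def algCompatible : Subalgebra K (∀ n, (algFactor A n).carrier) where
  carrier := {x | ∀ (m n : SimplexCategory) (φ : m ⟶ n),
    (tensorAlgMap ((polyForms K).map φ.op) (𝟙 (A.obj n))).toAlgHom (x n)
      = (tensorAlgMap (𝟙 ((polyForms K).obj (Opposite.op m))) (A.map φ)).toAlgHom (x m)}
  mul_mem' hx hy m n φ := (map_mul _ _ _).trans ((congrArg₂ (· * ·) (hx m n φ) (hy m n φ)).trans
    (map_mul _ _ _).symm)
  add_mem' hx hy m n φ := (map_add _ _ _).trans ((congrArg₂ (· + ·) (hx m n φ) (hy m n φ)).trans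
    (map_add _ _ _).symm)
  algebraMap_mem' r _ _ _ := (AlgHom.commutes _ r).trans (AlgHom.commutes _ r).symm

theorem d_algCompatible : ∀ x ∈ algCompatible A,
    familyMap (algFactor A) (fun n => (algFactor A n).d) x ∈ algCompatible A :=
  fun _ hx m n φ => ((tensorAlgMap _ _).map_d _).trans ((congrArg _ (hx m n φ)).trans
    ((tensorAlgMap _ _).map_d _).symm)

/-- The totalization of a cosimplicial CDGA. -/
noncomputable def algTot : CDGA.{u, max u v} K :=
  family (algFactor A) (algCompatible A) (d_algCompatible A)

variable {A} {k : ℤ} {i : ∀ n : SimplexCategory, Module.End K (A.obj n).carrier}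

theorem tensorOp_algCompatible
    (hi : ∀ (m n : SimplexCategory) (φ : m ⟶ n) (a : (A.obj m).carrier),
      i n ((A.map φ).toAlgHom a) = (A.map φ).toAlgHom (i m a)) (r : ℤ) :
    ∀ x ∈ algCompatible A,
      familyMap (algFactor A) (fun n => tensorOp r 1 (i n)) x ∈ algCompatible A :=
  fun x hx m n φ =>
    (tensorAlgMap_tensorOp ((polyForms K).map φ.op) (𝟙 (A.obj n)) (fun _ => rfl) r (x n)).symm.trans
      ((congrArg (tensorOp r 1 (i n)) (hx m n φ)).trans
        (tensorAlgMap_tensorOp (𝟙 ((polyForms K).obj (Opposite.op m))) (A.map φ) (hi m n φ) r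
          (x m)))

theorem hasDegree_tensorOp_algFactor {r : ℤ} (h : ∀ n, (A.obj n).HasDegree r (i n))
    (n : SimplexCategory) : (algFactor A n).HasDegree r (tensorOp r 1 (i n)) := by
  have := hasDegree_tensorOp (B := (polyForms K).obj (Opposite.op n)) (h n) one_mem_gr
  rwa [zero_add] at this

variable (hi : ∀ (m n : SimplexCategory) (φ : m ⟶ n) (a : (A.obj m).carrier),
    i n ((A.map φ).toAlgHom a) = (A.map φ).toAlgHom (i m a))
  (hBV : ∀ n, (A.obj n).IsQuasiBV (-(2 * k)) (i n))

/-- The operator induced by `i` on the totalization. -/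
noncomputable def totOp : Module.End K (algTot A).carrier :=
  familyAlgMap (fun n => tensorOp (-(2 * k)) 1 (i n)) (-(2 * k))
    (hasDegree_tensorOp_algFactor fun n => (hBV n).1.hasDegree)
    (tensorOp_algCompatible hi (-(2 * k)))

theorem proj_lieOp_totOp (n : SimplexCategory) (x : (algTot A).carrier) :
    (familyProj (d_algCompatible A) n).toAlgHom ((algTot A).lieOp k (totOp hi hBV) x)
      = tensorOp (1 - 2 * k) 1 ((A.obj n).lieOp k (i n))
        ((familyProj (d_algCompatible A) n).toAlgHom x) :=
  ((familyProj (d_algCompatible A) n).map_lieOp k (i := totOp hi hBV)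
    (j := tensorOp (-(2 * k)) 1 (i n)) (fun _ => rfl) x).symm.trans
    (LinearMap.congr_fun (lieOp_tensorOp k (i n)) _)

theorem isQuasiBV_totOp : (algTot A).IsQuasiBV (-(2 * k)) (totOp hi hBV) :=
  isQuasiBV_family (d_algCompatible A) (φ := fun n => tensorOp (-(2 * k)) 1 (i n))
    (fun _ _ => rfl) fun n => isQuasiBV_tensorOp (hBV n)

theorem isQuasiBV_gradedCommutator_totOp
    (hlBV : ∀ n, (A.obj n).IsQuasiBV (1 - 2 * k + -(2 * k))
      (gradedCommutator (1 - 2 * k) (-(2 * k)) ((A.obj n).lieOp k (i n)) (i n))) :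
    (algTot A).IsQuasiBV (1 - 2 * k + -(2 * k))
      (gradedCommutator (1 - 2 * k) (-(2 * k)) ((algTot A).lieOp k (totOp hi hBV))
        (totOp hi hBV)) :=
  isQuasiBV_family (d_algCompatible A)
    (φ := fun n => tensorOp (1 - 2 * k + -(2 * k)) 1
      (gradedCommutator (1 - 2 * k) (-(2 * k)) ((A.obj n).lieOp k (i n)) (i n)))
    (fun n x => (familyProj_gradedCommutator (d_algCompatible A)
        (φ := fun n => tensorOp (1 - 2 * k) 1 ((A.obj n).lieOp k (i n)))
        (ψ := fun n => tensorOp (-(2 * k)) 1 (i n))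
        (proj_lieOp_totOp hi hBV) (fun _ _ => rfl) (1 - 2 * k) (-(2 * k)) n x).trans
      (LinearMap.congr_fun (gradedCommutator_tensorOp_tensorOp _ _ _ _) _))
    fun n => isQuasiBV_tensorOp (hlBV n)

section comparison

variable (h : ∀ n, ((A.obj n).koszulData k (i n)).IsDGLA)

/-- The compatibility equations on the two sides coincide, because the cosimplicial DGLA has the
structure maps of A; only the degree has to be shifted. -/
theorem degree_le_familyGr {p : ℤ}
    {x : ∀ n, (factor (koszulCosimplicial A k i hi h) n).carrier}
    (hx : x ∈ degree (koszulCosimplicial A k i hi h) p) :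
    x ∈ familyGr (algFactor A) (algCompatible A) (2 * k - 1 + p) :=
  ⟨fun m n φ => hx.1 m n φ, fun n => tensorGr_koszul_le (h n) (hx.2 n)⟩

theorem familyGr_le_degree {p : ℤ} {x : ∀ n, (algFactor A n).carrier}
    (hx : x ∈ familyGr (algFactor A) (algCompatible A) (2 * k - 1 + p)) :
    x ∈ degree (koszulCosimplicial A k i hi h) p :=
  ⟨fun m n φ => hx.1 m n φ, fun n => tensorAlgGr_le_tensorGr_koszul (h n) (hx.2 n)⟩

theorem iSup_degree_le {x : ∀ n, (factor (koszulCosimplicial A k i hi h) n).carrier}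
    (hx : x ∈ ⨆ p, degree (koszulCosimplicial A k i hi h) p) :
    x ∈ familyAlg (algFactor A) (algCompatible A) := by
  induction hx using Submodule.iSup_induction' with
  | mem p x hx =>
    exact Submodule.mem_iSup_of_mem (p := familyGr (algFactor A) (algCompatible A)) _
      (degree_le_familyGr hi h hx)
  | zero => exact zero_mem (familyAlg (algFactor A) (algCompatible A))
  | add x y _ _ hx hy => exact (familyAlg (algFactor A) (algCompatible A)).add_mem hx hy

/-- The linear map underlying `totHom`. -/
noncomputable def totLinearMap : (tot (koszulCosimplicial A k i hi h)).carrier →ₗ[K]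
    familyAlg (algFactor A) (algCompatible A) where
  toFun x := ⟨x.1, iSup_degree_le hi h x.2⟩
  map_add' _ _ := rfl
  map_smul' _ _ := rfl

theorem totLinearMap_d (x : (tot (koszulCosimplicial A k i hi h)).carrier) :
    totLinearMap hi h ((tot (koszulCosimplicial A k i hi h)).d x)
      = (algTot A).d (totLinearMap hi h x) :=
  Subtype.ext (funext fun n => tensorD_koszul (h n) (x.1 n))

theorem totLinearMap_bracket (x y : (tot (koszulCosimplicial A k i hi h)).carrier) :
    totLinearMap hi h ((tot (koszulCosimplicial A k i hi h)).bracket x y)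
      = (algTot A).bracketOf ((algTot A).lieOp k (totOp hi hBV)) (totLinearMap hi h x)
        (totLinearMap hi h y) := by
  refine family_ext (d_algCompatible A) fun n => ?_
  refine Eq.trans ?_ ((familyProj (d_algCompatible A) n).map_bracketOf
        (l := (algTot A).lieOp k (totOp hi hBV))
        (l' := tensorOp (1 - 2 * k) 1 ((A.obj n).lieOp k (i n)))
        (fun x => (proj_lieOp_totOp hi hBV n x).symm) _ _).symm
  exact tensorBracket_koszul (h n) (lieOp_isDiffOp (hBV n)).hasDegree (x.1 n) (y.1 n)

/-- The totalization of the DGLAs `Aₙ[2k-1]` maps identically to the DGLA associated with the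
totalization of the algebras `Aₙ`. -/
noncomputable def totHom (hT : ((algTot A).koszulData k (totOp hi hBV)).IsDGLA) :
    DGLA.Hom (tot (koszulCosimplicial A k i hi h)) ((algTot A).koszul k (totOp hi hBV) hT) where
  toLinearMap := totLinearMap hi h
  map_mem := fun hx => degree_le_familyGr hi h hx
  map_d := totLinearMap_d hi h
  map_bracket := totLinearMap_bracket hi hBV h

theorem totLinearMap_apply (x : (tot (koszulCosimplicial A k i hi h)).carrier)
    (n : SimplexCategory) : (totLinearMap hi h x).1 n = x.1 n := rfl

theorem totLinearMap_injective : Function.Injective (totLinearMap hi h) := by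
  intro x y hxy
  refine Subtype.ext (funext fun n => ?_)
  have e := totLinearMap_apply hi h x n
  rw [hxy, totLinearMap_apply hi h y n] at e
  exact e.symm

theorem exists_totLinearMap_eq {p : ℤ} {y : familyAlg (algFactor A) (algCompatible A)}
    (hy : y ∈ familyAlgGr (algFactor A) (algCompatible A) (2 * k - 1 + p)) :
    ∃ x ∈ (tot (koszulCosimplicial A k i hi h)).gr p, totLinearMap hi h x = y :=
  ⟨⟨y.1, Submodule.mem_iSup_of_mem p (familyGr_le_degree hi h hy)⟩,
    familyGr_le_degree hi h hy, rfl⟩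

theorem totHom_isQuasiIso (hT : ((algTot A).koszulData k (totOp hi hBV)).IsDGLA) :
    (totHom hi hBV h hT).IsQuasiIso :=
  DGLA.Hom.isQuasiIso_of_injective _ (totLinearMap_injective hi h)
    fun _ _ hy => exists_totLinearMap_eq hi h hy

end comparison

end Totalization

theorem corollary4p9 {K : Type u} [Field K] [CharZero K]
    (A : CosimplicialObject (CDGA.{u, v} K)) (k : ℤ)
    (i : ∀ n : SimplexCategory, Module.End K (A.obj n).carrier)
    (hi : ∀ (m n : SimplexCategory) (φ : m ⟶ n) (a : (A.obj m).carrier),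
      i n ((A.map φ).toAlgHom a) = (A.map φ).toAlgHom (i m a))
    (hBV : ∀ n, (A.obj n).IsQuasiBV (-(2 * k)) (i n))
    (hlBV : ∀ n, (A.obj n).IsQuasiBV (1 - 2 * k + -(2 * k))
      (gradedCommutator (1 - 2 * k) (-(2 * k)) ((A.obj n).lieOp k (i n)) (i n))) :
    ∃ h : ∀ n, ((A.obj n).koszulData k (i n)).IsDGLA,
      (Totalization.tot (CDGA.koszulCosimplicial A k i hi h)).IsHomotopyAbelian := by
  have hT := Totalization.isQuasiBV_totOp hi hBV
  have hlT := Totalization.isQuasiBV_gradedCommutator_totOp hi hBV hlBV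
  have h := fun n => CDGA.koszulData_isDGLA (hBV n) (hlBV n)
  -- The result for one algebra, applied to `Totalization.algTot`; `totHom` supplies the remaining
  -- quasi-isomorphism.
  obtain ⟨M, hM, hTM⟩ := CDGA.koszul_isHomotopyAbelian.{u, v} _ hT hlT
  exact ⟨h, M, hM, .trans _ _ _ (.rel _ _ ⟨_, Totalization.totHom_isQuasiIso hi hBV h _⟩) hTM⟩
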